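/- Let $R$ be an integral domain of characteristic zero with fraction field $K$, and let $G(X,Y)=(G^{(1)},\dots,G^{(m)})$ be an $m$-dimensional formal group law over $R$, i.e. $G^{(j)}\in R[[X,Y]]$, $G^{(j)}=X_j+Y_j+\sum_{l,k}\gamma^j_{lk}X_lY_k+O(\deg\ge 3)$ and $G(G(X,Y),Z)=G(X,G(Y,Z))$. Let $\mathfrak g$ be its Lie algebra, free over $R$ on $e_1,\dots,e_m$ with $[e_l,e_k]=\sum_j(\gamma^j_{lk}-\gamma^j_{kl})e_j$, let $U=\mathcal U(\mathfrak g)$ be its universal enveloping algebra with its usual Hopf algebra structure, and $U^*=\mathrm{Hom}_R(U,R)$. Let $$\tilde{\mathcal O}(G)=\Big\{\sum_{j\in\mathbb N^m} b_j t^j\in K[[t_1,\dots,t_m]] : j!\,b_j\in R \text{ for all } j\Big\},\qquad j!=\prod_i j_i!,$$ filtered by total degree ($F^n$ = series all of whose monomials have degree $\ge n$). There is a tuple $s(X)$ of power series over $R$ with $s(0)=0$ and $G(X,s(X))=0$; the ordered monomials $e^j=e_1^{j_1}\cdots e_m^{j_m}$ form a basis of $U$ (write $d^jt$ for the dual elements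 of $U^*$, and $F^nU^*$ for the functionals that vanish on all $e^j$ with $|j|<n$). Moreover: 1. $\tilde{\mathcal O}(G)$ is a complete Hopf algebra, with the multiplication and unit of power series, comultiplication $f\mapsto f(G(X,Y))$, counit $f\mapsto f(0)$ and antipode $f\mapsto f(s(X))$; here $\tilde{\mathcal O}(G)^{\hat\otimes n}$ is the analogous modified power series ring in $n$ sets of $m$ variables. Likewise $U^*$ is a complete Hopf algebra, with the transposes of the structure maps of $U$; here $(U^*)^{\hat\otimes n}=(U^{\otimes n})^*$. 2. The map $\tilde\alpha^*:\tilde{\mathcal O}(G)\to U^*$ induced by the pairing $L\otimes f\mapsto L(f)=\sum_j L_j\,\frac{\partial f}{\partial t_j}(0)$ of $\mathfrak g$ with $\tilde{\mathcal O}(G)$, that is $$\tilde\alpha^*(f)(L_1L_2\cdots L_k)=(L_1*L_2*\cdots*L_k)(f)\qquad(k\ge 0,\ L_i\in\mathfrak g),$$ where $\varphi*\psi=(\varphi\hat\otimes\psi)\circ\mu$, $\mu(f)=f(G(X,Y))$, and the empty product is $f\mapsto f(0)$, is well defined with values in $U^*$ and is an isomorphism of complete Hopf algebras (a linear homeomorphism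 that commutes with all structure maps). 3. For all $n$ and $f$: $f\in F^n\tilde{\mathcal O}(G)$ if and only if $\tilde\alpha^*(f)\in F^nU^*$; and $\tilde\alpha^*(t^j)\equiv j!\,d^jt \mod F^{|j|+1}U^*$ for every $j\in\mathbb N^m$. -/

import Mathlib

open MvPowerSeries TensorProduct

section chainRule
open MvPowerSeries.WithPiTopology

theorem continuous_pderiv_aux {R : Type*} [CommRing R] [TopologicalSpace R] [IsTopologicalRing R]
    {σ : Type*} (i : σ) : Continuous (fun f : MvPowerSeries σ R => pderiv R i f) := by
  refine continuous_pi fun d => ?_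
  have h : (fun f : MvPowerSeries σ R => (pderiv R i f) d) =
      fun f => coeff (d + Finsupp.single i 1) f * ((d i : R) + 1) := by
    funext f
    exact coeff_pderiv f d
  rw [h]
  exact (continuous_coeff R _).mul continuous_const

theorem pderiv_subst_eq_sum {R : Type*} [CommRing R] {σ τ : Type*} [Fintype σ]
    {a : σ → MvPowerSeries τ R} (ha : HasSubst a) (k : τ) (f : MvPowerSeries σ R) :
    pderiv R k (subst a f) = ∑ i, subst a (pderiv R i f) * pderiv R k (a i) := by
  classical
  let _ : UniformSpace R := ⊥
  have _ : DiscreteTopology R := ⟨rfl⟩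
  have _ : DiscreteUniformity R := ⟨rfl⟩
  have h : (fun f : MvPowerSeries σ R => pderiv R k (subst a f)) =
      fun f => ∑ i, subst a (pderiv R i f) * pderiv R k (a i) := by
    refine DenseRange.equalizer (denseRange_toMvPowerSeries (σ := σ) (R := R)) ?_ ?_ ?_
    · exact (continuous_pderiv_aux k).comp (continuous_subst ha)
    · exact continuous_finsetSum _ fun i _ =>
        ((continuous_subst ha).comp (continuous_pderiv_aux i)).mul continuous_const
    · funext p
      simp only [Function.comp]
      induction p using MvPolynomial.induction_on with
      | C r =>
        simp only [MvPolynomial.coe_C, pderiv_C, ← coe_substAlgHom ha, map_zero, zero_mul,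
          Finset.sum_const_zero]
        have : substAlgHom ha (C r) = C r := by
          rw [coe_substAlgHom ha]
          simp
        rw [this, pderiv_C]
      | add p q hp hq =>
        simp only [MvPolynomial.coe_add, ← coe_substAlgHom ha, map_add, add_mul,
          Finset.sum_add_distrib] at hp hq ⊢
        rw [hp, hq]
      | mul_X p i hp =>
        simp only [MvPolynomial.coe_mul, MvPolynomial.coe_X, ← coe_substAlgHom ha, map_mul,
          Derivation.leibniz, smul_eq_mul, map_add, add_mul, Finset.sum_add_distrib] at hp ⊢
        rw [hp, substAlgHom_X ha, Finset.mul_sum]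
        congr 1
        · rw [Finset.sum_eq_single i]
          · rw [pderiv_X_self, map_one, mul_one]
          · intro j _ hj
            rw [pderiv_X_of_ne hj.symm, map_zero, mul_zero, zero_mul]
          · simp
        · exact Finset.sum_congr rfl fun j _ => by ring
  exact congrFun h f

end chainRule

theorem pderiv_comm_aux {R : Type*} [CommRing R] {σ : Type*} (i j : σ) (f : MvPowerSeries σ R) :
    pderiv R i (pderiv R j f) = pderiv R j (pderiv R i f) := by
  classical
  by_cases h : i = j
  · rw [h]
  ext d
  simp only [coeff_pderiv, Finsupp.add_apply, Finsupp.single_eq_of_ne h,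
    Finsupp.single_eq_of_ne (Ne.symm h), add_zero]
  rw [add_right_comm]
  ring

theorem constantCoeff_subst_of_zero {R : Type*} [CommRing R] {σ τ : Type*} [Finite σ]
    {a : σ → MvPowerSeries τ R} (ha : ∀ i, constantCoeff (a i) = 0) (g : MvPowerSeries σ R) :
    constantCoeff (subst a g) = constantCoeff g := by
  have hs : HasSubst a := hasSubst_of_constantCoeff_zero ha
  have h1 : constantCoeff (subst a (g - C (constantCoeff g))) = 0 :=
    constantCoeff_subst_eq_zero hs ha (by simp)
  rw [subst_sub hs, map_sub] at h1
  simpa [sub_eq_zero] using h1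

/-- Second derivatives at the origin of a composite series. -/
theorem constantCoeff_pderiv_pderiv_subst {R : Type*} [CommRing R] {σ τ : Type*} [Fintype σ]
    {a : σ → MvPowerSeries τ R} (ha : ∀ i, constantCoeff (a i) = 0) (x y : τ)
    (f : MvPowerSeries σ R) :
    constantCoeff (pderiv R x (pderiv R y (subst a f))) =
      (∑ i, ∑ i', constantCoeff (pderiv R i' (pderiv R i f)) *
        constantCoeff (pderiv R x (a i')) * constantCoeff (pderiv R y (a i))) +
      ∑ i, constantCoeff (pderiv R i f) * constantCoeff (pderiv R x (pderiv R y (a i))) := by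
  have hs : HasSubst a := hasSubst_of_constantCoeff_zero ha
  have h0 := constantCoeff_subst_of_zero ha
  rw [pderiv_subst_eq_sum hs]
  simp only [map_sum, Derivation.leibniz, smul_eq_mul, map_add, map_mul, h0,
    Finset.sum_add_distrib, pderiv_subst_eq_sum hs]
  rw [add_comm]
  congr 1
  refine Finset.sum_congr rfl fun i _ => ?_
  rw [Finset.mul_sum]
  exact Finset.sum_congr rfl fun i' _ => by ring

/-- An `m`-dimensional formal group law over `R`: power series `G j` in variables
`X = (X (inl i))` and `Y = (X (inr i))` with
`G j = X_j + Y_j + ∑ γ l k X_l Y_k + O(degree ≥ 3)` and `G (G (X, Y), Z) = G (X, G (Y, Z))`. -/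
structure FormalGroupLaw (R : Type*) [CommRing R] (m : ℕ) where
  toSeries : Fin m → MvPowerSeries (Fin m ⊕ Fin m) R
  expansion : ∀ j, ∃ γ : Fin m → Fin m → R, ∀ d : Fin m ⊕ Fin m →₀ ℕ, d.degree < 3 →
    coeff d (toSeries j) = coeff d (X (Sum.inl j) + X (Sum.inr j) +
      ∑ l, ∑ k, C (γ l k) * (X (Sum.inl l) * X (Sum.inr k)))
  assoc : ∀ j,
    subst (Sum.elim
      (fun i => subst (fun v => (X (Sum.inl v) : MvPowerSeries ((Fin m ⊕ Fin m) ⊕ Fin m) R))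
        (toSeries i))
      (fun i => X (Sum.inr i))) (toSeries j) =
    subst (Sum.elim
      (fun i => (X (Sum.inl (Sum.inl i)) : MvPowerSeries ((Fin m ⊕ Fin m) ⊕ Fin m) R))
      (fun i => subst (Sum.elim (fun v => X (Sum.inl (Sum.inr v))) (fun v => X (Sum.inr v)))
        (toSeries i))) (toSeries j)

namespace FormalGroupLaw

variable {R : Type*} [CommRing R] {m : ℕ} (G : FormalGroupLaw R m)

/-- `G.γ j l k` is the coefficient of `X_l Y_k` in `G j`. -/
noncomputable def γ (j l k : Fin m) : R :=
  coeff (Finsupp.single (Sum.inl l) 1 + Finsupp.single (Sum.inr k) 1) (G.toSeries j)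

theorem constantCoeff_toSeries (j : Fin m) : constantCoeff (G.toSeries j) = 0 := by
  obtain ⟨γ, h⟩ := G.expansion j
  rw [← coeff_zero_eq_constantCoeff_apply, h 0 (by simp)]
  simp

theorem constantCoeff_pderiv_inl (j l : Fin m) :
    constantCoeff (pderiv R (Sum.inl l) (G.toSeries j)) = if l = j then 1 else 0 := by
  classical
  obtain ⟨γ, h⟩ := G.expansion j
  rw [← coeff_zero_eq_constantCoeff_apply, coeff_pderiv, h _ (by simp [Finsupp.degree_single])]
  have := coeff_pderiv (i := Sum.inl l) (X (Sum.inl j) + X (Sum.inr j) +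
      ∑ l, ∑ k, C (γ l k) * (X (Sum.inl l) * X (Sum.inr k)) : MvPowerSeries (Fin m ⊕ Fin m) R) 0
  rw [← this]
  simp [map_sum, Derivation.leibniz, pderiv_X, Pi.single_apply, eq_comm]
  
theorem constantCoeff_pderiv_inr (j l : Fin m) :
    constantCoeff (pderiv R (Sum.inr l) (G.toSeries j)) = if l = j then 1 else 0 := by
  classical
  obtain ⟨γ, h⟩ := G.expansion j
  rw [← coeff_zero_eq_constantCoeff_apply, coeff_pderiv, h _ (by simp [Finsupp.degree_single])]
  have := coeff_pderiv (i := Sum.inr l) (X (Sum.inl j) + X (Sum.inr j) +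
      ∑ l, ∑ k, C (γ l k) * (X (Sum.inl l) * X (Sum.inr k)) : MvPowerSeries (Fin m ⊕ Fin m) R) 0
  rw [← this]
  simp [map_sum, Derivation.leibniz, pderiv_X, Pi.single_apply, eq_comm]

theorem γ_eq (j l k : Fin m) : G.γ j l k =
    constantCoeff (pderiv R (Sum.inl l) (pderiv R (Sum.inr k) (G.toSeries j))) := by
  rw [← coeff_zero_eq_constantCoeff_apply, coeff_pderiv, coeff_pderiv, γ]
  simp

theorem γ_assoc (j l k n : Fin m) :
    constantCoeff (pderiv R (Sum.inl l) (pderiv R (Sum.inl k)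
      (pderiv R (Sum.inr n) (G.toSeries j)))) + ∑ i, G.γ j i n * G.γ i l k =
    constantCoeff (pderiv R (Sum.inr k) (pderiv R (Sum.inr n)
      (pderiv R (Sum.inl l) (G.toSeries j)))) + ∑ i, G.γ j l i * G.γ i k n := by
  classical
  have c := G.constantCoeff_toSeries
  let e₁ : Fin m ⊕ Fin m → MvPowerSeries ((Fin m ⊕ Fin m) ⊕ Fin m) R := fun v => X (Sum.inl v)
  have he₁ : ∀ v, constantCoeff (e₁ v) = 0 := fun v => by simp [e₁]
  have hs₁ : HasSubst e₁ := hasSubst_of_constantCoeff_zero he₁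
  let e₂ : Fin m ⊕ Fin m → MvPowerSeries ((Fin m ⊕ Fin m) ⊕ Fin m) R :=
    Sum.elim (fun v => X (Sum.inl (Sum.inr v))) (fun v => X (Sum.inr v))
  have he₂ : ∀ v, constantCoeff (e₂ v) = 0 := by rintro (v | v) <;> simp [e₂]
  have hs₂ : HasSubst e₂ := hasSubst_of_constantCoeff_zero he₂
  let a : Fin m ⊕ Fin m → MvPowerSeries ((Fin m ⊕ Fin m) ⊕ Fin m) R :=
    Sum.elim (fun i => subst e₁ (G.toSeries i)) (fun i => X (Sum.inr i))
  have ha : ∀ v, constantCoeff (a v) = 0 := by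
    rintro (v | v)
    · exact constantCoeff_subst_eq_zero hs₁ he₁ (c v)
    · simp [a]
  have hsa : HasSubst a := hasSubst_of_constantCoeff_zero ha
  let b : Fin m ⊕ Fin m → MvPowerSeries ((Fin m ⊕ Fin m) ⊕ Fin m) R :=
    Sum.elim (fun i => X (Sum.inl (Sum.inl i))) (fun i => subst e₂ (G.toSeries i))
  have hb : ∀ v, constantCoeff (b v) = 0 := by
    rintro (v | v)
    · simp [b]
    · exact constantCoeff_subst_eq_zero hs₂ he₂ (c v)
  have hsb : HasSubst b := hasSubst_of_constantCoeff_zero hb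
  have key : subst a (G.toSeries j) = subst b (G.toSeries j) := G.assoc j
  have L : pderiv R (Sum.inr n) (subst a (G.toSeries j)) =
      subst a (pderiv R (Sum.inr n) (G.toSeries j)) := by
    rw [pderiv_subst_eq_sum hsa, Fintype.sum_sum_type]
    simp [a, e₁, pderiv_subst_eq_sum hs₁, pderiv_X, Pi.single_apply]
  have Rr : pderiv R (Sum.inl (Sum.inl l)) (subst b (G.toSeries j)) =
      subst b (pderiv R (Sum.inl l) (G.toSeries j)) := by
    rw [pderiv_subst_eq_sum hsb, Fintype.sum_sum_type]
    simp [b, e₂, pderiv_subst_eq_sum hs₂, pderiv_X, Pi.single_apply]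
  have key2 : constantCoeff (pderiv R (Sum.inl (Sum.inl l)) (pderiv R (Sum.inl (Sum.inr k))
        (pderiv R (Sum.inr n) (subst a (G.toSeries j))))) =
      constantCoeff (pderiv R (Sum.inl (Sum.inr k)) (pderiv R (Sum.inr n)
        (pderiv R (Sum.inl (Sum.inl l)) (subst b (G.toSeries j))))) := by
    rw [key, pderiv_comm_aux (Sum.inl (Sum.inl l)), pderiv_comm_aux (Sum.inl (Sum.inl l))]
  rw [L, Rr, constantCoeff_pderiv_pderiv_subst ha, constantCoeff_pderiv_pderiv_subst hb] at key2
  have E₁ : ∀ i, constantCoeff (pderiv R (Sum.inl (Sum.inl l)) (pderiv R (Sum.inl (Sum.inr k))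
      (subst e₁ (G.toSeries i)))) = G.γ i l k := by
    intro i
    rw [constantCoeff_pderiv_pderiv_subst he₁, γ_eq]
    simp [e₁, pderiv_X, Pi.single_apply, apply_ite]
  have E₂ : ∀ i, constantCoeff (pderiv R (Sum.inl (Sum.inr k)) (pderiv R (Sum.inr n)
      (subst e₂ (G.toSeries i)))) = G.γ i k n := by
    intro i
    rw [constantCoeff_pderiv_pderiv_subst he₂, γ_eq]
    simp [e₂, pderiv_X, Pi.single_apply, apply_ite]
  simp only [Fintype.sum_sum_type, a, b, Sum.elim_inl, Sum.elim_inr, E₁, E₂] at key2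
  simp [e₁, e₂, pderiv_subst_eq_sum hs₁, pderiv_subst_eq_sum hs₂, constantCoeff_subst_of_zero he₁,
    constantCoeff_subst_of_zero he₂, constantCoeff_pderiv_inl, constantCoeff_pderiv_inr,
    pderiv_X, Pi.single_apply, apply_ite] at key2
  have hγ : ∀ i, G.γ j l i =
      constantCoeff (pderiv R (Sum.inr i) (pderiv R (Sum.inl l) (G.toSeries j))) := fun i => by
    rw [γ_eq, pderiv_comm_aux]
  simpa only [hγ, G.γ_eq j _ n] using key2

/-- The bilinear part `∑ γ l k x_l y_k` of the formal group law. -/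
noncomputable def bilin (x y : Fin m → R) : Fin m → R :=
  fun j => ∑ l, ∑ k, G.γ j l k * (x l * y k)

theorem bilin_sub_left (x x' y : Fin m → R) :
    G.bilin (x - x') y = G.bilin x y - G.bilin x' y := by
  funext j
  simp [bilin, sub_mul, mul_sub]

theorem bilin_sub_right (x y y' : Fin m → R) :
    G.bilin x (y - y') = G.bilin x y - G.bilin x y' := by
  funext j
  simp [bilin, mul_sub]

theorem bilin_assoc (x y z : Fin m → R) (j : Fin m) :
    (∑ l, ∑ k, ∑ n, constantCoeff (pderiv R (Sum.inl l) (pderiv R (Sum.inl k)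
      (pderiv R (Sum.inr n) (G.toSeries j)))) * (x l * y k * z n)) +
      G.bilin (G.bilin x y) z j =
    (∑ l, ∑ k, ∑ n, constantCoeff (pderiv R (Sum.inr k) (pderiv R (Sum.inr n)
      (pderiv R (Sum.inl l) (G.toSeries j)))) * (x l * y k * z n)) +
      G.bilin x (G.bilin y z) j := by
  have h₁ : G.bilin (G.bilin x y) z j =
      ∑ l, ∑ k, ∑ n, (∑ i, G.γ j i n * G.γ i l k) * (x l * y k * z n) := by
    simp only [bilin, Finset.sum_mul, Finset.mul_sum]
    rw [Finset.sum_comm, Finset.sum_congr rfl fun n _ => (Finset.sum_comm.trans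
      (Finset.sum_congr rfl fun l _ => Finset.sum_comm)), Finset.sum_comm]
    refine Finset.sum_congr rfl fun l _ => ?_
    rw [Finset.sum_comm]
    exact Finset.sum_congr rfl fun k _ => Finset.sum_congr rfl fun n _ =>
      Finset.sum_congr rfl fun i _ => by ring
  have h₂ : G.bilin x (G.bilin y z) j =
      ∑ l, ∑ k, ∑ n, (∑ i, G.γ j l i * G.γ i k n) * (x l * y k * z n) := by
    simp only [bilin, Finset.sum_mul, Finset.mul_sum]
    refine Finset.sum_congr rfl fun l _ => ?_
    rw [Finset.sum_comm]
    refine Finset.sum_congr rfl fun k _ => ?_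
    rw [Finset.sum_comm]
    exact Finset.sum_congr rfl fun n _ => Finset.sum_congr rfl fun i _ => by ring
  rw [h₁, h₂]
  simp only [← Finset.sum_add_distrib, ← add_mul, G.γ_assoc]

theorem bilin_jacobi (x y z : Fin m → R) :
    G.bilin x (G.bilin y z - G.bilin z y) - G.bilin (G.bilin y z - G.bilin z y) x =
      (G.bilin (G.bilin x y - G.bilin y x) z - G.bilin z (G.bilin x y - G.bilin y x)) +
      (G.bilin y (G.bilin x z - G.bilin z x) - G.bilin (G.bilin x z - G.bilin z x) y) := by
  funext j
  let S : (Fin m → R) → (Fin m → R) → (Fin m → R) → R := fun x y z =>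
    ∑ l, ∑ k, ∑ n, constantCoeff (pderiv R (Sum.inl l) (pderiv R (Sum.inl k)
      (pderiv R (Sum.inr n) (G.toSeries j)))) * (x l * y k * z n)
  let T : (Fin m → R) → (Fin m → R) → (Fin m → R) → R := fun x y z =>
    ∑ l, ∑ k, ∑ n, constantCoeff (pderiv R (Sum.inr k) (pderiv R (Sum.inr n)
      (pderiv R (Sum.inl l) (G.toSeries j)))) * (x l * y k * z n)
  have hS : ∀ x y z, S x y z = S y x z := by
    intro x y z
    simp only [S]
    rw [Finset.sum_comm]
    exact Finset.sum_congr rfl fun k _ => Finset.sum_congr rfl fun l _ =>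
      Finset.sum_congr rfl fun n _ => by rw [pderiv_comm_aux (Sum.inl l) (Sum.inl k)]; ring
  have hT : ∀ x y z, T x y z = T x z y := by
    intro x y z
    simp only [T]
    refine Finset.sum_congr rfl fun l _ => ?_
    rw [Finset.sum_comm]
    exact Finset.sum_congr rfl fun k _ => Finset.sum_congr rfl fun n _ => by
      rw [pderiv_comm_aux (Sum.inr n) (Sum.inr k)]; ring
  have E : ∀ x y z, S x y z + G.bilin (G.bilin x y) z j = T x y z + G.bilin x (G.bilin y z) j :=
    fun x y z => G.bilin_assoc x y z j
  simp only [bilin_sub_left, bilin_sub_right, Pi.sub_apply, Pi.add_apply]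
  linear_combination -E x y z + E y x z + E x z y - E y z x - E z x y + E z y x
    + hS x y z - hS x z y + hS y z x - hT x y z + hT y x z - hT z x y

/-- The Lie algebra of `G`: the free module on `e_1, …, e_m`, with
`⁅e_l, e_k⁆ = ∑ j, (γ j l k - γ j k l) e_j`. -/
def LieAlg (_G : FormalGroupLaw R m) : Type _ := Fin m → R

noncomputable instance : AddCommGroup G.LieAlg := inferInstanceAs (AddCommGroup (Fin m → R))

noncomputable instance : Module R G.LieAlg := inferInstanceAs (Module R (Fin m → R))

noncomputable instance : Bracket G.LieAlg G.LieAlg where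
  bracket x y := fun j => ∑ l, ∑ k, (G.γ j l k - G.γ j k l) * (x l * y k)

theorem bracket_eq (x y : G.LieAlg) : ⁅x, y⁆ = (G.bilin x y - G.bilin y x : Fin m → R) := by
  funext j
  change ∑ l, ∑ k, (G.γ j l k - G.γ j k l) * (x l * y k) = _
  simp only [bilin, Pi.sub_apply, sub_mul, Finset.sum_sub_distrib]
  congr 1
  rw [Finset.sum_comm]
  exact Finset.sum_congr rfl fun k _ => Finset.sum_congr rfl fun l _ => by ring

noncomputable instance : LieRing G.LieAlg where
  add_lie x y z := by
    funext j
    change ∑ l, ∑ k, (G.γ j l k - G.γ j k l) * ((x l + y l) * z k) =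
      ∑ l, ∑ k, (G.γ j l k - G.γ j k l) * (x l * z k) +
      ∑ l, ∑ k, (G.γ j l k - G.γ j k l) * (y l * z k)
    simp only [add_mul, mul_add, Finset.sum_add_distrib]
  lie_add x y z := by
    funext j
    change ∑ l, ∑ k, (G.γ j l k - G.γ j k l) * (x l * (y k + z k)) =
      ∑ l, ∑ k, (G.γ j l k - G.γ j k l) * (x l * y k) +
      ∑ l, ∑ k, (G.γ j l k - G.γ j k l) * (x l * z k)
    simp only [mul_add, Finset.sum_add_distrib]
  lie_self x := by
    rw [bracket_eq]
    exact sub_self _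
  leibniz_lie x y z := by
    rw [bracket_eq G x ⁅y, z⁆, bracket_eq G ⁅x, y⁆ z, bracket_eq G y ⁅x, z⁆, bracket_eq G y z,
      bracket_eq G x y, bracket_eq G x z]
    exact G.bilin_jacobi x y z

noncomputable instance : LieAlgebra R G.LieAlg where
  lie_smul t x y := by
    funext j
    change ∑ l, ∑ k, (G.γ j l k - G.γ j k l) * (x l * (t * y k)) =
      t * ∑ l, ∑ k, (G.γ j l k - G.γ j k l) * (x l * y k)
    simp only [Finset.mul_sum]
    exact Finset.sum_congr rfl fun l _ => Finset.sum_congr rfl fun k _ => by ring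

/-- The basis vector `e_i`. -/
def e (i : Fin m) : G.LieAlg := (Pi.single i 1 : Fin m → R)

end FormalGroupLaw

/-! ### Complete filtered modules, completed tensor products, complete Hopf algebras -/

section CompleteHopf

variable {R : Type*} [CommRing R]

/-- `M` is complete (and separated) for the topology given by the descending filtration `F`. -/
structure IsCompleteFiltration {M : Type*} [AddCommGroup M] [Module R M]
    (F : ℕ → Submodule R M) : Prop where
  zero : F 0 = ⊤
  antitone : Antitone F
  separated : ⨅ n, F n = ⊥
  complete : ∀ u : ℕ → M, (∀ n, u (n + 1) - u n ∈ F n) → ∃ x, ∀ n, x - u n ∈ F n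

/-- Continuity of a linear map for the topologies given by two filtrations. -/
def IsFilCont {M N : Type*} [AddCommGroup M] [Module R M] [AddCommGroup N] [Module R N]
    (F : ℕ → Submodule R M) (F' : ℕ → Submodule R N) (f : M →ₗ[R] N) : Prop :=
  ∀ n, ∃ k, ∀ x ∈ F k, f x ∈ F' n

/-- The filtration `∑_{i + j = n} F^i M ⊗ F^j N` of `M ⊗ N`. -/
def tensorFil {M N : Type*} [AddCommGroup M] [Module R M] [AddCommGroup N] [Module R N]
    (F : ℕ → Submodule R M) (F' : ℕ → Submodule R N) (n : ℕ) : Submodule R (M ⊗[R] N) :=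
  ⨆ (i : ℕ) (j : ℕ) (_ : i + j = n), Submodule.map₂ (TensorProduct.mk R M N) (F i) (F' j)

/-- The bilinear map `t : M × N → P` exhibits the filtered module `P` as the completed tensor
product of `M` and `N`: `P` is complete, and `t` induces isomorphisms
`(M ⊗ N) / F^n (M ⊗ N) ≃ P / F^n P` for all `n`, so that `P = lim (M ⊗ N) / F^n (M ⊗ N)`. -/
structure IsCompletedTensor {M N P : Type*} [AddCommGroup M] [Module R M]
    [AddCommGroup N] [Module R N] [AddCommGroup P] [Module R P]
    (F : ℕ → Submodule R M) (F' : ℕ → Submodule R N) (F'' : ℕ → Submodule R P)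
    (t : M →ₗ[R] N →ₗ[R] P) : Prop where
  complete : IsCompleteFiltration F''
  surjective : ∀ n (p : P), ∃ z : M ⊗[R] N, p - TensorProduct.lift t z ∈ F'' n
  injective : ∀ n (z : M ⊗[R] N), TensorProduct.lift t z ∈ F'' n ↔ z ∈ tensorFil F F' n

/-- The structure maps of a complete Hopf algebra: a filtered module `H`, models `H₂` and `H₃` of
`H ⊗̂ H` and `H ⊗̂ H ⊗̂ H` with the maps `H × H → H₂`, `H₂ × H → H₃` and `H × H₂ → H₃` given by
pure tensors, and multiplication, unit, comultiplication, counit and antipode. -/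
structure CompleteHopfData (R H H₂ H₃ : Type*) [CommRing R] [AddCommGroup H] [Module R H]
    [AddCommGroup H₂] [Module R H₂] [AddCommGroup H₃] [Module R H₃] where
  fil : ℕ → Submodule R H
  fil₂ : ℕ → Submodule R H₂
  fil₃ : ℕ → Submodule R H₃
  tmul : H →ₗ[R] H →ₗ[R] H₂
  tmulLeft : H₂ →ₗ[R] H →ₗ[R] H₃
  tmulRight : H →ₗ[R] H₂ →ₗ[R] H₃
  mul : H₂ →ₗ[R] H
  unit : R →ₗ[R] H
  comul : H →ₗ[R] H₂
  counit : H →ₗ[R] R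
  antipode : H →ₗ[R] H

/-- The axioms of a complete Hopf algebra. A continuous map with prescribed values on pure tensors
is unique, so the continuous maps whose existence is required below are the completed tensor
products `μ ⊗̂ 1`, `1 ⊗̂ μ`, `ε ⊗̂ 1`, `1 ⊗̂ ε`, `s ⊗̂ 1`, `1 ⊗̂ s`, and the multiplication of
`H ⊗̂ H`. -/
structure CompleteHopfData.IsCompleteHopfAlgebra {R H H₂ H₃ : Type*} [CommRing R]
    [AddCommGroup H] [Module R H] [AddCommGroup H₂] [Module R H₂] [AddCommGroup H₃] [Module R H₃]
    (A : CompleteHopfData R H H₂ H₃) : Prop where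
  complete : IsCompleteFiltration A.fil
  isTensor : IsCompletedTensor A.fil A.fil A.fil₂ A.tmul
  isTensorLeft : IsCompletedTensor A.fil₂ A.fil A.fil₃ A.tmulLeft
  isTensorRight : IsCompletedTensor A.fil A.fil₂ A.fil₃ A.tmulRight
  tmul_assoc : ∀ x y z, A.tmulLeft (A.tmul x y) z = A.tmulRight x (A.tmul y z)
  mul_cont : IsFilCont A.fil₂ A.fil A.mul
  comul_cont : IsFilCont A.fil A.fil₂ A.comul
  counit_cont : ∃ k, ∀ x ∈ A.fil k, A.counit x = 0
  antipode_cont : IsFilCont A.fil A.fil A.antipode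
  mul_assoc : ∀ x y z,
    A.mul (A.tmul (A.mul (A.tmul x y)) z) = A.mul (A.tmul x (A.mul (A.tmul y z)))
  one_mul : ∀ x, A.mul (A.tmul (A.unit 1) x) = x
  mul_one : ∀ x, A.mul (A.tmul x (A.unit 1)) = x
  coassoc : ∃ cl cr : H₂ →ₗ[R] H₃, IsFilCont A.fil₂ A.fil₃ cl ∧ IsFilCont A.fil₂ A.fil₃ cr ∧
    (∀ x y, cl (A.tmul x y) = A.tmulLeft (A.comul x) y) ∧
    (∀ x y, cr (A.tmul x y) = A.tmulRight x (A.comul y)) ∧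
    ∀ x, cl (A.comul x) = cr (A.comul x)
  counit_comul : ∃ c : H₂ →ₗ[R] H, IsFilCont A.fil₂ A.fil c ∧
    (∀ x y, c (A.tmul x y) = A.counit x • y) ∧ ∀ x, c (A.comul x) = x
  comul_counit : ∃ c : H₂ →ₗ[R] H, IsFilCont A.fil₂ A.fil c ∧
    (∀ x y, c (A.tmul x y) = A.counit y • x) ∧ ∀ x, c (A.comul x) = x
  counit_one : A.counit (A.unit 1) = 1
  counit_mul : ∀ x y, A.counit (A.mul (A.tmul x y)) = A.counit x * A.counit y
  comul_one : A.comul (A.unit 1) = A.tmul (A.unit 1) (A.unit 1)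
  comul_mul : ∃ m₂ : H₂ →ₗ[R] H₂ →ₗ[R] H₂,
    (∀ n, ∃ k, ∀ a ∈ A.fil₂ k, ∀ b, m₂ a b ∈ A.fil₂ n ∧ m₂ b a ∈ A.fil₂ n) ∧
    (∀ x y x' y', m₂ (A.tmul x y) (A.tmul x' y') =
      A.tmul (A.mul (A.tmul x x')) (A.mul (A.tmul y y'))) ∧
    ∀ x y, A.comul (A.mul (A.tmul x y)) = m₂ (A.comul x) (A.comul y)
  antipode_left : ∃ c : H₂ →ₗ[R] H₂, IsFilCont A.fil₂ A.fil₂ c ∧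
    (∀ x y, c (A.tmul x y) = A.tmul (A.antipode x) y) ∧
    ∀ x, A.mul (c (A.comul x)) = A.unit (A.counit x)
  antipode_right : ∃ c : H₂ →ₗ[R] H₂, IsFilCont A.fil₂ A.fil₂ c ∧
    (∀ x y, c (A.tmul x y) = A.tmul x (A.antipode y)) ∧
    ∀ x, A.mul (c (A.comul x)) = A.unit (A.counit x)

/-- `Φ` is an isomorphism of complete Hopf algebras: a linear homeomorphism which commutes with all
structure maps; `Φ₂` is `Φ ⊗̂ Φ`. -/
structure CompleteHopfData.IsIso {R H H₂ H₃ H' H₂' H₃' : Type*} [CommRing R]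
    [AddCommGroup H] [Module R H] [AddCommGroup H₂] [Module R H₂] [AddCommGroup H₃] [Module R H₃]
    [AddCommGroup H'] [Module R H'] [AddCommGroup H₂'] [Module R H₂']
    [AddCommGroup H₃'] [Module R H₃']
    (A : CompleteHopfData R H H₂ H₃) (B : CompleteHopfData R H' H₂' H₃') (Φ : H ≃ₗ[R] H') :
    Prop where
  cont : IsFilCont A.fil B.fil Φ.toLinearMap
  cont_symm : IsFilCont B.fil A.fil Φ.symm.toLinearMap
  map_mul_comul : ∃ Φ₂ : H₂ →ₗ[R] H₂', IsFilCont A.fil₂ B.fil₂ Φ₂ ∧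
    (∀ x y, Φ₂ (A.tmul x y) = B.tmul (Φ x) (Φ y)) ∧
    (∀ z, Φ (A.mul z) = B.mul (Φ₂ z)) ∧
    ∀ x, Φ₂ (A.comul x) = B.comul (Φ x)
  map_unit : ∀ r, Φ (A.unit r) = B.unit r
  map_counit : ∀ x, B.counit (Φ x) = A.counit x
  map_antipode : ∀ x, Φ (A.antipode x) = B.antipode (Φ x)

end CompleteHopf

/-! ### The modified ring of functions -/

section Modified

variable (R K : Type*) [CommRing R] [Field K] [Algebra R K]

/-- `j! = ∏ i, (j i)!`. -/
def multiFactorial {σ : Type*} [Fintype σ] (j : σ →₀ ℕ) : ℕ := ∏ i, (j i).factorial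

theorem multiFactorial_add_single {σ : Type*} [Fintype σ] (j : σ →₀ ℕ) (k : σ) :
    multiFactorial (j + Finsupp.single k 1) = multiFactorial j * (j k + 1) := by
  classical
  unfold multiFactorial
  rw [← Finset.mul_prod_erase _ _ (Finset.mem_univ k),
    ← Finset.mul_prod_erase _ (fun i => (j i).factorial) (Finset.mem_univ k)]
  have : ∀ i ∈ Finset.univ.erase k, ((j + Finsupp.single k 1 : σ →₀ ℕ) i).factorial = (j i).factorial := by
    intro i hi
    simp [Finsupp.single_eq_of_ne (Finset.ne_of_mem_erase hi)]
  rw [Finset.prod_congr rfl this]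
  simp [Nat.factorial_succ]
  ring

theorem multiFactorial_dvd {σ : Type*} [Fintype σ] (p q : σ →₀ ℕ) :
    multiFactorial p * multiFactorial q ∣ multiFactorial (p + q) := by
  unfold multiFactorial
  rw [← Finset.prod_mul_distrib]
  exact Finset.prod_dvd_prod_of_dvd _ _ fun i _ => Nat.factorial_mul_factorial_dvd_factorial_add _ _

/-- The modified power series ring `{∑ b_j t^j ∈ K[[t]] : j! b_j ∈ R}`. -/
def modifiedSeries (σ : Type*) [Fintype σ] : Subalgebra R (MvPowerSeries σ K) where
  carrier := {f | ∀ j, (multiFactorial j : K) * coeff j f ∈ (algebraMap R K).range}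
  add_mem' := by
    intro f g hf hg j
    rw [map_add, mul_add]
    exact add_mem (hf j) (hg j)
  mul_mem' := by
    classical
    intro f g hf hg j
    rw [coeff_mul, Finset.mul_sum]
    refine sum_mem fun p hp => ?_
    obtain ⟨c, hc⟩ := multiFactorial_dvd p.1 p.2
    rw [Finset.HasAntidiagonal.mem_antidiagonal.1 hp] at hc
    have : (multiFactorial j : K) * (coeff p.1 f * coeff p.2 g) =
        (c : K) * ((multiFactorial p.1 * coeff p.1 f) * (multiFactorial p.2 * coeff p.2 g)) := by
      rw [hc]
      push_cast
      ring
    rw [this]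
    exact mul_mem (natCast_mem _ c) (mul_mem (hf _) (hg _))
  algebraMap_mem' := by
    classical
    intro r j
    refine mul_mem (natCast_mem _ _) ?_
    rw [MvPowerSeries.algebraMap_apply, coeff_C]
    split_ifs
    · exact ⟨r, rfl⟩
    · exact zero_mem _

theorem subst_mem_modifiedSeries {σ τ : Type*} [Fintype σ] [Fintype τ]
    {a : σ → MvPowerSeries τ R} (ha : ∀ i, constantCoeff (a i) = 0) {f : MvPowerSeries σ K}
    (hf : f ∈ modifiedSeries R K σ) :
    subst (fun i => map (algebraMap R K) (a i)) f ∈ modifiedSeries R K τ := by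
  classical
  have ha' : ∀ i, constantCoeff (map (algebraMap R K) (a i)) = 0 := fun i => by
    rw [constantCoeff_map, ha, map_zero]
  have hs : HasSubst fun i => map (algebraMap R K) (a i) := hasSubst_of_constantCoeff_zero ha'
  have key : ∀ N : ℕ, ∀ f ∈ modifiedSeries R K σ, ∀ j : τ →₀ ℕ, j.degree ≤ N →
      (multiFactorial j : K) * coeff j (subst (fun i => map (algebraMap R K) (a i)) f) ∈
        (algebraMap R K).range := by
    intro N
    induction N with
    | zero =>
      intro f hf j hj
      have hj0 : j = 0 := (Finsupp.degree_eq_zero_iff j).1 (Nat.le_zero.1 hj)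
      subst hj0
      rw [coeff_zero_eq_constantCoeff_apply, constantCoeff_subst_of_zero ha']
      simpa [multiFactorial] using hf 0
    | succ N ih =>
      intro f hf j hj
      by_cases hj0 : j = 0
      · exact ih f hf j (by simp [hj0])
      obtain ⟨k, hk⟩ : ∃ k, j k ≠ 0 := Finsupp.ne_iff.1 hj0
      obtain ⟨d, rfl⟩ : ∃ d : τ →₀ ℕ, j = d + Finsupp.single k 1 :=
        ⟨j - Finsupp.single k 1, (tsub_add_cancel_of_le (by
          rw [Finsupp.single_le_iff]; exact Nat.one_le_iff_ne_zero.2 hk)).symm⟩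
      have hd : d.degree ≤ N := by
        rw [map_add, Finsupp.degree_single] at hj
        omega
      have h : (multiFactorial (d + Finsupp.single k 1) : K) * coeff (d + Finsupp.single k 1)
          (subst (fun i => map (algebraMap R K) (a i)) f) = multiFactorial d * coeff d
            (pderiv K k (subst (fun i => map (algebraMap R K) (a i)) f)) := by
        rw [coeff_pderiv, multiFactorial_add_single]
        push_cast
        ring
      rw [h, pderiv_subst_eq_sum hs, map_sum, Finset.mul_sum]
      refine sum_mem fun i _ => ?_
      rw [coeff_mul, Finset.mul_sum]
      refine sum_mem fun p hp => ?_
      have hp' := Finset.HasAntidiagonal.mem_antidiagonal.1 hp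
      obtain ⟨c, hc⟩ := multiFactorial_dvd p.1 p.2
      rw [hp'] at hc
      have h2 : (multiFactorial d : K) * (coeff p.1 (subst (fun i => map (algebraMap R K) (a i))
            (pderiv K i f)) * coeff p.2 (pderiv K k (map (algebraMap R K) (a i)))) =
          (c * multiFactorial p.2) * coeff p.2 (pderiv K k (map (algebraMap R K) (a i))) *
            (multiFactorial p.1 * coeff p.1 (subst (fun i => map (algebraMap R K) (a i))
              (pderiv K i f))) := by
        rw [hc]
        push_cast
        ring
      rw [h2]
      refine mul_mem (mul_mem (mul_mem (natCast_mem _ _) (natCast_mem _ _)) ?_)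
        (ih _ ?_ _ ((Finsupp.degree_mono (by rw [← hp']; exact le_self_add)).trans hd))
      · rw [coeff_pderiv, coeff_map]
        exact mul_mem ⟨_, rfl⟩ (add_mem (natCast_mem _ _) (one_mem _))
      · intro j
        have := hf (j + Finsupp.single i 1)
        rw [multiFactorial_add_single] at this
        rw [coeff_pderiv]
        convert this using 1
        push_cast
        ring
  exact fun j => key _ f hf j le_rfl

/-- Substitution of power series with coefficients in `R` and without constant term, as a map
between modified power series rings. -/
noncomputable def modifiedSubst {σ τ : Type*} [Fintype σ] [Fintype τ]
    (a : σ → MvPowerSeries τ R) (ha : ∀ i, constantCoeff (a i) = 0) :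
    modifiedSeries R K σ →ₗ[R] modifiedSeries R K τ where
  toFun f := ⟨subst (fun i => map (algebraMap R K) (a i)) f.1, subst_mem_modifiedSeries R K ha f.2⟩
  map_add' f g := Subtype.ext (subst_add (hasSubst_of_constantCoeff_zero fun i => by
    rw [constantCoeff_map, ha, map_zero]) f.1 g.1)
  map_smul' r f := Subtype.ext (subst_smul (hasSubst_of_constantCoeff_zero fun i => by
    rw [constantCoeff_map, ha, map_zero]) r f.1)

/-- The filtration by total degree. -/
def modifiedFil (σ : Type*) [Fintype σ] (n : ℕ) : Submodule R (modifiedSeries R K σ) where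
  carrier := {f | ∀ j : σ →₀ ℕ, j.degree < n → coeff j f.1 = 0}
  add_mem' := by
    intro f g hf hg j hj
    change coeff j (f.1 + g.1) = 0
    rw [map_add, hf j hj, hg j hj, add_zero]
  zero_mem' := fun j _ => map_zero (coeff j)
  smul_mem' := by
    intro r f hf j hj
    change r • coeff j f.1 = 0
    rw [hf j hj, smul_zero]

/-- The evaluation `f ↦ f(0) ∈ R`. -/
noncomputable def modifiedEval [IsDomain R] [IsFractionRing R K] (σ : Type*) [Fintype σ] :
    modifiedSeries R K σ →ₗ[R] R :=
  (LinearEquiv.ofInjective (Algebra.linearMap R K) (IsFractionRing.injective R K)).symm.toLinearMap ∘ₗ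
    LinearMap.codRestrict (LinearMap.range (Algebra.linearMap R K))
      ((coeff (R := K) (0 : σ →₀ ℕ)).restrictScalars R ∘ₗ (modifiedSeries R K σ).val.toLinearMap)
      (fun f => by
        obtain ⟨r, hr⟩ := f.2 0
        exact ⟨r, by simpa [multiFactorial] using hr⟩)

theorem algebraMap_modifiedEval [IsDomain R] [IsFractionRing R K] {σ : Type*} [Fintype σ]
    (f : modifiedSeries R K σ) :
    algebraMap R K (modifiedEval R K σ f) = constantCoeff f.1 := by
  have h := LinearEquiv.apply_symm_apply
    (LinearEquiv.ofInjective (Algebra.linearMap R K) (IsFractionRing.injective R K))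
    (LinearMap.codRestrict (LinearMap.range (Algebra.linearMap R K))
      ((coeff (R := K) (0 : σ →₀ ℕ)).restrictScalars R ∘ₗ (modifiedSeries R K σ).val.toLinearMap)
      (fun f => by
        obtain ⟨r, hr⟩ := f.2 0
        exact ⟨r, by simpa [multiFactorial] using hr⟩) f)
  exact congrArg Subtype.val h

/-- The monomial `t^j`. -/
noncomputable def modifiedMonomial {σ : Type*} [Fintype σ] (j : σ →₀ ℕ) : modifiedSeries R K σ :=
  ⟨monomial j 1, by
    classical
    intro d
    rw [coeff_monomial]
    split_ifs
    · exact mul_mem (natCast_mem _ _) (one_mem _)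
    · rw [mul_zero]
      exact zero_mem _⟩

end Modified

namespace FormalGroupLaw

variable {R : Type*} [CommRing R] {m : ℕ} (G : FormalGroupLaw R m)

/-- `s` is the inverse of the formal group law: `s(0) = 0` and `G (X, s(X)) = 0`. -/
structure IsInverse (s : Fin m → MvPowerSeries (Fin m) R) : Prop where
  constantCoeff_eq_zero : ∀ i, constantCoeff (s i) = 0
  subst_eq_zero : ∀ j, subst (Sum.elim (fun i => X i) s) (G.toSeries j) = 0

section Functions

variable [IsDomain R] (K : Type*) [Field K] [Algebra R K] [IsFractionRing R K]

/-- The structure maps of the complete Hopf algebra of modified functions on `G`: the completed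
tensor powers are the modified power series rings in several sets of variables, the multiplication
is `F(X, Y) ↦ F(X, X)`, the comultiplication `f ↦ f(G(X, Y))`, the counit `f ↦ f(0)` and the
antipode `f ↦ f(s(X))`. -/
noncomputable def functionsHopf {s : Fin m → MvPowerSeries (Fin m) R} (hs : G.IsInverse s) :
    CompleteHopfData R (modifiedSeries R K (Fin m)) (modifiedSeries R K (Fin m ⊕ Fin m))
      (modifiedSeries R K ((Fin m ⊕ Fin m) ⊕ Fin m)) where
  fil := modifiedFil R K (Fin m)
  fil₂ := modifiedFil R K (Fin m ⊕ Fin m)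
  fil₃ := modifiedFil R K ((Fin m ⊕ Fin m) ⊕ Fin m)
  tmul := (LinearMap.mul R _).compl₁₂
    (modifiedSubst R K (fun i => X (Sum.inl i)) fun _ => constantCoeff_X _)
    (modifiedSubst R K (fun i => X (Sum.inr i)) fun _ => constantCoeff_X _)
  tmulLeft := (LinearMap.mul R _).compl₁₂
    (modifiedSubst R K (fun v => X (Sum.inl v)) fun _ => constantCoeff_X _)
    (modifiedSubst R K (fun i => X (Sum.inr i)) fun _ => constantCoeff_X _)
  tmulRight := (LinearMap.mul R _).compl₁₂
    (modifiedSubst R K (fun i => X (Sum.inl (Sum.inl i))) fun _ => constantCoeff_X _)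
    (modifiedSubst R K (Sum.elim (fun i => X (Sum.inl (Sum.inr i))) (fun i => X (Sum.inr i)))
      (by rintro (i | i) <;> exact constantCoeff_X _))
  mul := modifiedSubst R K (Sum.elim (fun i => X i) (fun i => X i))
    (by rintro (i | i) <;> exact constantCoeff_X _)
  unit := Algebra.linearMap R _
  comul := modifiedSubst R K G.toSeries G.constantCoeff_toSeries
  counit := modifiedEval R K (Fin m)
  antipode := modifiedSubst R K s hs.constantCoeff_eq_zero

end Functions

section Pairing

variable (K : Type*) [Field K] [Algebra R K]

/-- The comultiplication `f ↦ f(G(X, Y))` of `K[[t]]`. -/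
noncomputable def comulK : MvPowerSeries (Fin m) K →ₐ[K] MvPowerSeries (Fin m ⊕ Fin m) K :=
  substAlgHom (a := fun i => map (algebraMap R K) (G.toSeries i))
    (hasSubst_of_constantCoeff_zero fun i => by
      rw [constantCoeff_map, G.constantCoeff_toSeries, map_zero])

/-- The coefficient of `X^p` in a series in `X` and `Y`, as a series in `Y`. -/
def slice {σ τ : Type*} (p : σ →₀ ℕ) :
    MvPowerSeries (σ ⊕ τ) K →ₗ[K] MvPowerSeries τ K where
  toFun F := fun q => coeff (Finsupp.sumElim p q) F
  map_add' _ _ := rfl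
  map_smul' _ _ := rfl

/-- The map `1 ⊗̂ ψ`: the functional `ψ` is applied to the variables `Y` of a series in `X`
and `Y`. -/
def applyRight {σ τ : Type*} (ψ : MvPowerSeries τ K →ₗ[K] K) :
    MvPowerSeries (σ ⊕ τ) K →ₗ[K] MvPowerSeries σ K where
  toFun F := fun p => ψ (slice K p F)
  map_add' F F' := by
    funext p
    exact (congrArg ψ (map_add (slice K p) F F')).trans (map_add ψ _ _)
  map_smul' c F := by
    funext p
    exact (congrArg ψ (map_smul (slice K p) c F)).trans (map_smul ψ c _)

/-- The product `φ * ψ = (φ ⊗̂ ψ) ∘ μ` of continuous functionals on power series. -/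
noncomputable def conv (φ ψ : MvPowerSeries (Fin m) K →ₗ[K] K) :
    MvPowerSeries (Fin m) K →ₗ[K] K :=
  φ ∘ₗ applyRight K ψ ∘ₗ (G.comulK K).toLinearMap

/-- The functional `L(f) = ∑ j, L_j (∂f/∂t_j)(0)`. -/
noncomputable def tangent (L : G.LieAlg) : MvPowerSeries (Fin m) K →ₗ[K] K :=
  ∑ j : Fin m, algebraMap R K ((L : Fin m → R) j) •
    (coeff (R := K) 0 ∘ₗ (pderiv K j : MvPowerSeries (Fin m) K →ₗ[K] MvPowerSeries (Fin m) K))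

/-- The image `L_1 * ⋯ * L_k` of the product `L_1 ⋯ L_k` of elements of the Lie algebra under
the algebra homomorphism from the universal enveloping algebra to the continuous dual induced by the
pairing `L ⊗ f ↦ L(f)`. -/
noncomputable def wordFunctional : List G.LieAlg → (MvPowerSeries (Fin m) K →ₗ[K] K)
  | [] => coeff 0
  | L :: w => G.conv K (G.tangent K L) (wordFunctional w)

end Pairing

end FormalGroupLaw

/-! ### The Hopf algebra structure of the universal enveloping algebra and its dual -/

section Enveloping

open UniversalEnvelopingAlgebra

attribute [local instance 100] LieRing.ofAssociativeRing

variable (R : Type*) [CommRing R] (L : Type*) [LieRing L] [LieAlgebra R L]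

/-- The comultiplication: `x ↦ x ⊗ 1 + 1 ⊗ x` for `x ∈ L`. -/
noncomputable def envelopingComul :
    UniversalEnvelopingAlgebra R L →ₐ[R]
      UniversalEnvelopingAlgebra R L ⊗[R] UniversalEnvelopingAlgebra R L :=
  lift R
    { toFun := fun x => ι R x ⊗ₜ[R] 1 + 1 ⊗ₜ[R] ι R x
      map_add' := fun x y => by
        rw [map_add, TensorProduct.add_tmul, TensorProduct.tmul_add]
        abel
      map_smul' := fun r x => by
        simp [TensorProduct.smul_tmul']
      map_lie' := fun {x y} => by
        simp only [LieHom.map_lie, LieRing.of_associative_ring_bracket, mul_add, add_mul,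
          Algebra.TensorProduct.tmul_mul_tmul, mul_one, one_mul, TensorProduct.sub_tmul,
          TensorProduct.tmul_sub]
        abel }

/-- The counit: `x ↦ 0` for `x ∈ L`. -/
noncomputable def envelopingCounit : UniversalEnvelopingAlgebra R L →ₐ[R] R :=
  lift R 0

/-- The antipode: the antihomomorphism with `x ↦ -x` for `x ∈ L`. -/
noncomputable def envelopingAntipode :
    UniversalEnvelopingAlgebra R L →ₗ[R] UniversalEnvelopingAlgebra R L :=
  (MulOpposite.opLinearEquiv R).symm.toLinearMap ∘ₗ
    (lift R
      { toFun := fun x => MulOpposite.op (-ι R x)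
        map_add' := fun x y => by
          rw [map_add, neg_add, MulOpposite.op_add]
        map_smul' := fun r x => by
          simp
        map_lie' := fun {x y} => by
          simp only [LieHom.map_lie, LieRing.of_associative_ring_bracket, ← MulOpposite.op_mul,
            ← MulOpposite.op_sub]
          congr 1
          noncomm_ring } : UniversalEnvelopingAlgebra R L →ₐ[R]
            (UniversalEnvelopingAlgebra R L)ᵐᵒᵖ).toLinearMap

end Enveloping

/-- The functionals on `M` which vanish on all `v i` of weight `w i < n`. -/
def dualFil {R M ι : Type*} [CommRing R] [AddCommGroup M] [Module R M] (v : ι → M) (w : ι → ℕ)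
    (n : ℕ) : Submodule R (Module.Dual R M) where
  carrier := {φ | ∀ i, w i < n → φ (v i) = 0}
  add_mem' := by
    intro φ ψ hφ hψ i hi
    rw [LinearMap.add_apply, hφ i hi, hψ i hi, add_zero]
  zero_mem' := fun _ _ => rfl
  smul_mem' := by
    intro r φ hφ i hi
    rw [LinearMap.smul_apply, hφ i hi, smul_zero]

namespace FormalGroupLaw

variable {R : Type*} [CommRing R] {m : ℕ} (G : FormalGroupLaw R m)

/-- The universal enveloping algebra of the Lie algebra of `G`. -/
abbrev U : Type _ := UniversalEnvelopingAlgebra R G.LieAlg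

/-- The ordered monomial `e_1^{j_1} ⋯ e_m^{j_m}`. -/
noncomputable def orderedMonomial (j : Fin m →₀ ℕ) : G.U :=
  (List.ofFn fun i => UniversalEnvelopingAlgebra.ι R (G.e i) ^ j i).prod

/-- The structure maps of the complete Hopf algebra `U* = Hom_R (U, R)`: the completed tensor powers
are the linear duals of the tensor powers of `U`, and the structure maps are the transposes of those
of the Hopf algebra `U`. The filtrations are those by the total degree of the dual basis of the
ordered monomials. -/
noncomputable def dualHopf : CompleteHopfData R (Module.Dual R G.U)
    (Module.Dual R (G.U ⊗[R] G.U)) (Module.Dual R ((G.U ⊗[R] G.U) ⊗[R] G.U)) where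
  fil := dualFil G.orderedMonomial Finsupp.degree
  fil₂ := dualFil
    (fun p : (Fin m →₀ ℕ) × (Fin m →₀ ℕ) => G.orderedMonomial p.1 ⊗ₜ[R] G.orderedMonomial p.2)
    (fun p => p.1.degree + p.2.degree)
  fil₃ := dualFil
    (fun p : ((Fin m →₀ ℕ) × (Fin m →₀ ℕ)) × (Fin m →₀ ℕ) =>
      (G.orderedMonomial p.1.1 ⊗ₜ[R] G.orderedMonomial p.1.2) ⊗ₜ[R] G.orderedMonomial p.2)
    (fun p => p.1.1.degree + p.1.2.degree + p.2.degree)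
  tmul := TensorProduct.curry (TensorProduct.dualDistrib R G.U G.U)
  tmulLeft := TensorProduct.curry (TensorProduct.dualDistrib R (G.U ⊗[R] G.U) G.U)
  tmulRight := (TensorProduct.curry (TensorProduct.dualDistrib R G.U (G.U ⊗[R] G.U))).compr₂
    (TensorProduct.assoc R G.U G.U G.U).toLinearMap.dualMap
  mul := (envelopingComul R G.LieAlg).toLinearMap.dualMap
  unit := LinearMap.toSpanSingleton R _ (envelopingCounit R G.LieAlg).toLinearMap
  comul := (LinearMap.mul' R G.U).dualMap
  counit := Module.Dual.eval R G.U 1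
  antipode := (envelopingAntipode R G.LieAlg).dualMap

end FormalGroupLaw

/-! The enveloping algebra acts on functions by right invariant differential operators, and the
pairing applies the operator and evaluates at the origin. Let V_j be the derivation f(Y) ↦ ∂/∂X_j
f(G(X, Y)) at X = 0. Associativity of G makes V_j right invariant, and differentiating twice gives
[V_l, V_j] = ∑ (γ^k_{jl} - γ^k_{lj}) V_k, the bracket of the Lie algebra with its arguments
exchanged. So U acts from the right on modified series (`IsRightAction.act`), and L_1 * ⋯ * L_k is f
↦ (V_{L_k} ⋯ V_{L_1} f)(0) (`wordFunctional_eq`). This is why the map is well defined on U.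

Since V_j equals ∂/∂t_j at the origin, e^j acts on a series ∑ b_j t^j of order at least |j| with the
same value at 0 as the iterated partial derivative, namely j! b_j
(`constantCoeff_foldl_vectorField`). The numbers j! b_j are exactly the R-valued coordinates of a
modified series. Hence the pairing, written in these coordinates and by values on ordered monomials,
is triangular for the degree with identity diagonal. Both sides are full products of copies of R
with finitely many indices in each degree, and such a map is bijective by successive approximation
and respects the filtrations in both directions (`bijective_of_triangular`, `mem_of_map_mem`). The
same triangularity yields the linear independence of the ordered monomials, so no
Poincaré–Birkhoff–Witt theorem is presupposed; spanning is the usual reordering of words. Two sets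
of variables and U ⊗ U are treated in the same way.

The pairing respects the structure maps for geometric reasons. The Leibniz rule matches
multiplication with the coproduct of U (`act_modifiedSubst_diag`). Right invariance matches f(G(X,
Y)) with the product of U. The substitution of s carries right invariant fields to minus the left
invariant ones, which commute with the right invariant ones; this matches the antipodes.

The Hopf axioms for functions are identities between families of power series over R, substituted
into modified series. Those of U* are transported along the pairing, except completeness, the
completed tensor products and coassociativity, which follow from the monomial basis. The neutral
element and the inverse of G come from the bijectivity of substitutions of the form X + O(degree ≥
2), again a triangularity statement. -/

/-! ### Complete filtered modules in coordinates, and triangular maps -/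

section Coordinates

variable {R : Type*} [CommRing R]

/-- The filtered module `(M, F)` is the product of copies of `R` indexed by `ι` via `c`, with the
filtration by the weight `w`, of which there are finitely many indices in each weight. -/
structure IsCoordinates {M ι : Type*} [AddCommGroup M] [Module R M] (c : M ≃ₗ[R] (ι → R))
    (w : ι → ℕ) (F : ℕ → Submodule R M) : Prop where
  finite : ∀ n, {i | w i < n}.Finite
  mem_iff : ∀ n x, x ∈ F n ↔ ∀ i, w i < n → c x i = 0

namespace IsCoordinates

variable {M N P ι κ : Type*} [AddCommGroup M] [Module R M] [AddCommGroup N] [Module R N]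
  [AddCommGroup P] [Module R P] {c : M ≃ₗ[R] (ι → R)} {w : ι → ℕ} {F : ℕ → Submodule R M}

theorem antitone (h : IsCoordinates c w F) : Antitone F := fun a b hab x hx =>
  (h.mem_iff a x).2 fun i hi => (h.mem_iff b x).1 hx i (hi.trans_le hab)

theorem eq_zero (h : IsCoordinates c w F) {x : M} (hx : ∀ n, x ∈ F n) : x = 0 := by
  apply c.injective
  rw [map_zero]
  funext i
  exact (h.mem_iff _ x).1 (hx (w i + 1)) i (Nat.lt_succ_self _)

theorem sub_mem_of_succ (h : IsCoordinates c w F) {u : ℕ → M}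
    (hu : ∀ n, u (n + 1) - u n ∈ F n) {a b : ℕ} (hab : a ≤ b) : u b - u a ∈ F a := by
  induction b, hab using Nat.le_induction with
  | base => simp
  | succ b hab ih =>
    rw [← sub_add_sub_cancel _ (u b)]
    exact add_mem (h.antitone hab (hu b)) ih

theorem isCompleteFiltration (h : IsCoordinates c w F) : IsCompleteFiltration F where
  zero := by
    rw [eq_top_iff]
    exact fun x _ => (h.mem_iff 0 x).2 fun i hi => absurd hi (Nat.not_lt_zero _)
  antitone := h.antitone
  separated := by
    rw [eq_bot_iff]
    intro x hx
    exact h.eq_zero fun n => (Submodule.mem_iInf _).1 hx n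
  complete := by
    intro u hu
    -- The coordinate `i` no longer changes along the sequence from the index `w i + 1` on.
    refine ⟨c.symm fun i => c (u (w i + 1)) i, fun n => (h.mem_iff _ _).2 fun i hi => ?_⟩
    have := (h.mem_iff _ _).1 (h.sub_mem_of_succ hu (Nat.succ_le_of_lt hi)) i (Nat.lt_succ_self _)
    rw [map_sub, Pi.sub_apply, sub_eq_zero] at this
    simp [this]

/-- The part of `x` of weight less than `n`. -/
theorem sub_sum_mem [DecidableEq ι] (h : IsCoordinates c w F) (n : ℕ) (x : M) :
    x - ∑ i ∈ (h.finite n).toFinset, c x i • c.symm (Pi.single i 1) ∈ F n := by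
  rw [h.mem_iff]
  intro i hi
  rw [map_sub, map_sum, Pi.sub_apply, Finset.sum_apply, Finset.sum_eq_single i]
  · simp
  · intro k _ hk
    simp [hk.symm]
  · intro hi'
    exact absurd ((h.finite n).mem_toFinset.2 hi) hi'

theorem single_mem [DecidableEq ι] (h : IsCoordinates c w F) {n : ℕ} {i : ι} (hi : n ≤ w i) :
    c.symm (Pi.single i 1) ∈ F n := by
  rw [h.mem_iff]
  intro k hk
  rw [LinearEquiv.apply_symm_apply, Pi.single_eq_of_ne]
  rintro rfl
  omega

variable {d : N ≃ₗ[R] (κ → R)} {w' : κ → ℕ} {F' : ℕ → Submodule R N}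
  {e : P ≃ₗ[R] (ι × κ → R)} {F'' : ℕ → Submodule R P}

theorem tmul_mem_tensorFil {n i j : ℕ} (hij : i + j = n) {x : M} {y : N} (hx : x ∈ F i)
    (hy : y ∈ F' j) : x ⊗ₜ[R] y ∈ tensorFil F F' n :=
  Submodule.mem_iSup_of_mem i (Submodule.mem_iSup_of_mem j (Submodule.mem_iSup_of_mem hij
    (Submodule.apply_mem_map₂ _ hx hy)))

/-- Finitely many coordinates lie below each weight, so truncations are finite sums of pure tensors.
Conversely, modulo the `n`-th step of the tensor filtration, an element of `M ⊗ N` is the sum of its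
finitely many coordinates, hence lies in that step once the coordinates of weight less than `n`
vanish. -/
theorem isCompletedTensor (h : IsCoordinates c w F) (h' : IsCoordinates d w' F')
    (h'' : IsCoordinates e (fun p => w p.1 + w' p.2) F'') {t : M →ₗ[R] N →ₗ[R] P}
    (ht : ∀ x y i j, e (t x y) (i, j) = c x i * d y j) : IsCompletedTensor F F' F'' t := by
  classical
  have htop : ∀ x, x ∈ F 0 := fun x => by rw [h.isCompleteFiltration.zero]; trivial
  have htop' : ∀ x, x ∈ F' 0 := fun x => by rw [h'.isCompleteFiltration.zero]; trivial
  refine ⟨h''.isCompleteFiltration, fun n p => ?_, fun n z => ⟨fun hz => ?_, fun hz => ?_⟩⟩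
  · refine ⟨∑ q ∈ (h''.finite n).toFinset,
      e p q • (c.symm (Pi.single q.1 1) ⊗ₜ[R] d.symm (Pi.single q.2 1)), ?_⟩
    convert! h''.sub_sum_mem n p using 2
    rw [map_sum]
    refine Finset.sum_congr rfl fun q _ => ?_
    rw [map_smul, TensorProduct.lift.tmul]
    congr 1
    apply e.injective
    funext ⟨i, j⟩
    rw [ht, LinearEquiv.apply_symm_apply, LinearEquiv.apply_symm_apply,
      LinearEquiv.apply_symm_apply]
    obtain ⟨a, b⟩ := q
    by_cases hi : i = a <;> by_cases hj : j = b <;> simp [hi, hj]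
  · have key : ∀ z : M ⊗[R] N, z - ∑ i ∈ (h.finite n).toFinset, ∑ j ∈ (h'.finite n).toFinset,
        e (TensorProduct.lift t z) (i, j) •
          (c.symm (Pi.single i 1) ⊗ₜ[R] d.symm (Pi.single j 1)) ∈ tensorFil F F' n := by
      intro z
      induction z with
      | zero => simp
      | tmul x y =>
        have h1 := h.sub_sum_mem n x
        have h2 := h'.sub_sum_mem n y
        set x' := ∑ i ∈ (h.finite n).toFinset, c x i • c.symm (Pi.single i 1)
        set y' := ∑ i ∈ (h'.finite n).toFinset, d y i • d.symm (Pi.single i 1)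
        have h3 : ∑ i ∈ (h.finite n).toFinset, ∑ j ∈ (h'.finite n).toFinset,
            e (TensorProduct.lift t (x ⊗ₜ[R] y)) (i, j) •
              (c.symm (Pi.single i 1) ⊗ₜ[R] d.symm (Pi.single j 1)) = x' ⊗ₜ[R] y' := by
          simp only [x', y', TensorProduct.sum_tmul, TensorProduct.tmul_sum,
            TensorProduct.lift.tmul, ht, TensorProduct.smul_tmul_smul]
          exact Finset.sum_comm
        rw [h3]
        -- Each summand has one factor in step `n` and the other in step `0`.
        have h4 : x ⊗ₜ[R] y - x' ⊗ₜ[R] y' = (x - x') ⊗ₜ[R] y + x' ⊗ₜ[R] (y - y') := by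
          rw [TensorProduct.sub_tmul, TensorProduct.tmul_sub]
          abel
        rw [h4]
        exact add_mem (tmul_mem_tensorFil (add_zero n) h1 (htop' y))
          (tmul_mem_tensorFil (zero_add n) (htop x') h2)
      | add z z' hz hz' =>
        convert! add_mem hz hz' using 1
        simp only [map_add, Pi.add_apply, add_smul, Finset.sum_add_distrib]
        abel
    rw [← sub_add_cancel z (∑ i ∈ (h.finite n).toFinset, ∑ j ∈ (h'.finite n).toFinset,
        e (TensorProduct.lift t z) (i, j) •
          (c.symm (Pi.single i 1) ⊗ₜ[R] d.symm (Pi.single j 1)))]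
    refine add_mem (key z) (sum_mem fun i _ => sum_mem fun j _ => ?_)
    by_cases hij : w i + w' j < n
    · rw [(h''.mem_iff _ _).1 hz (i, j) hij, zero_smul]
      exact zero_mem _
    -- `tensorFil` asks for degrees adding up to exactly `n`, so the weight of the first factor is
    -- cut off at `n`.
    · refine Submodule.smul_mem _ _ (tmul_mem_tensorFil (i := min n (w i)) (j := n - min n (w i))
        (by omega) (h.single_mem (by omega)) (h'.single_mem (by omega)))
  · have : tensorFil F F' n ≤ (F'' n).comap (TensorProduct.lift t) := by
      refine iSup_le fun i => iSup_le fun j => iSup_le fun hij => ?_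
      rw [Submodule.map₂_le]
      intro x hx y hy
      rw [Submodule.mem_comap, TensorProduct.mk_apply, TensorProduct.lift.tmul, h''.mem_iff]
      rintro ⟨a, b⟩ hab
      rw [ht]
      by_cases ha : w a < i
      · rw [(h.mem_iff _ _).1 hx a ha, zero_mul]
      · rw [(h'.mem_iff _ _).1 hy b (by change w a + w' b < n at hab; omega), mul_zero]
    exact this hz

variable {d : N ≃ₗ[R] (ι → R)} {F' : ℕ → Submodule R N}

section Triangular

variable (h : IsCoordinates c w F) (h' : IsCoordinates d w F') {Ψ : M →ₗ[R] N}
  (hΨ : ∀ n, ∀ x ∈ F n, ∀ i, w i ≤ n → d (Ψ x) i = c x i)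
include h h' hΨ

theorem map_mem {n : ℕ} {x : M} (hx : x ∈ F n) : Ψ x ∈ F' n :=
  (h'.mem_iff _ _).2 fun i hi => by rw [hΨ n x hx i hi.le, (h.mem_iff _ _).1 hx i hi]

/-- Climb one weight at a time: once `x ∈ F k` with `k < n`, triangularity identifies its
coordinates of weight `k` with those of `Ψ x`, which vanish. This needs agreement in weight `n`
itself in `hΨ`, not only below it. -/
theorem mem_of_map_mem {n : ℕ} {x : M} (hx : Ψ x ∈ F' n) : x ∈ F n := by
  suffices ∀ k ≤ n, x ∈ F k from this n le_rfl
  intro k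
  induction k with
  | zero =>
    intro _
    rw [h.isCompleteFiltration.zero]
    trivial
  | succ k ih =>
    intro hk
    have := ih (by omega)
    rw [h.mem_iff]
    intro i hi
    rw [← hΨ k x this i (by omega)]
    exact (h'.mem_iff _ _).1 hx i (by omega)

theorem exists_approx (y : N) : ∃ u : ℕ → M, ∀ n, u (n + 1) - u n ∈ F n ∧ y - Ψ (u n) ∈ F' n := by
  classical
  -- The error is fed back as if `Ψ` were the identity in coordinates; this cancels its part of
  -- lowest weight.
  let step : M → M := fun x => x + c.symm (d (y - Ψ x))
  let u : ℕ → M := fun n => n.rec 0 fun _ => step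
  have key : ∀ n, y - Ψ (u n) ∈ F' n := by
    intro n
    induction n with
    | zero =>
      rw [h'.isCompleteFiltration.zero]
      trivial
    | succ n ih =>
      have hmem : c.symm (d (y - Ψ (u n))) ∈ F n := (h.mem_iff _ _).2 fun i hi => by
        rw [LinearEquiv.apply_symm_apply]
        exact (h'.mem_iff _ _).1 ih i hi
      refine (h'.mem_iff _ _).2 fun i hi => ?_
      change d (y - Ψ (u n + c.symm (d (y - Ψ (u n))))) i = 0
      rw [map_add, ← sub_sub, map_sub, Pi.sub_apply, hΨ n _ hmem i (by omega),
        LinearEquiv.apply_symm_apply, sub_self]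
  refine ⟨u, fun n => ⟨?_, key n⟩⟩
  change u n + c.symm (d (y - Ψ (u n))) - u n ∈ F n
  rw [add_sub_cancel_left]
  exact (h.mem_iff _ _).2 fun i hi => by
    rw [LinearEquiv.apply_symm_apply]
    exact (h'.mem_iff _ _).1 (key n) i hi

/-- An element of the kernel lies in every `F n`. A preimage of `y` is the limit of the
approximations, since `Ψ` preserves the filtration. -/
theorem bijective_of_triangular : Function.Bijective Ψ := by
  constructor
  · rw [← LinearMap.ker_eq_bot, LinearMap.ker_eq_bot']
    intro x hx
    exact h.eq_zero fun n => mem_of_map_mem h h' hΨ (by rw [hx]; exact zero_mem _)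
  · intro y
    obtain ⟨u, hu⟩ := exists_approx h h' hΨ y
    obtain ⟨x, hx⟩ := h.isCompleteFiltration.complete u fun n => (hu n).1
    refine ⟨x, (sub_eq_zero.1 (h'.eq_zero fun n => ?_)).symm⟩
    have : y - Ψ x = (y - Ψ (u n)) - Ψ (x - u n) := by
      rw [map_sub]
      abel
    rw [this]
    exact sub_mem (hu n).2 (map_mem h h' hΨ (hx n))

end Triangular

end IsCoordinates

end Coordinates

/-! ### Orders of power series, and substitutions tangent to the identity -/

section Order

variable {R : Type*} [CommRing R] {σ τ : Type*}

theorem MvPowerSeries.natCast_le_order_iff {n : ℕ} {f : MvPowerSeries σ R} :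
    (n : ℕ∞) ≤ f.order ↔ ∀ d : σ →₀ ℕ, d.degree < n → coeff d f = 0 :=
  ⟨fun h _ hd => coeff_of_lt_order ((Nat.cast_lt.2 hd).trans_le h), nat_le_order⟩

theorem MvPowerSeries.le_order_add {n : ℕ∞} {f g : MvPowerSeries σ R} (hf : n ≤ f.order)
    (hg : n ≤ g.order) : n ≤ (f + g).order :=
  (le_min hf hg).trans min_order_le_add

theorem MvPowerSeries.le_order_sum {ι : Type*} {n : ℕ∞} (s : Finset ι)
    {f : ι → MvPowerSeries σ R} (hf : ∀ i ∈ s, n ≤ (f i).order) : n ≤ (∑ i ∈ s, f i).order := by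
  classical
  induction s using Finset.induction_on with
  | empty => simp
  | insert i s hi ih =>
    rw [Finset.sum_insert hi]
    exact le_order_add (hf i (Finset.mem_insert_self i s))
      (ih fun k hk => hf k (Finset.mem_insert_of_mem hk))

theorem MvPowerSeries.le_order_mul_of_le {a b n : ℕ} (h : n ≤ a + b) {f g : MvPowerSeries σ R}
    (hf : (a : ℕ∞) ≤ f.order) (hg : (b : ℕ∞) ≤ g.order) : (n : ℕ∞) ≤ (f * g).order :=
  calc (n : ℕ∞) ≤ (a : ℕ∞) + b := by exact_mod_cast h
    _ ≤ f.order + g.order := add_le_add hf hg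
    _ ≤ (f * g).order := le_order_mul

theorem MvPowerSeries.le_order_subst_of_le [Finite σ] {a : σ → MvPowerSeries τ R}
    (ha : ∀ i, constantCoeff (a i) = 0) {n : ℕ∞} {f : MvPowerSeries σ R} (hf : n ≤ f.order) :
    n ≤ (subst a f).order := by
  refine le_trans ?_ (le_order_subst (hasSubst_of_constantCoeff_zero ha) f)
  have h1 : 1 ≤ ⨅ i, (a i).order := le_iInf fun i => one_le_order_iff_constCoeff_eq_zero.2 (ha i)
  calc n ≤ 1 * f.order := by rwa [one_mul]
    _ ≤ _ := mul_le_mul_left h1 _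

theorem MvPowerSeries.le_order_pderiv {n : ℕ} {f : MvPowerSeries σ R}
    (hf : ((n + 1 : ℕ) : ℕ∞) ≤ f.order) (i : σ) : (n : ℕ∞) ≤ (pderiv R i f).order := by
  rw [natCast_le_order_iff] at hf ⊢
  intro d hd
  rw [coeff_pderiv, hf _ (by rw [map_add, Finsupp.degree_single]; omega), zero_mul]

/-- A nonconstant coefficient of degree at most `n`, times a positive integer, is a coefficient of
degree less than `n` of a partial derivative. In a domain of characteristic zero the integer
cancels, so orders can be estimated by induction on derivatives. -/
theorem MvPowerSeries.le_order_of_pderiv [IsDomain R] [CharZero R] {n : ℕ} {f : MvPowerSeries σ R}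
    (h0 : constantCoeff f = 0) (hf : ∀ i, (n : ℕ∞) ≤ (pderiv R i f).order) :
    ((n + 1 : ℕ) : ℕ∞) ≤ f.order := by
  rw [natCast_le_order_iff]
  intro d hd
  by_cases hd0 : d = 0
  · rw [hd0, coeff_zero_eq_constantCoeff_apply, h0]
  obtain ⟨k, hk⟩ : ∃ k, d k ≠ 0 := Finsupp.ne_iff.1 hd0
  obtain ⟨e, rfl⟩ : ∃ e : σ →₀ ℕ, d = e + Finsupp.single k 1 :=
    ⟨d - Finsupp.single k 1, (tsub_add_cancel_of_le (by
      rw [Finsupp.single_le_iff]; exact Nat.one_le_iff_ne_zero.2 hk)).symm⟩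
  have := natCast_le_order_iff.1 (hf k) e (by
    rw [map_add, Finsupp.degree_single] at hd
    omega)
  rw [coeff_pderiv] at this
  exact (mul_eq_zero.1 this).resolve_right (Nat.cast_add_one_ne_zero _)

/-- Substituting `a i = X i + O(degree ≥ 2)` does not change leading forms. -/
theorem MvPowerSeries.le_order_subst_sub [IsDomain R] [CharZero R] [Fintype σ]
    {a : σ → MvPowerSeries σ R} (ha : ∀ i, ((2 : ℕ) : ℕ∞) ≤ (a i - X i).order) (n : ℕ)
    {f : MvPowerSeries σ R} (hf : (n : ℕ∞) ≤ f.order) :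
    ((n + 1 : ℕ) : ℕ∞) ≤ (subst a f - f).order := by
  classical
  have ha0 : ∀ i, constantCoeff (a i) = 0 := fun i => by
    have := natCast_le_order_iff.1 (ha i) 0 (by simp)
    simpa using this
  have hs : HasSubst a := hasSubst_of_constantCoeff_zero ha0
  induction n generalizing f with
  | zero =>
    rw [natCast_le_order_iff]
    intro d hd
    have hd0 : d = 0 := (Finsupp.degree_eq_zero_iff d).1 (by omega)
    rw [hd0, map_sub, coeff_zero_eq_constantCoeff_apply, coeff_zero_eq_constantCoeff_apply,
      constantCoeff_subst_of_zero ha0, sub_self]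
  | succ n ih =>
    refine le_order_of_pderiv (by rw [map_sub, constantCoeff_subst_of_zero ha0, sub_self])
      fun k => ?_
    -- Chain rule with `a i = X i + (a i - X i)`. The first bracket falls under the induction
    -- hypothesis; in the sum the second factor gains one order.
    have h : pderiv R k (subst a f - f) = (subst a (pderiv R k f) - pderiv R k f) +
        ∑ i, subst a (pderiv R i f) * pderiv R k (a i - X i) := by
      rw [map_sub, pderiv_subst_eq_sum hs]
      simp only [map_sub, mul_sub, Finset.sum_sub_distrib]
      have : ∑ i, subst a (pderiv R i f) * pderiv R k (X i) = subst a (pderiv R k f) := by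
        rw [Finset.sum_eq_single k]
        · rw [pderiv_X_self, mul_one]
        · intro i _ hi
          rw [pderiv_X_of_ne hi, mul_zero]
        · simp
      rw [this]
      ring
    rw [h]
    refine le_order_add (ih (le_order_pderiv hf k)) (le_order_sum _ fun i _ => ?_)
    exact le_order_mul_of_le (a := n) (b := 1) le_rfl
      (le_order_subst_of_le ha0 (le_order_pderiv hf i)) (le_order_pderiv (ha i) k)

/-- The filtration of a power series ring by the order. -/
def MvPowerSeries.orderFil (R σ : Type*) [CommRing R] (n : ℕ) :
    Submodule R (MvPowerSeries σ R) where
  carrier := {f | (n : ℕ∞) ≤ f.order}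
  add_mem' := le_order_add
  zero_mem' := by simp
  smul_mem' r f hf := le_trans hf le_order_smul

theorem MvPowerSeries.isCoordinates_orderFil [Finite σ] :
    IsCoordinates (LinearEquiv.refl R _ : MvPowerSeries σ R ≃ₗ[R] ((σ →₀ ℕ) → R))
      Finsupp.degree (orderFil R σ) where
  finite := Finsupp.finite_of_degree_lt
  mem_iff _ _ := natCast_le_order_iff

/-- Since `f` and `subst a f` have the same leading form, the substitution is triangular for the
degree. This stands in for a formal inverse function theorem. -/
theorem MvPowerSeries.subst_bijective [IsDomain R] [CharZero R] [Fintype σ]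
    {a : σ → MvPowerSeries σ R} (ha : ∀ i, ((2 : ℕ) : ℕ∞) ≤ (a i - X i).order) :
    Function.Bijective (subst a : MvPowerSeries σ R → MvPowerSeries σ R) := by
  have ha0 : ∀ i, constantCoeff (a i) = 0 := fun i => by
    have := natCast_le_order_iff.1 (ha i) 0 (by simp)
    simpa using this
  have hs : HasSubst a := hasSubst_of_constantCoeff_zero ha0
  rw [← coe_substAlgHom hs]
  refine isCoordinates_orderFil.bijective_of_triangular isCoordinates_orderFil
    (Ψ := (substAlgHom (R := R) hs).toLinearMap) fun n f hf i hi => ?_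
  have := natCast_le_order_iff.1 (le_order_subst_sub ha n hf) i (by omega)
  rw [map_sub, sub_eq_zero] at this
  rw [AlgHom.toLinearMap_apply, coe_substAlgHom]
  exact this

/-- Substitution in both arguments of equal families. -/
theorem MvPowerSeries.subst_subst_congr [Finite σ] [Finite τ] {υ : Type*} {a : σ → MvPowerSeries τ R}
    {b : τ → MvPowerSeries υ R} {c : σ → MvPowerSeries υ R} (ha : ∀ i, constantCoeff (a i) = 0)
    (hb : ∀ i, constantCoeff (b i) = 0) (h : ∀ i, subst b (a i) = c i) (f : MvPowerSeries σ R) :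
    subst b (subst a f) = subst c f := by
  rw [subst_comp_subst_apply (hasSubst_of_constantCoeff_zero ha)
    (hasSubst_of_constantCoeff_zero hb)]
  exact congrArg (subst · f) (funext h)

end Order

/-! ### Neutral element and inverse of a formal group law -/

namespace FormalGroupLaw

variable {R : Type*} [CommRing R] {m : ℕ} (G : FormalGroupLaw R m) {τ υ : Type*}

/-- The sum `G (a, b)` of two families of power series. -/
noncomputable def add (a b : Fin m → MvPowerSeries τ R) : Fin m → MvPowerSeries τ R :=
  fun j => subst (Sum.elim a b) (G.toSeries j)

theorem constantCoeff_elim {a b : Fin m → MvPowerSeries τ R} (ha : ∀ i, constantCoeff (a i) = 0)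
    (hb : ∀ i, constantCoeff (b i) = 0) (i : Fin m ⊕ Fin m) :
    constantCoeff (Sum.elim a b i) = 0 := by
  rcases i with i | i
  · exact ha i
  · exact hb i

theorem constantCoeff_add {a b : Fin m → MvPowerSeries τ R} (ha : ∀ i, constantCoeff (a i) = 0)
    (hb : ∀ i, constantCoeff (b i) = 0) (j : Fin m) : constantCoeff (G.add a b j) = 0 := by
  rw [add, constantCoeff_subst_of_zero (constantCoeff_elim ha hb), G.constantCoeff_toSeries]

theorem subst_add_apply [Finite τ] {a b : Fin m → MvPowerSeries τ R}
    (ha : ∀ i, constantCoeff (a i) = 0)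
    (hb : ∀ i, constantCoeff (b i) = 0) {c : τ → MvPowerSeries υ R}
    (hc : ∀ i, constantCoeff (c i) = 0) (j : Fin m) :
    subst c (G.add a b j) = G.add (fun i => subst c (a i)) (fun i => subst c (b i)) j :=
  subst_subst_congr (constantCoeff_elim ha hb) hc (by rintro (i | i) <;> rfl) _

/-- The axiom is the case of three independent sets of variables; substituting `(a, b, c)` into it
gives the general case. -/
theorem add_assoc {a b c : Fin m → MvPowerSeries τ R} (ha : ∀ i, constantCoeff (a i) = 0)
    (hb : ∀ i, constantCoeff (b i) = 0) (hc : ∀ i, constantCoeff (c i) = 0) :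
    G.add (G.add a b) c = G.add a (G.add b c) := by
  funext j
  have hd : ∀ i, constantCoeff (Sum.elim (Sum.elim a b) c i) = 0 := by
    rintro ((i | i) | i)
    exacts [ha i, hb i, hc i]
  have hs := hasSubst_of_constantCoeff_zero hd
  have key := congrArg (subst (Sum.elim (Sum.elim a b) c)) (G.assoc j)
  rw [subst_subst_congr (c := Sum.elim (G.add a b) c) _ hd,
    subst_subst_congr (c := Sum.elim a (G.add b c)) _ hd] at key
  · exact key
  · rintro (i | i)
    · exact subst_X hs _
    · refine subst_subst_congr (by rintro (i | i) <;> exact constantCoeff_X _) hd ?_ _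
      rintro (i | i) <;> exact subst_X hs _
  · refine constantCoeff_elim (fun i => constantCoeff_X _) fun i => ?_
    rw [constantCoeff_subst_of_zero, constantCoeff_toSeries]
    rintro (i | i) <;> exact constantCoeff_X _
  · rintro (i | i)
    · refine subst_subst_congr (fun i => constantCoeff_X _) hd ?_ _
      rintro (i | i) <;> exact subst_X hs _
    · exact subst_X hs _
  · refine constantCoeff_elim (fun i => ?_) fun i => constantCoeff_X _
    rw [constantCoeff_subst_of_zero fun i => constantCoeff_X _, constantCoeff_toSeries]

theorem le_order_toSeries_sub (j : Fin m) :
    ((2 : ℕ) : ℕ∞) ≤ (G.toSeries j - (X (Sum.inl j) + X (Sum.inr j))).order := by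
  obtain ⟨γ, h⟩ := G.expansion j
  rw [natCast_le_order_iff]
  intro d hd
  rw [map_sub, h d (by omega), map_add, add_sub_cancel_left]
  refine natCast_le_order_iff.1 (le_order_sum _ fun l _ => le_order_sum _ fun k _ => ?_) d hd
  refine le_order_mul_of_le (a := 0) (b := 2) le_rfl (by simp) (le_order_mul_of_le (a := 1) (b := 1)
    le_rfl ?_ ?_)
  · exact one_le_order_iff_constCoeff_eq_zero.2 (constantCoeff_X _)
  · exact one_le_order_iff_constCoeff_eq_zero.2 (constantCoeff_X _)

theorem le_order_add_sub {a b : Fin m → MvPowerSeries τ R} (ha : ∀ i, constantCoeff (a i) = 0)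
    (hb : ∀ i, constantCoeff (b i) = 0) (j : Fin m) :
    ((2 : ℕ) : ℕ∞) ≤ (G.add a b j - (a j + b j)).order := by
  have hs := hasSubst_of_constantCoeff_zero (constantCoeff_elim ha hb)
  have := le_order_subst_of_le (constantCoeff_elim ha hb) (G.le_order_toSeries_sub j)
  rwa [subst_sub hs, subst_add hs, subst_X hs, subst_X hs] at this

theorem constantCoeff_zero_family (i : Fin m) :
    constantCoeff ((0 : Fin m → MvPowerSeries τ R) i) = 0 := map_zero _

theorem zero_add_zero : G.add (0 : Fin m → MvPowerSeries τ R) 0 = 0 := by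
  funext j
  rw [add, show (Sum.elim 0 0 : Fin m ⊕ Fin m → MvPowerSeries τ R) = 0 from Sum.elim_zero_zero]
  exact subst_zero_of_constantCoeff_zero (G.constantCoeff_toSeries j)

section Domain

variable [IsDomain R] [CharZero R]

/-- An idempotent map which is injective is the identity; tangency to the identity gives injectivity
of `subst g`. -/
theorem eq_X_of_subst_self {g : Fin m → MvPowerSeries (Fin m) R}
    (hg : ∀ i, ((2 : ℕ) : ℕ∞) ≤ (g i - X i).order) (h : ∀ i, subst g (g i) = g i) (i : Fin m) :
    g i = X i := by
  have hg0 : ∀ i, constantCoeff (g i) = 0 := fun i => by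
    have := natCast_le_order_iff.1 (hg i) 0 (by simp)
    simpa using this
  apply (subst_bijective hg).1
  rw [h, subst_X (hasSubst_of_constantCoeff_zero hg0)]

/-- The definition does not include the neutral element law. It follows from idempotency: G(0, G(0,
X)) = G(G(0, 0), X) = G(0, X). -/
theorem zero_add_X : G.add 0 X = (X : Fin m → MvPowerSeries (Fin m) R) := by
  have h0 := constantCoeff_zero_family (R := R) (m := m) (τ := Fin m)
  have hX : ∀ i : Fin m, constantCoeff (X i : MvPowerSeries (Fin m) R) = 0 :=
    fun i => constantCoeff_X i
  have hc := G.constantCoeff_add h0 hX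
  have hs := hasSubst_of_constantCoeff_zero hc
  refine funext (eq_X_of_subst_self (fun i => ?_) fun i => ?_)
  · simpa using G.le_order_add_sub h0 hX i
  · rw [subst_add_apply G h0 hX hc]
    have h1 : (fun i => subst (G.add 0 X) ((0 : Fin m → MvPowerSeries (Fin m) R) i)) = 0 :=
      funext fun i => by
        rw [Pi.zero_apply, ← coe_substAlgHom hs, map_zero]
    have h2 : (fun i => subst (G.add 0 X) (X i : MvPowerSeries (Fin m) R)) = G.add 0 X :=
      funext fun i => subst_X hs i
    rw [h1, h2, ← G.add_assoc h0 h0 hX, zero_add_zero]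

theorem add_zero_X : G.add X 0 = (X : Fin m → MvPowerSeries (Fin m) R) := by
  have h0 := constantCoeff_zero_family (R := R) (m := m) (τ := Fin m)
  have hX : ∀ i : Fin m, constantCoeff (X i : MvPowerSeries (Fin m) R) = 0 :=
    fun i => constantCoeff_X i
  have hc := G.constantCoeff_add hX h0
  have hs := hasSubst_of_constantCoeff_zero hc
  refine funext (eq_X_of_subst_self (fun i => ?_) fun i => ?_)
  · simpa using G.le_order_add_sub hX h0 i
  · rw [subst_add_apply G hX h0 hc]
    have h1 : (fun i => subst (G.add X 0) ((0 : Fin m → MvPowerSeries (Fin m) R) i)) = 0 :=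
      funext fun i => by
        rw [Pi.zero_apply, ← coe_substAlgHom hs, map_zero]
    have h2 : (fun i => subst (G.add X 0) (X i : MvPowerSeries (Fin m) R)) = G.add X 0 :=
      funext fun i => subst_X hs i
    rw [h1, h2, G.add_assoc hX h0 h0, zero_add_zero]

theorem zero_add {a : Fin m → MvPowerSeries τ R} (ha : ∀ i, constantCoeff (a i) = 0) :
    G.add 0 a = a := by
  have hs := hasSubst_of_constantCoeff_zero ha
  funext j
  have := congrArg (subst a) (congrFun G.zero_add_X j)
  rw [subst_add_apply G constantCoeff_zero_family (fun i => constantCoeff_X i) ha, subst_X hs] at this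
  rw [← this]
  congr 1
  · funext i
    rw [Pi.zero_apply, Pi.zero_apply, ← coe_substAlgHom hs, map_zero]
  · exact funext fun i => (subst_X hs i).symm

theorem add_zero {a : Fin m → MvPowerSeries τ R} (ha : ∀ i, constantCoeff (a i) = 0) :
    G.add a 0 = a := by
  have hs := hasSubst_of_constantCoeff_zero ha
  funext j
  have := congrArg (subst a) (congrFun G.add_zero_X j)
  rw [subst_add_apply G (fun i => constantCoeff_X i) constantCoeff_zero_family ha, subst_X hs] at this
  rw [← this]
  congr 1
  · exact funext fun i => (subst_X hs i).symm
  · funext i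
    rw [Pi.zero_apply, Pi.zero_apply, ← coe_substAlgHom hs, map_zero]

theorem exists_isInverse : ∃ s, G.IsInverse s := by
  let x : Fin m → MvPowerSeries (Fin m ⊕ Fin m) R := fun i => X (Sum.inl i)
  let y : Fin m → MvPowerSeries (Fin m ⊕ Fin m) R := fun i => X (Sum.inr i)
  have hx : ∀ i, constantCoeff (x i) = 0 := fun i => constantCoeff_X _
  have hy : ∀ i, constantCoeff (y i) = 0 := fun i => constantCoeff_X _
  have hyx : ∀ i, constantCoeff ((y - x) i) = 0 := fun i => by
    rw [Pi.sub_apply, map_sub, hx, hy, sub_zero]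
  -- The shear (X, Y) ↦ (X, G(X, Y - X)): subtracting X makes the linear part exactly (X, Y).
  let a : Fin m ⊕ Fin m → MvPowerSeries (Fin m ⊕ Fin m) R := Sum.elim x (G.add x (y - x))
  have ha0 : ∀ i, constantCoeff (a i) = 0 := constantCoeff_elim hx (G.constantCoeff_add hx hyx)
  have hsa := hasSubst_of_constantCoeff_zero ha0
  have ha : ∀ i, ((2 : ℕ) : ℕ∞) ≤ (a i - X i).order := by
    rintro (i | i)
    · simp [a, x]
    · simpa [a, y] using G.le_order_add_sub hx hyx i
  have hbij := subst_bijective ha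
  choose b hb using fun i => hbij.2 (X i)
  have hb0 : ∀ i, constantCoeff (b i) = 0 := fun i => by
    rw [← constantCoeff_subst_of_zero ha0, hb, constantCoeff_X]
  have hsb := hasSubst_of_constantCoeff_zero hb0
  -- `hb` gives one composite of the two substitutions; injectivity of `subst a` gives the other.
  have hba : ∀ i, subst b (a i) = X i := fun i => hbij.1 (by
    rw [subst_subst_congr hb0 ha0 hb, subst_self, subst_X hsa, id_eq])
  have hbx : ∀ i, b (Sum.inl i) = x i := fun i => by
    rw [← subst_X (R := R) hsb (Sum.inl i)]
    exact hba (Sum.inl i)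
  -- The inverted shear reads G(X, b_Y - X) = Y, where b_Y is the second half of `b`; setting Y = 0
  -- leaves the equation for the inverse.
  let π : Fin m ⊕ Fin m → MvPowerSeries (Fin m) R := Sum.elim X 0
  have hπ0 : ∀ i, constantCoeff (π i) = 0 :=
    constantCoeff_elim (fun i => constantCoeff_X _) constantCoeff_zero_family
  have hsπ := hasSubst_of_constantCoeff_zero hπ0
  have hs0 : ∀ i, constantCoeff (b (Sum.inr i) - b (Sum.inl i)) = 0 := fun i => by
    rw [map_sub, hb0, hb0, sub_zero]
  refine ⟨fun i => subst π (b (Sum.inr i) - b (Sum.inl i)), fun i => ?_, fun j => ?_⟩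
  · rw [constantCoeff_subst_of_zero hπ0, hs0]
  · have h2 : subst b (G.add x (y - x) j) =
        G.add x (fun i => b (Sum.inr i) - b (Sum.inl i)) j := by
      rw [subst_add_apply G hx hyx hb0]
      congr 1
      · exact funext fun i => hba (Sum.inl i)
      · funext i
        rw [Pi.sub_apply, subst_sub hsb]
        exact congrArg₂ _ (subst_X hsb _) (subst_X hsb _)
    have h3 : subst b (G.add x (y - x) j) = X (Sum.inr j) := hba (Sum.inr j)
    have h4 := congrArg (subst π) (h2.symm.trans h3)
    rw [subst_add_apply G hx hs0 hπ0, subst_X hsπ] at h4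
    refine Eq.trans ?_ h4
    change G.add (fun i => X i) _ j = _
    congr 1
    exact funext fun i => (subst_X hsπ (Sum.inl i)).symm

end Domain

end FormalGroupLaw

/-! ### Special substitutions and their composites -/

theorem MvPowerSeries.subst_zero_family {R σ τ : Type*} [CommRing R] {a : σ → MvPowerSeries τ R}
    (h : ∀ i, a i = 0) (f : MvPowerSeries σ R) : subst a f = C (constantCoeff f) := by
  rw [show a = 0 from funext h, subst_zero_eq_C_constantCoeff]
  simp

theorem MvPowerSeries.subst_eq_self {R σ : Type*} [CommRing R] {a : σ → MvPowerSeries σ R}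
    (h : ∀ i, a i = X i) (f : MvPowerSeries σ R) : subst a f = f := by
  rw [show a = X from funext h, subst_self, id]

theorem MvPowerSeries.subst_zero_apply {R σ τ : Type*} [CommRing R] {a : σ → MvPowerSeries τ R}
    (ha : HasSubst a) : subst a (0 : MvPowerSeries σ R) = 0 := by
  rw [← coe_substAlgHom ha, map_zero]

section Compositions

variable {R σ τ υ : Type*} [CommRing R] [Finite σ] [Finite τ] {a : σ → MvPowerSeries τ R}

theorem MvPowerSeries.subst_subst_eq_self {b : τ → MvPowerSeries σ R}
    (ha : ∀ i, constantCoeff (a i) = 0)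
    (hb : ∀ i, constantCoeff (b i) = 0) (h : ∀ i, subst b (a i) = X i) (f : MvPowerSeries σ R) :
    subst b (subst a f) = f :=
  (subst_subst_congr ha hb h f).trans (subst_eq_self (fun _ => rfl) f)

theorem MvPowerSeries.subst_subst_eq_C {b : τ → MvPowerSeries υ R}
    (ha : ∀ i, constantCoeff (a i) = 0)
    (hb : ∀ i, constantCoeff (b i) = 0) (h : ∀ i, subst b (a i) = 0) (f : MvPowerSeries σ R) :
    subst b (subst a f) = C (constantCoeff f) :=
  (subst_subst_congr ha hb h f).trans (subst_zero_family (fun _ => rfl) f)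

end Compositions

theorem MvPowerSeries.isUnit_of_mapMatrix_constantCoeff_eq_one {R σ ι : Type*} [CommRing R]
    [Fintype ι] [DecidableEq ι] {M : Matrix ι ι (MvPowerSeries σ R)}
    (h : (constantCoeff (σ := σ) (R := R)).mapMatrix M = 1) : IsUnit M := by
  rw [Matrix.isUnit_iff_isUnit_det, MvPowerSeries.isUnit_iff_constantCoeff, RingHom.map_det, h,
    Matrix.det_one]
  exact isUnit_one

/-! ### Vector fields on power series rings -/

section VectorFields

variable {R : Type*} [CommRing R] {σ τ : Type*} [Fintype σ] [Fintype τ]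

/-- The derivation `∑ i, v i ∂/∂X_i` of a power series ring. -/
noncomputable def vectorField (v : σ → MvPowerSeries σ R) :
    Derivation R (MvPowerSeries σ R) (MvPowerSeries σ R) := ∑ i, v i • pderiv R i

theorem vectorField_apply (v : σ → MvPowerSeries σ R) (f : MvPowerSeries σ R) :
    vectorField v f = ∑ i, v i * pderiv R i f := by
  rw [vectorField, ← Derivation.coeFnAddMonoidHom_apply, map_sum, Finset.sum_apply]
  rfl

theorem vectorField_X (v : σ → MvPowerSeries σ R) (i : σ) : vectorField v (X i) = v i := by
  rw [vectorField_apply, Finset.sum_eq_single i]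
  · rw [pderiv_X_self, mul_one]
  · intro k _ hk
    rw [pderiv_X_of_ne hk.symm, mul_zero]
  · simp

theorem vectorField_subst (v : τ → MvPowerSeries τ R) {a : σ → MvPowerSeries τ R}
    (ha : ∀ i, constantCoeff (a i) = 0) (f : MvPowerSeries σ R) :
    vectorField v (subst a f) = ∑ i, subst a (pderiv R i f) * vectorField v (a i) := by
  simp only [vectorField_apply, pderiv_subst_eq_sum (hasSubst_of_constantCoeff_zero ha),
    Finset.mul_sum]
  rw [Finset.sum_comm]
  exact Finset.sum_congr rfl fun i _ => Finset.sum_congr rfl fun k _ => by ring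

omit [Fintype τ] in
theorem subst_vectorField (v : σ → MvPowerSeries σ R) {a : σ → MvPowerSeries τ R}
    (ha : ∀ i, constantCoeff (a i) = 0) (f : MvPowerSeries σ R) :
    subst a (vectorField v f) = ∑ i, subst a (pderiv R i f) * subst a (v i) := by
  have hs := hasSubst_of_constantCoeff_zero ha
  simp only [vectorField_apply, ← coe_substAlgHom hs, map_sum, map_mul]
  exact Finset.sum_congr rfl fun i _ => mul_comm _ _

/-- If the vector fields `v` and `v'` are related by the substitution `a` on the variables, then
they are so on all power series. -/
theorem vectorField_subst_of_related {v : τ → MvPowerSeries τ R} {v' : σ → MvPowerSeries σ R}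
    {a : σ → MvPowerSeries τ R} (ha : ∀ i, constantCoeff (a i) = 0)
    (h : ∀ i, vectorField v (a i) = subst a (v' i)) (f : MvPowerSeries σ R) :
    vectorField v (subst a f) = subst a (vectorField v' f) := by
  rw [vectorField_subst v ha, subst_vectorField v' ha]
  exact Finset.sum_congr rfl fun i _ => by rw [h]

/-- The second order parts of the two composites agree because partial derivatives commute. A
commutator is therefore determined by its values on the variables. -/
theorem vectorField_comm (v w : σ → MvPowerSeries σ R) (f : MvPowerSeries σ R) :
    vectorField v (vectorField w f) - vectorField w (vectorField v f) =
      vectorField (fun i => vectorField v (w i) - vectorField w (v i)) f := by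
  have key : ∀ v w : σ → MvPowerSeries σ R, vectorField v (vectorField w f) =
      ∑ i, vectorField v (w i) * pderiv R i f + ∑ i, ∑ k, v k * w i * pderiv R k (pderiv R i f) := by
    intro v w
    rw [vectorField_apply w, map_sum, ← Finset.sum_add_distrib]
    refine Finset.sum_congr rfl fun i _ => ?_
    rw [Derivation.leibniz, smul_eq_mul, smul_eq_mul, vectorField_apply v (pderiv R i f),
      Finset.mul_sum, mul_comm (pderiv R i f), add_comm]
    congr 1
    exact Finset.sum_congr rfl fun k _ => by ring
  rw [key v w, key w v, vectorField_apply, Finset.sum_comm (f := fun i k => w k * v i * _)]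
  simp only [sub_mul, Finset.sum_sub_distrib]
  rw [add_sub_add_comm, add_eq_left, sub_eq_zero]
  exact Finset.sum_congr rfl fun i _ => Finset.sum_congr rfl fun k _ => by
    rw [pderiv_comm_aux k i]
    ring

/-- Leading terms of a vector field. -/
theorem le_order_vectorField_sub_pderiv [DecidableEq σ] {n : ℕ} {v : σ → MvPowerSeries σ R} {k : σ}
    (hv : ∀ i, constantCoeff (v i) = if k = i then 1 else 0) {f : MvPowerSeries σ R}
    (hf : ((n + 1 : ℕ) : ℕ∞) ≤ f.order) :
    ((n + 1 : ℕ) : ℕ∞) ≤ (vectorField v f - pderiv R k f).order := by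
  have h : vectorField v f - pderiv R k f =
      ∑ i, (v i - if k = i then 1 else 0) * pderiv R i f := by
    simp [vectorField_apply, sub_mul, Finset.sum_sub_distrib]
  rw [h]
  refine le_order_sum _ fun i _ => le_order_mul_of_le (a := 1) (b := n) (by omega) ?_
    (le_order_pderiv hf i)
  rw [Nat.cast_one, one_le_order_iff_constCoeff_eq_zero, map_sub, hv]
  split_ifs <;> simp

theorem vectorField_map {S : Type*} [CommRing S] (φ : R →+* S) (v : σ → MvPowerSeries σ R)
    (f : MvPowerSeries σ R) :
    vectorField (fun i => map φ (v i)) (map φ f) = map φ (vectorField v f) := by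
  simp only [vectorField_apply, map_sum, map_mul]
  refine Finset.sum_congr rfl fun i _ => ?_
  congr 1
  ext d
  simp [coeff_pderiv]

end VectorFields

/-! ### Invariant vector fields of a formal group law -/

namespace FormalGroupLaw

variable {R : Type*} [CommRing R] {m : ℕ} (G : FormalGroupLaw R m)

local notation "xx" => (fun i : Fin m => (X (Sum.inl i) : MvPowerSeries (Fin m ⊕ Fin m) _))
local notation "yy" => (fun i : Fin m => (X (Sum.inr i) : MvPowerSeries (Fin m ⊕ Fin m) _))
local notation "atLeftZero" => (Sum.elim 0 X : Fin m ⊕ Fin m → MvPowerSeries (Fin m) _)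
local notation "atRightZero" => (Sum.elim X 0 : Fin m ⊕ Fin m → MvPowerSeries (Fin m) _)

theorem constantCoeff_X_inl (i) : constantCoeff (xx i : MvPowerSeries (Fin m ⊕ Fin m) R) = 0 :=
  constantCoeff_X _

theorem constantCoeff_X_inr (i) : constantCoeff (yy i : MvPowerSeries (Fin m ⊕ Fin m) R) = 0 :=
  constantCoeff_X _

theorem constantCoeff_atLeftZero (i) : constantCoeff (atLeftZero i : MvPowerSeries (Fin m) R) = 0 :=
  constantCoeff_elim constantCoeff_zero_family (fun _ => constantCoeff_X _) i

theorem constantCoeff_atRightZero (i) :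
    constantCoeff (atRightZero i : MvPowerSeries (Fin m) R) = 0 :=
  constantCoeff_elim (fun _ => constantCoeff_X _) constantCoeff_zero_family i

/-- The coefficients of the right invariant vector field with value `∂/∂t_j` at the origin. -/
noncomputable def rightInv (j i : Fin m) : MvPowerSeries (Fin m) R :=
  subst atLeftZero (pderiv R (Sum.inl j) (G.toSeries i))

/-- The coefficients of the left invariant vector field with value `∂/∂t_j` at the origin. -/
noncomputable def leftInv (j i : Fin m) : MvPowerSeries (Fin m) R :=
  subst atRightZero (pderiv R (Sum.inr j) (G.toSeries i))

/-- A vector field acting on the first variables. -/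
noncomputable def onLeft (v : Fin m → MvPowerSeries (Fin m) R) :
    Fin m ⊕ Fin m → MvPowerSeries (Fin m ⊕ Fin m) R :=
  Sum.elim (fun i => subst xx (v i)) 0

/-- A vector field acting on the second variables. -/
noncomputable def onRight (v : Fin m → MvPowerSeries (Fin m) R) :
    Fin m ⊕ Fin m → MvPowerSeries (Fin m ⊕ Fin m) R :=
  Sum.elim 0 (fun i => subst yy (v i))

theorem constantCoeff_rightInv (j i : Fin m) :
    constantCoeff (G.rightInv j i) = if j = i then 1 else 0 := by
  rw [rightInv, constantCoeff_subst_of_zero constantCoeff_atLeftZero, constantCoeff_pderiv_inl]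

theorem constantCoeff_leftInv (j i : Fin m) :
    constantCoeff (G.leftInv j i) = if j = i then 1 else 0 := by
  rw [leftInv, constantCoeff_subst_of_zero constantCoeff_atRightZero, constantCoeff_pderiv_inr]

theorem vectorField_onLeft (v : Fin m → MvPowerSeries (Fin m) R)
    (F : MvPowerSeries (Fin m ⊕ Fin m) R) :
    vectorField (onLeft v) F = ∑ k, subst xx (v k) * pderiv R (Sum.inl k) F := by
  simp [vectorField_apply, Fintype.sum_sum_type, onLeft]

theorem vectorField_onRight (v : Fin m → MvPowerSeries (Fin m) R)
    (F : MvPowerSeries (Fin m ⊕ Fin m) R) :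
    vectorField (onRight v) F = ∑ k, subst yy (v k) * pderiv R (Sum.inr k) F := by
  simp [vectorField_apply, Fintype.sum_sum_type, onRight]

theorem vectorField_onLeft_subst_inl (v : Fin m → MvPowerSeries (Fin m) R)
    (f : MvPowerSeries (Fin m) R) :
    vectorField (onLeft v) (subst xx f) = subst xx (vectorField v f) :=
  vectorField_subst_of_related (fun _ => constantCoeff_X _)
    (fun i => by rw [vectorField_X]; rfl) f

theorem vectorField_onLeft_subst_inr (v : Fin m → MvPowerSeries (Fin m) R)
    (f : MvPowerSeries (Fin m) R) : vectorField (onLeft v) (subst yy f) = 0 := by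
  rw [vectorField_subst _ fun _ => constantCoeff_X _]
  exact Finset.sum_eq_zero fun i _ => by rw [vectorField_X]; exact mul_zero _

theorem vectorField_onRight_subst_inr (v : Fin m → MvPowerSeries (Fin m) R)
    (f : MvPowerSeries (Fin m) R) :
    vectorField (onRight v) (subst yy f) = subst yy (vectorField v f) :=
  vectorField_subst_of_related (fun _ => constantCoeff_X _)
    (fun i => by rw [vectorField_X]; rfl) f

theorem vectorField_onRight_subst_inl (v : Fin m → MvPowerSeries (Fin m) R)
    (f : MvPowerSeries (Fin m) R) : vectorField (onRight v) (subst xx f) = 0 := by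
  rw [vectorField_subst _ fun _ => constantCoeff_X _]
  exact Finset.sum_eq_zero fun i _ => by rw [vectorField_X]; exact mul_zero _

theorem pderiv_add {τ : Type*} {a b : Fin m → MvPowerSeries τ R}
    (ha : ∀ i, constantCoeff (a i) = 0) (hb : ∀ i, constantCoeff (b i) = 0) (k : τ) (i : Fin m) :
    pderiv R k (G.add a b i) =
      ∑ l, subst (Sum.elim a b) (pderiv R (Sum.inl l) (G.toSeries i)) * pderiv R k (a l) +
      ∑ l, subst (Sum.elim a b) (pderiv R (Sum.inr l) (G.toSeries i)) * pderiv R k (b l) := by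
  rw [add, pderiv_subst_eq_sum (hasSubst_of_constantCoeff_zero (constantCoeff_elim ha hb)),
    Fintype.sum_sum_type]
  rfl

theorem pderiv_X_ite {τ : Type*} [DecidableEq τ] (i j : τ) :
    pderiv R i (X j : MvPowerSeries τ R) = if j = i then 1 else 0 := by
  split_ifs with h
  · rw [h, pderiv_X_self]
  · rw [pderiv_X_of_ne h]

theorem add_X_X : G.add xx yy = G.toSeries := funext fun i => subst_eq_self (by
  rintro (i | i) <;> rfl) _

variable [IsDomain R] [CharZero R]

/-- Right invariance. -/
theorem vectorField_rightInv_toSeries (j i : Fin m) :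
    vectorField (onLeft (G.rightInv j)) (G.toSeries i) = subst G.toSeries (G.rightInv j i) := by
  classical
  let x : Fin m → MvPowerSeries ((Fin m ⊕ Fin m) ⊕ Fin m) R := fun i => X (Sum.inl (Sum.inl i))
  let y : Fin m → MvPowerSeries ((Fin m ⊕ Fin m) ⊕ Fin m) R := fun i => X (Sum.inl (Sum.inr i))
  let z : Fin m → MvPowerSeries ((Fin m ⊕ Fin m) ⊕ Fin m) R := fun i => X (Sum.inr i)
  have hx : ∀ i, constantCoeff (x i) = 0 := fun i => constantCoeff_X _
  have hy : ∀ i, constantCoeff (y i) = 0 := fun i => constantCoeff_X _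
  have hz : ∀ i, constantCoeff (z i) = 0 := fun i => constantCoeff_X _
  have hxy := G.constantCoeff_add hx hy
  have hyz := G.constantCoeff_add hy hz
  let p : (Fin m ⊕ Fin m) ⊕ Fin m → MvPowerSeries (Fin m ⊕ Fin m) R :=
    Sum.elim (Sum.elim 0 xx) yy
  have hp : ∀ i, constantCoeff (p i) = 0 := by
    rintro ((i | i) | i)
    exacts [constantCoeff_zero_family i, constantCoeff_X _, constantCoeff_X _]
  have hsp := hasSubst_of_constantCoeff_zero hp
  have px : (fun i => subst p (x i)) = 0 := funext fun i => subst_X hsp _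
  have py : (fun i => subst p (y i)) = xx := funext fun i => subst_X hsp _
  have pz : (fun i => subst p (z i)) = yy := funext fun i => subst_X hsp _
  -- Differentiate G(G(x, y), z) = G(x, G(y, z)) in x_j and set x = 0; `p` also renames y, z to the
  -- two sets of variables.
  have key := congrArg (fun F => subst p (pderiv R (Sum.inl (Sum.inl j)) F))
    (congrFun (G.add_assoc hx hy hz) i)
  have e0 : ∀ k, pderiv R (Sum.inl (Sum.inl j)) (x k) = if k = j then 1 else 0 := by
    intro k
    simp [x, pderiv_X_ite]
  have e1 : ∀ k, pderiv R (Sum.inl (Sum.inl j)) (y k) = 0 := by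
    intro k
    simp [y]
  have e2 : ∀ k, pderiv R (Sum.inl (Sum.inl j)) (z k) = 0 := by
    intro k
    simp [z]
  simp only [G.pderiv_add hxy hz, G.pderiv_add hx hy, G.pderiv_add hx hyz, G.pderiv_add hy hz,
    e0, e1, e2, mul_zero, mul_ite, mul_one, Finset.sum_const_zero, Finset.sum_ite_eq',
    Finset.mem_univ, if_true, _root_.add_zero] at key
  simp only [← coe_substAlgHom hsp, map_sum, map_mul] at key
  simp only [coe_substAlgHom hsp] at key
  have f1 : ∀ g : MvPowerSeries (Fin m ⊕ Fin m) R,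
      subst p (subst (Sum.elim (G.add x y) z) g) = g := by
    intro g
    rw [subst_subst_congr (constantCoeff_elim hxy hz) hp fun i => rfl]
    refine subst_eq_self ?_ g
    rintro (i | i)
    · exact (G.subst_add_apply hx hy hp i).trans (by
        rw [px, py, G.zero_add fun i => constantCoeff_X _])
    · exact congrFun pz i
  have f2 : ∀ k, subst p (subst (Sum.elim x y) (pderiv R (Sum.inl j) (G.toSeries k))) =
      subst xx (G.rightInv j k) := by
    intro k
    have hsx := hasSubst_of_constantCoeff_zero (constantCoeff_X_inl (R := R) (m := m))
    rw [rightInv, subst_comp_subst_apply (hasSubst_of_constantCoeff_zero constantCoeff_atLeftZero)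
      hsx]
    refine subst_subst_congr (constantCoeff_elim hx hy) hp ?_ _
    rintro (i | i)
    · exact (congrFun px i).trans (subst_zero_apply hsx).symm
    · exact (congrFun py i).trans (subst_X hsx i).symm
  have f3 : subst p (subst (Sum.elim x (G.add y z)) (pderiv R (Sum.inl j) (G.toSeries i))) =
      subst G.toSeries (G.rightInv j i) := by
    have hsG := hasSubst_of_constantCoeff_zero G.constantCoeff_toSeries
    rw [rightInv, subst_comp_subst_apply (hasSubst_of_constantCoeff_zero constantCoeff_atLeftZero)
      hsG]
    refine subst_subst_congr (constantCoeff_elim hx hyz) hp ?_ _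
    rintro (i | i)
    · exact (congrFun px i).trans (subst_zero_apply hsG).symm
    · refine (G.subst_add_apply hy hz hp i).trans (Eq.trans ?_ (subst_X hsG i).symm)
      rw [py, pz, add_X_X]
  rw [f3] at key
  rw [vectorField_onLeft, ← key]
  refine Finset.sum_congr rfl fun k _ => ?_
  rw [f1, f2, mul_comm]

/-- Left invariance. -/
theorem vectorField_leftInv_toSeries (j i : Fin m) :
    vectorField (onRight (G.leftInv j)) (G.toSeries i) = subst G.toSeries (G.leftInv j i) := by
  classical
  let x : Fin m → MvPowerSeries ((Fin m ⊕ Fin m) ⊕ Fin m) R := fun i => X (Sum.inl (Sum.inl i))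
  let y : Fin m → MvPowerSeries ((Fin m ⊕ Fin m) ⊕ Fin m) R := fun i => X (Sum.inl (Sum.inr i))
  let z : Fin m → MvPowerSeries ((Fin m ⊕ Fin m) ⊕ Fin m) R := fun i => X (Sum.inr i)
  have hx : ∀ i, constantCoeff (x i) = 0 := fun i => constantCoeff_X _
  have hy : ∀ i, constantCoeff (y i) = 0 := fun i => constantCoeff_X _
  have hz : ∀ i, constantCoeff (z i) = 0 := fun i => constantCoeff_X _
  have hxy := G.constantCoeff_add hx hy
  have hyz := G.constantCoeff_add hy hz
  let p : (Fin m ⊕ Fin m) ⊕ Fin m → MvPowerSeries (Fin m ⊕ Fin m) R :=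
    Sum.elim (Sum.elim xx yy) 0
  have hp : ∀ i, constantCoeff (p i) = 0 := by
    rintro ((i | i) | i)
    exacts [constantCoeff_X _, constantCoeff_X _, constantCoeff_zero_family i]
  have hsp := hasSubst_of_constantCoeff_zero hp
  have px : (fun i => subst p (x i)) = xx := funext fun i => subst_X hsp _
  have py : (fun i => subst p (y i)) = yy := funext fun i => subst_X hsp _
  have pz : (fun i => subst p (z i)) = 0 := funext fun i => subst_X hsp _
  -- The mirror image: differentiate the associative law in z_j and set z = 0.
  have key := congrArg (fun F => subst p (pderiv R (Sum.inr j) F))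
    (congrFun (G.add_assoc hx hy hz) i)
  have e0 : ∀ k, pderiv R (Sum.inr j) (x k) = 0 := by
    intro k
    simp [x]
  have e1 : ∀ k, pderiv R (Sum.inr j) (y k) = 0 := by
    intro k
    simp [y]
  have e2 : ∀ k, pderiv R (Sum.inr j) (z k) = if k = j then 1 else 0 := by
    intro k
    simp [z, pderiv_X_ite]
  simp only [G.pderiv_add hxy hz, G.pderiv_add hx hy, G.pderiv_add hx hyz, G.pderiv_add hy hz,
    e0, e1, e2, mul_zero, mul_ite, mul_one, Finset.sum_const_zero, Finset.sum_ite_eq',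
    Finset.mem_univ, if_true, _root_.add_zero, _root_.zero_add] at key
  simp only [← coe_substAlgHom hsp, map_sum, map_mul] at key
  simp only [coe_substAlgHom hsp] at key
  have f1 : ∀ g : MvPowerSeries (Fin m ⊕ Fin m) R,
      subst p (subst (Sum.elim x (G.add y z)) g) = g := by
    intro g
    rw [subst_subst_congr (constantCoeff_elim hx hyz) hp fun i => rfl]
    refine subst_eq_self ?_ g
    rintro (i | i)
    · exact congrFun px i
    · exact (G.subst_add_apply hy hz hp i).trans (by
        rw [py, pz, G.add_zero fun i => constantCoeff_X _])
  have f2 : ∀ k, subst p (subst (Sum.elim y z) (pderiv R (Sum.inr j) (G.toSeries k))) =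
      subst yy (G.leftInv j k) := by
    intro k
    have hsy := hasSubst_of_constantCoeff_zero (constantCoeff_X_inr (R := R) (m := m))
    rw [leftInv, subst_comp_subst_apply (hasSubst_of_constantCoeff_zero constantCoeff_atRightZero)
      hsy]
    refine subst_subst_congr (constantCoeff_elim hy hz) hp ?_ _
    rintro (i | i)
    · exact (congrFun py i).trans (subst_X hsy i).symm
    · exact (congrFun pz i).trans (subst_zero_apply hsy).symm
  have f3 : subst p (subst (Sum.elim (G.add x y) z) (pderiv R (Sum.inr j) (G.toSeries i))) =
      subst G.toSeries (G.leftInv j i) := by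
    have hsG := hasSubst_of_constantCoeff_zero G.constantCoeff_toSeries
    rw [leftInv, subst_comp_subst_apply (hasSubst_of_constantCoeff_zero constantCoeff_atRightZero)
      hsG]
    refine subst_subst_congr (constantCoeff_elim hxy hz) hp ?_ _
    rintro (i | i)
    · refine (G.subst_add_apply hx hy hp i).trans (Eq.trans ?_ (subst_X hsG i).symm)
      rw [px, py, add_X_X]
    · exact (congrFun pz i).trans (subst_zero_apply hsG).symm
  rw [f3] at key
  rw [vectorField_onRight, key]
  refine Finset.sum_congr rfl fun k _ => ?_
  rw [f1, f2, mul_comm]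

theorem vectorField_onLeft_subst_toSeries (j : Fin m) (f : MvPowerSeries (Fin m) R) :
    vectorField (onLeft (G.rightInv j)) (subst G.toSeries f) =
      subst G.toSeries (vectorField (G.rightInv j) f) :=
  vectorField_subst_of_related G.constantCoeff_toSeries (G.vectorField_rightInv_toSeries j) f

omit [IsDomain R] [CharZero R] in
theorem subst_atLeftZero_subst_inl (f : MvPowerSeries (Fin m) R) :
    subst atLeftZero (subst xx f : MvPowerSeries (Fin m ⊕ Fin m) R) = C (constantCoeff f) :=
  subst_subst_eq_C constantCoeff_X_inl constantCoeff_atLeftZero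
    (fun _ => subst_X (hasSubst_of_constantCoeff_zero constantCoeff_atLeftZero) _) f

omit [IsDomain R] [CharZero R] in
theorem subst_atRightZero_subst_inl (f : MvPowerSeries (Fin m) R) :
    subst atRightZero (subst xx f : MvPowerSeries (Fin m ⊕ Fin m) R) = f :=
  subst_subst_eq_self constantCoeff_X_inl constantCoeff_atRightZero
    (fun _ => subst_X (hasSubst_of_constantCoeff_zero constantCoeff_atRightZero) _) f

theorem subst_atLeftZero_toSeries (f : MvPowerSeries (Fin m) R) :
    subst atLeftZero (subst G.toSeries f) = f :=
  subst_subst_eq_self G.constantCoeff_toSeries constantCoeff_atLeftZero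
    (congrFun G.zero_add_X) f

theorem subst_atRightZero_toSeries (f : MvPowerSeries (Fin m) R) :
    subst atRightZero (subst G.toSeries f) = f :=
  subst_subst_eq_self G.constantCoeff_toSeries constantCoeff_atRightZero
    (congrFun G.add_zero_X) f

/-- Chain rule for an infinitesimal translation in the first argument of G. In this form invariant
fields can be composed by differentiating f(G(X, Y)). -/
theorem vectorField_rightInv_eq (j : Fin m) (f : MvPowerSeries (Fin m) R) :
    vectorField (G.rightInv j) f =
      subst atLeftZero (pderiv R (Sum.inl j) (subst G.toSeries f)) := by
  have hs := hasSubst_of_constantCoeff_zero (constantCoeff_atLeftZero (R := R) (m := m))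
  rw [pderiv_subst_eq_sum (hasSubst_of_constantCoeff_zero G.constantCoeff_toSeries),
    vectorField_apply, ← coe_substAlgHom hs, map_sum]
  refine Finset.sum_congr rfl fun i _ => ?_
  rw [map_mul, coe_substAlgHom, subst_atLeftZero_toSeries, mul_comm]
  rfl

theorem vectorField_leftInv_eq (j : Fin m) (f : MvPowerSeries (Fin m) R) :
    vectorField (G.leftInv j) f =
      subst atRightZero (pderiv R (Sum.inr j) (subst G.toSeries f)) := by
  have hs := hasSubst_of_constantCoeff_zero (constantCoeff_atRightZero (R := R) (m := m))
  rw [pderiv_subst_eq_sum (hasSubst_of_constantCoeff_zero G.constantCoeff_toSeries),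
    vectorField_apply, ← coe_substAlgHom hs, map_sum]
  refine Finset.sum_congr rfl fun i _ => ?_
  rw [map_mul, coe_substAlgHom, subst_atRightZero_toSeries, mul_comm]
  rfl

omit [IsDomain R] [CharZero R] in
theorem pderiv_inl_subst_inl (l : Fin m) (f : MvPowerSeries (Fin m) R) :
    pderiv R (Sum.inl l) (subst xx f) = subst xx (pderiv R l f) := by
  classical
  rw [pderiv_subst_eq_sum (hasSubst_of_constantCoeff_zero fun i => constantCoeff_X _)]
  simp [pderiv_X_ite]

omit [IsDomain R] [CharZero R] in
theorem pderiv_inr_subst_inl (l : Fin m) (f : MvPowerSeries (Fin m) R) :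
    pderiv R (Sum.inr l) (subst xx f) = 0 := by
  rw [pderiv_subst_eq_sum (hasSubst_of_constantCoeff_zero fun i => constantCoeff_X _)]
  simp

omit [IsDomain R] [CharZero R] in
theorem constantCoeff_pderiv_rightInv (l j k : Fin m) :
    constantCoeff (pderiv R l (G.rightInv j k)) = G.γ k j l := by
  classical
  rw [rightInv, pderiv_subst_eq_sum (hasSubst_of_constantCoeff_zero constantCoeff_atLeftZero),
    Fintype.sum_sum_type, γ_eq, pderiv_comm_aux (Sum.inl j)]
  simp [pderiv_X_ite, constantCoeff_subst_of_zero constantCoeff_atLeftZero]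

/-- By right invariance the inner field becomes a field in X acting on f(G(X, Y)). Then ∂/∂X_l at X
= 0 hits either its coefficients, whose derivatives at 0 are the γ, or the function, leaving a
second derivative symmetric in `l` and `j`. -/
theorem vectorField_rightInv_rightInv (l j : Fin m) (f : MvPowerSeries (Fin m) R) :
    vectorField (G.rightInv l) (vectorField (G.rightInv j) f) =
      ∑ k, G.γ k j l • vectorField (G.rightInv k) f +
      subst atLeftZero (pderiv R (Sum.inl l) (pderiv R (Sum.inl j) (subst G.toSeries f))) := by
  have hs := hasSubst_of_constantCoeff_zero (constantCoeff_atLeftZero (R := R) (m := m))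
  rw [vectorField_rightInv_eq G l, ← vectorField_onLeft_subst_toSeries, vectorField_onLeft]
  simp only [map_sum, Derivation.leibniz, smul_eq_mul, pderiv_inl_subst_inl]
  rw [← coe_substAlgHom hs]
  simp only [map_sum, map_add, map_mul]
  simp only [coe_substAlgHom, subst_atLeftZero_subst_inl, constantCoeff_rightInv,
    constantCoeff_pderiv_rightInv, ← vectorField_rightInv_eq]
  rw [Finset.sum_add_distrib, add_comm]
  congr 1
  · exact Finset.sum_congr rfl fun k _ => by rw [smul_eq_C_mul, mul_comm]
  · simp

/-- The symmetric second derivatives cancel. The sign is opposite to that of ⁅e_l, e_j⁆, which is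
why the enveloping algebra acts from the right. -/
theorem vectorField_rightInv_comm (l j : Fin m) (f : MvPowerSeries (Fin m) R) :
    vectorField (G.rightInv l) (vectorField (G.rightInv j) f) -
      vectorField (G.rightInv j) (vectorField (G.rightInv l) f) =
      ∑ k, (G.γ k j l - G.γ k l j) • vectorField (G.rightInv k) f := by
  rw [vectorField_rightInv_rightInv, vectorField_rightInv_rightInv,
    pderiv_comm_aux (Sum.inl l), add_sub_add_right_eq_sub, ← Finset.sum_sub_distrib]
  exact Finset.sum_congr rfl fun k _ => (sub_smul _ _ _).symm

/-- A commutator of fields is determined by its coefficients, and these are the renamed coefficients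
of the one-variable relation. -/
theorem vectorField_onLeft_rightInv_comm (l j : Fin m) (F : MvPowerSeries (Fin m ⊕ Fin m) R) :
    vectorField (onLeft (G.rightInv l)) (vectorField (onLeft (G.rightInv j)) F) -
      vectorField (onLeft (G.rightInv j)) (vectorField (onLeft (G.rightInv l)) F) =
      ∑ k, (G.γ k j l - G.γ k l j) • vectorField (onLeft (G.rightInv k)) F := by
  have hs := hasSubst_of_constantCoeff_zero (constantCoeff_X_inl (R := R) (m := m))
  have h : ∀ i : Fin m, vectorField (onLeft (G.rightInv l)) (onLeft (G.rightInv j) (Sum.inl i)) -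
      vectorField (onLeft (G.rightInv j)) (onLeft (G.rightInv l) (Sum.inl i)) =
      ∑ k, (G.γ k j l - G.γ k l j) • onLeft (G.rightInv k) (Sum.inl i) := by
    intro i
    have := congrArg (subst (xx : Fin m → MvPowerSeries (Fin m ⊕ Fin m) R))
      (G.vectorField_rightInv_comm l j (X i))
    simp only [vectorField_X] at this
    rw [subst_sub hs, ← vectorField_onLeft_subst_inl, ← vectorField_onLeft_subst_inl] at this
    refine this.trans ?_
    simp only [← coe_substAlgHom hs, map_sum, map_smul]
    simp only [coe_substAlgHom hs]
    rfl
  rw [vectorField_comm, vectorField_apply, Fintype.sum_sum_type]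
  simp only [h]
  simp only [onLeft, Sum.elim_inr, Pi.zero_apply, map_zero, sub_zero, zero_mul,
    Finset.sum_const_zero, _root_.add_zero, Sum.elim_inl, vectorField_apply, Fintype.sum_sum_type,
    Finset.sum_mul, Finset.smul_sum, smul_mul_assoc]
  exact Finset.sum_comm

theorem vectorField_onRight_rightInv_comm (l j : Fin m) (F : MvPowerSeries (Fin m ⊕ Fin m) R) :
    vectorField (onRight (G.rightInv l)) (vectorField (onRight (G.rightInv j)) F) -
      vectorField (onRight (G.rightInv j)) (vectorField (onRight (G.rightInv l)) F) =
      ∑ k, (G.γ k j l - G.γ k l j) • vectorField (onRight (G.rightInv k)) F := by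
  have hs := hasSubst_of_constantCoeff_zero (constantCoeff_X_inr (R := R) (m := m))
  have h : ∀ i : Fin m, vectorField (onRight (G.rightInv l)) (onRight (G.rightInv j) (Sum.inr i)) -
      vectorField (onRight (G.rightInv j)) (onRight (G.rightInv l) (Sum.inr i)) =
      ∑ k, (G.γ k j l - G.γ k l j) • onRight (G.rightInv k) (Sum.inr i) := by
    intro i
    have := congrArg (subst (yy : Fin m → MvPowerSeries (Fin m ⊕ Fin m) R))
      (G.vectorField_rightInv_comm l j (X i))
    simp only [vectorField_X] at this
    rw [subst_sub hs, ← vectorField_onRight_subst_inr, ← vectorField_onRight_subst_inr] at this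
    refine this.trans ?_
    simp only [← coe_substAlgHom hs, map_sum, map_smul]
    simp only [coe_substAlgHom hs]
    rfl
  rw [vectorField_comm, vectorField_apply, Fintype.sum_sum_type]
  simp only [h]
  simp only [onRight, Sum.elim_inl, Pi.zero_apply, map_zero, sub_zero, zero_mul,
    Finset.sum_const_zero, _root_.zero_add, Sum.elim_inr, vectorField_apply, Fintype.sum_sum_type,
    Finset.sum_mul, Finset.smul_sum, smul_mul_assoc]
  exact Finset.sum_comm

omit [IsDomain R] [CharZero R] in
theorem vectorField_onLeft_onRight_comm (v w : Fin m → MvPowerSeries (Fin m) R)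
    (F : MvPowerSeries (Fin m ⊕ Fin m) R) :
    vectorField (onLeft v) (vectorField (onRight w) F) =
      vectorField (onRight w) (vectorField (onLeft v) F) := by
  rw [← sub_eq_zero, vectorField_comm, vectorField_apply]
  refine Finset.sum_eq_zero fun i _ => ?_
  rcases i with i | i
  · rw [show onRight w (Sum.inl i) = 0 from rfl, map_zero, zero_sub,
      show onLeft v (Sum.inl i) = subst xx (v i) from rfl, vectorField_onRight_subst_inl, neg_zero,
      zero_mul]
  · rw [show onLeft v (Sum.inr i) = 0 from rfl, map_zero, sub_zero,
      show onRight w (Sum.inr i) = subst yy (w i) from rfl, vectorField_onLeft_subst_inr, zero_mul]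

/-- Left and right translations commute: on f(G(X, Y)) the left invariant field is ∂/∂Y_k at Y = 0
and the right invariant field involves only X. -/
theorem vectorField_leftInv_rightInv_comm (j k : Fin m) (f : MvPowerSeries (Fin m) R) :
    vectorField (G.leftInv k) (vectorField (G.rightInv j) f) =
      vectorField (G.rightInv j) (vectorField (G.leftInv k) f) := by
  have hs := hasSubst_of_constantCoeff_zero (constantCoeff_atRightZero (R := R) (m := m))
  rw [vectorField_leftInv_eq, vectorField_leftInv_eq, ← vectorField_onLeft_subst_toSeries]
  have h : pderiv R (Sum.inr k) (vectorField (onLeft (G.rightInv j)) (subst G.toSeries f)) =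
      vectorField (onLeft (G.rightInv j)) (pderiv R (Sum.inr k) (subst G.toSeries f)) := by
    simp only [vectorField_onLeft, map_sum, Derivation.leibniz, smul_eq_mul, pderiv_inr_subst_inl,
      mul_zero, _root_.add_zero]
    exact Finset.sum_congr rfl fun i _ => by rw [pderiv_comm_aux]
  rw [h]
  symm
  refine vectorField_subst_of_related constantCoeff_atRightZero ?_ _
  rintro (i | i)
  · rw [Sum.elim_inl, vectorField_X]
    exact (subst_atRightZero_subst_inl _).symm
  · rw [Sum.elim_inr, Pi.zero_apply, map_zero]
    exact (subst_zero_apply hs).symm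

omit [IsDomain R] [CharZero R] in
theorem isUnit_subst_pderiv_inr {a : Fin m ⊕ Fin m → MvPowerSeries (Fin m) R}
    (ha : ∀ i, constantCoeff (a i) = 0) :
    IsUnit (Matrix.of fun i k => subst a (pderiv R (Sum.inr k) (G.toSeries i))) := by
  refine isUnit_of_mapMatrix_constantCoeff_eq_one (Matrix.ext fun i k => ?_)
  change constantCoeff (subst a (pderiv R (Sum.inr k) (G.toSeries i))) = _
  rw [constantCoeff_subst_of_zero ha, constantCoeff_pderiv_inr, Matrix.one_apply]
  simp only [eq_comm]

/-- Right invariance evaluated where G vanishes: the right-hand side becomes the value of the field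
at the origin. -/
theorem sum_subst_pderiv_inl {a : Fin m ⊕ Fin m → MvPowerSeries (Fin m) R}
    (ha : ∀ i, constantCoeff (a i) = 0) (h : ∀ i, subst a (G.toSeries i) = 0) (j i : Fin m) :
    ∑ k, subst a (pderiv R (Sum.inl k) (G.toSeries i)) *
      subst (fun l => a (Sum.inl l)) (G.rightInv j k) = C (if j = i then 1 else 0) := by
  have hsa := hasSubst_of_constantCoeff_zero ha
  have key := congrArg (subst a) (G.vectorField_rightInv_toSeries j i)
  rw [subst_subst_eq_C G.constantCoeff_toSeries ha h, constantCoeff_rightInv, vectorField_onLeft,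
    ← coe_substAlgHom hsa, map_sum] at key
  rw [← key]
  refine Finset.sum_congr rfl fun k _ => ?_
  rw [map_mul, mul_comm, coe_substAlgHom hsa]
  exact congrArg (· * _) (subst_subst_congr constantCoeff_X_inl ha
    (fun l => subst_X hsa (Sum.inl l)) _).symm

theorem sum_subst_pderiv_inr {a : Fin m ⊕ Fin m → MvPowerSeries (Fin m) R}
    (ha : ∀ i, constantCoeff (a i) = 0) (h : ∀ i, subst a (G.toSeries i) = 0) (j i : Fin m) :
    ∑ k, subst a (pderiv R (Sum.inr k) (G.toSeries i)) *
      subst (fun l => a (Sum.inr l)) (G.leftInv j k) = C (if j = i then 1 else 0) := by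
  have hsa := hasSubst_of_constantCoeff_zero ha
  have key := congrArg (subst a) (G.vectorField_leftInv_toSeries j i)
  rw [subst_subst_eq_C G.constantCoeff_toSeries ha h, constantCoeff_leftInv, vectorField_onRight,
    ← coe_substAlgHom hsa, map_sum] at key
  rw [← key]
  refine Finset.sum_congr rfl fun k _ => ?_
  rw [map_mul, mul_comm, coe_substAlgHom hsa]
  exact congrArg (· * _) (subst_subst_congr constantCoeff_X_inr ha
    (fun l => subst_X hsa (Sum.inr l)) _).symm

/-- The inverse maps right invariant vector fields to left invariant ones. -/
theorem vectorField_rightInv_inverse {s : Fin m → MvPowerSeries (Fin m) R} (hs : G.IsInverse s)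
    (j : Fin m) : (fun k => vectorField (G.rightInv j) (s k)) =
      fun k => - subst s (G.leftInv j k) := by
  have ha : ∀ i, constantCoeff (Sum.elim (fun i => X i) s i) = 0 :=
    constantCoeff_elim (fun i => constantCoeff_X i) hs.constantCoeff_eq_zero
  -- The Jacobian ∂G/∂Y along (X, s(X)) is invertible, so it may be applied to both sides. Then G(X,
  -- s(X)) = 0 is differentiated along the field (`h1`); `h2` and `h3` are right and left invariance
  -- along this family.
  apply Matrix.mulVec_injective_of_isUnit (G.isUnit_subst_pderiv_inr ha)
  funext i
  have h1 : vectorField (G.rightInv j) (subst (Sum.elim (fun i => X i) s) (G.toSeries i)) = 0 := by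
    rw [hs.subst_eq_zero i, map_zero]
  have h2 := G.sum_subst_pderiv_inl ha hs.subst_eq_zero j i
  have h3 := G.sum_subst_pderiv_inr ha hs.subst_eq_zero j i
  rw [vectorField_subst _ ha, Fintype.sum_sum_type] at h1
  simp only [Sum.elim_inl, Sum.elim_inr, vectorField_X] at h1 h2 h3
  simp only [subst_eq_self (a := fun l : Fin m => (X l : MvPowerSeries (Fin m) R))
    fun _ => rfl] at h2
  simp only [Matrix.mulVec, dotProduct, Matrix.of_apply, mul_neg, Finset.sum_neg_distrib]
  rw [eq_neg_iff_add_eq_zero, h3, ← h2, add_comm, h1]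

end FormalGroupLaw

/-! ### Leading terms of products of vector fields -/

section LeadingTerms

variable {R : Type*} [CommRing R] {σ : Type*} [Fintype σ] [DecidableEq σ]
  {V : σ → σ → MvPowerSeries σ R}

theorem le_order_foldl_vectorField (hV : ∀ k i, constantCoeff (V k i) = if k = i then 1 else 0)
    {a : ℕ} (w : List σ) {f : MvPowerSeries σ R} (hf : ((a + w.length : ℕ) : ℕ∞) ≤ f.order) :
    (a : ℕ∞) ≤ (w.foldl (fun f k => vectorField (V k) f) f).order := by
  induction w generalizing f with
  | nil => simpa using hf
  | cons k w ih =>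
    refine ih ?_
    rw [List.length_cons, ← Nat.add_assoc] at hf
    change _ ≤ (vectorField (V k) f).order
    rw [← sub_add_cancel (vectorField (V k) f) (pderiv R k f)]
    exact le_order_add ((Nat.cast_le.2 (Nat.le_succ _)).trans
      (le_order_vectorField_sub_pderiv (hV k) hf)) (le_order_pderiv hf k)

omit [DecidableEq σ] in
theorem foldl_vectorField_sub (w : List σ) (f g : MvPowerSeries σ R) :
    w.foldl (fun f k => vectorField (V k) f) (f - g) =
      w.foldl (fun f k => vectorField (V k) f) f - w.foldl (fun f k => vectorField (V k) f) g := by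
  induction w generalizing f g with
  | nil => rfl
  | cons k w ih => rw [List.foldl_cons, map_sub, ih]; rfl

/-- Replace the fields by partial derivatives one at a time. Each replacement makes an error of one
order more than expected, and the remaining fields lower the order by at most one each. -/
theorem le_order_foldl_vectorField_sub
    (hV : ∀ k i, constantCoeff (V k i) = if k = i then 1 else 0)
    {a : ℕ} (w : List σ) {f : MvPowerSeries σ R} (hf : ((a + w.length : ℕ) : ℕ∞) ≤ f.order) :
    ((a + 1 : ℕ) : ℕ∞) ≤ (w.foldl (fun f k => vectorField (V k) f) f -
      w.foldl (fun f k => pderiv R k f) f).order := by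
  induction w generalizing f with
  | nil => simp
  | cons k w ih =>
    rw [List.length_cons, ← Nat.add_assoc] at hf
    rw [List.foldl_cons, List.foldl_cons, ← sub_add_sub_cancel _
      (w.foldl (fun f k => vectorField (V k) f) (pderiv R k f)), ← foldl_vectorField_sub]
    refine le_order_add (le_order_foldl_vectorField hV w ?_) (ih (le_order_pderiv hf k))
    rw [Nat.add_right_comm]
    exact le_order_vectorField_sub_pderiv (hV k) hf

/-- The exponent of the product of the variables in a list. -/
noncomputable def wordExponent {σ : Type*} (w : List σ) : σ →₀ ℕ :=
  (w.map fun k => Finsupp.single k 1).sum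

theorem degree_wordExponent {σ : Type*} (w : List σ) : (wordExponent w).degree = w.length := by
  induction w with
  | nil => simp [wordExponent]
  | cons k w ih =>
    rw [wordExponent, List.map_cons, List.sum_cons, map_add, Finsupp.degree_single]
    rw [wordExponent] at ih
    rw [ih, List.length_cons, Nat.add_comm]

omit [DecidableEq σ] in
-- In the coordinates d! b_d a partial derivative is a shift of the index, without numerical
-- factors.
theorem multiFactorial_mul_coeff_foldl_pderiv (w : List σ) (f : MvPowerSeries σ R) (d : σ →₀ ℕ) :
    (multiFactorial d : R) * coeff d (w.foldl (fun f k => pderiv R k f) f) =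
      multiFactorial (d + wordExponent w) * coeff (d + wordExponent w) f := by
  induction w generalizing f with
  | nil => simp [wordExponent]
  | cons k w ih =>
    have h : d + wordExponent (k :: w) = d + wordExponent w + Finsupp.single k 1 := by
      simp only [wordExponent, List.map_cons, List.sum_cons]
      abel
    rw [List.foldl_cons, ih, coeff_pderiv, h, multiFactorial_add_single]
    push_cast
    ring

/-- The source of the triangularity of the pairing: at the lowest possible order only the values of
the fields at the origin matter, so the fields may be taken to be the ∂/∂t_k. -/
theorem constantCoeff_foldl_vectorField
    (hV : ∀ k i, constantCoeff (V k i) = if k = i then 1 else 0)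
    {w : List σ} {f : MvPowerSeries σ R} (hf : (w.length : ℕ∞) ≤ f.order) :
    constantCoeff (w.foldl (fun f k => vectorField (V k) f) f) =
      multiFactorial (wordExponent w) * coeff (wordExponent w) f := by
  have h1 := le_order_foldl_vectorField_sub hV (a := 0) w (by rwa [Nat.zero_add])
  have h2 := natCast_le_order_iff.1 h1 0 (by simp)
  have h3 := multiFactorial_mul_coeff_foldl_pderiv w f 0
  rw [map_sub, sub_eq_zero, coeff_zero_eq_constantCoeff_apply] at h2
  rw [_root_.zero_add] at h3
  rw [h2, ← h3]
  simp [multiFactorial]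

end LeadingTerms

/-! ### Coefficients of products f(X) g(Y) -/

section TensorCoefficients

variable {R : Type*} [CommRing R] {α β τ : Type*} [Finite α] [Finite β]

omit [Finite β] in
theorem coeff_subst_X_inl [DecidableEq β] (f : MvPowerSeries α R) (p : α →₀ ℕ) (q : β →₀ ℕ) :
    coeff (Finsupp.sumElim p q) (subst (fun i => (X (Sum.inl i) : MvPowerSeries (α ⊕ β) R)) f) =
      if q = 0 then coeff p f else 0 := by
  have h : subst (fun i => (X (Sum.inl i) : MvPowerSeries (α ⊕ β) R)) f =
      rename (Function.Embedding.inl : α ↪ α ⊕ β) f := (rename_eq_subst _ f).symm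
  rw [h]
  split_ifs with hq
  · rw [hq, ← Finsupp.embDomain_inl, coeff_embDomain_rename]
  · refine coeff_rename_eq_zero _ _ ?_
    rintro ⟨x, hx⟩
    apply hq
    rw [← Finsupp.embDomain_eq_mapDomain, Finsupp.embDomain_inl] at hx
    ext b
    exact (DFunLike.congr_fun hx (Sum.inr b)).symm

omit [Finite α] in
theorem coeff_subst_X_inr [DecidableEq α] (f : MvPowerSeries β R) (p : α →₀ ℕ) (q : β →₀ ℕ) :
    coeff (Finsupp.sumElim p q) (subst (fun i => (X (Sum.inr i) : MvPowerSeries (α ⊕ β) R)) f) =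
      if p = 0 then coeff q f else 0 := by
  have h : subst (fun i => (X (Sum.inr i) : MvPowerSeries (α ⊕ β) R)) f =
      rename (Function.Embedding.inr : β ↪ α ⊕ β) f := (rename_eq_subst _ f).symm
  rw [h]
  split_ifs with hp
  · rw [hp, ← Finsupp.embDomain_inr, coeff_embDomain_rename]
  · refine coeff_rename_eq_zero _ _ ?_
    rintro ⟨x, hx⟩
    apply hp
    rw [← Finsupp.embDomain_eq_mapDomain, Finsupp.embDomain_inr] at hx
    ext b
    exact (DFunLike.congr_fun hx (Sum.inl b)).symm

theorem coeff_subst_X_mul (f : MvPowerSeries α R) (g : MvPowerSeries β R) (p : α →₀ ℕ)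
    (q : β →₀ ℕ) :
    coeff (Finsupp.sumElim p q) (subst (fun i => (X (Sum.inl i) : MvPowerSeries (α ⊕ β) R)) f *
      subst (fun i => (X (Sum.inr i) : MvPowerSeries (α ⊕ β) R)) g) = coeff p f * coeff q g := by
  classical
  rw [coeff_mul, Finset.sum_eq_single (Finsupp.sumElim p 0, Finsupp.sumElim 0 q)]
  · rw [coeff_subst_X_inl, coeff_subst_X_inr, if_pos rfl, if_pos rfl]
  · rintro ⟨x, y⟩ hxy hne
    obtain ⟨⟨x₁, x₂⟩, rfl⟩ := Finsupp.sumFinsuppEquivProdFinsupp.symm.surjective x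
    obtain ⟨⟨y₁, y₂⟩, rfl⟩ := Finsupp.sumFinsuppEquivProdFinsupp.symm.surjective y
    change coeff (Finsupp.sumElim x₁ x₂) _ * coeff (Finsupp.sumElim y₁ y₂) _ = 0
    rw [coeff_subst_X_inl, coeff_subst_X_inr]
    split_ifs with h1 h2
    · exfalso
      apply hne
      have := Finset.HasAntidiagonal.mem_antidiagonal.1 hxy
      change Finsupp.sumElim x₁ x₂ + Finsupp.sumElim y₁ y₂ = _ at this
      rw [← Finsupp.sumElim_add, h1, h2, _root_.zero_add, _root_.add_zero] at this
      have h3 := Finsupp.sumFinsuppEquivProdFinsupp.symm.injective (a₁ := (x₁, y₂))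
        (a₂ := (p, q)) this
      rw [Prod.mk.injEq] at h3
      change (Finsupp.sumElim x₁ x₂, Finsupp.sumElim y₁ y₂) = _
      rw [h1, h2, h3.1, h3.2]
    all_goals simp
  · intro h
    exfalso
    apply h
    rw [Finset.HasAntidiagonal.mem_antidiagonal, ← Finsupp.sumElim_add, _root_.zero_add,
      _root_.add_zero]

/-- The exponents in the variables `τ ≃ α ⊕ β`. -/
noncomputable def sumExponents (e : α ⊕ β ≃ τ) : (α →₀ ℕ) × (β →₀ ℕ) ≃ (τ →₀ ℕ) :=
  Finsupp.sumFinsuppEquivProdFinsupp.symm.trans (Finsupp.equivCongrLeft e)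

omit [Finite α] [Finite β] in
theorem sumExponents_apply (e : α ⊕ β ≃ τ) (p : (α →₀ ℕ) × (β →₀ ℕ)) (i : τ) :
    sumExponents e p i = Sum.elim p.1 p.2 (e.symm i) := rfl

/-- The free choice of `e` serves three sets of variables, which must be split both as (X, Y), Z and
as X, (Y, Z). -/
theorem coeff_subst_X_mul_equiv (e : α ⊕ β ≃ τ) (f : MvPowerSeries α R) (g : MvPowerSeries β R)
    (p : (α →₀ ℕ) × (β →₀ ℕ)) :
    coeff (sumExponents e p) (subst (fun i => (X (e (Sum.inl i)) : MvPowerSeries τ R)) f *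
      subst (fun i => (X (e (Sum.inr i)) : MvPowerSeries τ R)) g) =
      coeff p.1 f * coeff p.2 g := by
  classical
  have _ : Finite τ := Finite.of_equiv _ e
  let a : α ⊕ β → MvPowerSeries τ R := X ∘ e.toEmbedding
  have ha : ∀ i, constantCoeff (a i) = 0 := fun i => constantCoeff_X _
  have hs : HasSubst a := hasSubst_of_constantCoeff_zero ha
  have hf : subst (fun i => (X (e (Sum.inl i)) : MvPowerSeries τ R)) f =
      subst a (subst (fun i => (X (Sum.inl i) : MvPowerSeries (α ⊕ β) R)) f) :=
    (subst_subst_congr (fun i => constantCoeff_X _) ha (fun i => subst_X hs _) f).symm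
  have hg : subst (fun i => (X (e (Sum.inr i)) : MvPowerSeries τ R)) g =
      subst a (subst (fun i => (X (Sum.inr i) : MvPowerSeries (α ⊕ β) R)) g) :=
    (subst_subst_congr (fun i => constantCoeff_X _) ha (fun i => subst_X hs _) g).symm
  rw [hf, hg, ← subst_mul hs, ← rename_eq_subst]
  have h : sumExponents e p = Finsupp.embDomain e.toEmbedding (Finsupp.sumElim p.1 p.2) := by
    rw [Finsupp.embDomain_eq_mapDomain]
    exact Finsupp.equivMapDomain_eq_mapDomain e _
  rw [h, coeff_embDomain_rename, coeff_subst_X_mul]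

omit [Finite α] [Finite β] in
theorem degree_sumExponents [Fintype α] [Fintype β] [Fintype τ] (e : α ⊕ β ≃ τ)
    (p : (α →₀ ℕ) × (β →₀ ℕ)) :
    (sumExponents e p).degree = p.1.degree + p.2.degree := by
  simp only [Finsupp.degree_eq_sum, sumExponents_apply]
  rw [e.symm.sum_comp (fun i => Sum.elim p.1 p.2 i), Fintype.sum_sum_type]
  rfl

omit [Finite α] [Finite β] in
theorem multiFactorial_sumExponents [Fintype α] [Fintype β] [Fintype τ] (e : α ⊕ β ≃ τ)
    (p : (α →₀ ℕ) × (β →₀ ℕ)) :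
    multiFactorial (sumExponents e p) = multiFactorial p.1 * multiFactorial p.2 := by
  simp only [multiFactorial, sumExponents_apply]
  rw [e.symm.prod_comp (fun i => (Sum.elim p.1 p.2 i).factorial), Fintype.prod_sum_type]
  rfl

end TensorCoefficients

/-! ### Modified power series in coordinates -/

section ModifiedCoordinates

variable {R K : Type*} [CommRing R] [IsDomain R] [CharZero R] [Field K] [Algebra R K]
  [IsFractionRing R K] {σ : Type*} [Fintype σ]

theorem multiFactorial_ne_zero (K : Type*) [Field K] [CharZero K] (j : σ →₀ ℕ) :
    (multiFactorial j : K) ≠ 0 :=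
  Nat.cast_ne_zero.2 (Finset.prod_ne_zero_iff.2 fun _ _ => Nat.factorial_ne_zero _)

/-- The coordinates `j! b_j` of a modified power series `∑ b_j t^j`. -/
noncomputable def modifiedCoordinates (R K σ : Type*) [CommRing R] [IsDomain R] [CharZero R]
    [Field K] [Algebra R K] [IsFractionRing R K] [Fintype σ] :
    modifiedSeries R K σ ≃ₗ[R] ((σ →₀ ℕ) → R) where
  -- The preimage in `R` is unique because `R → K` is injective, so linearity can be checked in `K`.
  toFun f j := (f.2 j).choose
  map_add' f g := by
    funext j
    apply IsFractionRing.injective R K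
    rw [Pi.add_apply, map_add, (f.2 j).choose_spec, (g.2 j).choose_spec,
      ((f + g).2 j).choose_spec]
    change _ * coeff j (f.1 + g.1) = _
    rw [map_add, mul_add]
  map_smul' r f := by
    funext j
    apply IsFractionRing.injective R K
    rw [Pi.smul_apply, smul_eq_mul, map_mul, (f.2 j).choose_spec, ((r • f).2 j).choose_spec]
    change _ * (r • coeff j f.1) = _
    rw [Algebra.smul_def]
    exact mul_left_comm _ _ _
  invFun x := ⟨fun j => algebraMap R K (x j) / multiFactorial j, fun j => ⟨x j, by
    have _ : CharZero K := charZero_of_injective_algebraMap (IsFractionRing.injective R K)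
    exact (mul_div_cancel₀ _ (multiFactorial_ne_zero K j)).symm⟩⟩
  left_inv f := by
    have _ : CharZero K := charZero_of_injective_algebraMap (IsFractionRing.injective R K)
    refine Subtype.ext (MvPowerSeries.ext fun j => ?_)
    change algebraMap R K (f.2 j).choose / _ = _
    rw [(f.2 j).choose_spec, mul_div_cancel_left₀ _ (multiFactorial_ne_zero K j)]
  right_inv x := by
    have _ : CharZero K := charZero_of_injective_algebraMap (IsFractionRing.injective R K)
    funext j
    apply IsFractionRing.injective R K
    refine Eq.trans (Exists.choose_spec (p := fun r => algebraMap R K r =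
      (multiFactorial j : K) * (algebraMap R K (x j) / multiFactorial j)) _) ?_
    exact mul_div_cancel₀ _ (multiFactorial_ne_zero K j)

theorem algebraMap_modifiedCoordinates (f : modifiedSeries R K σ) (j : σ →₀ ℕ) :
    algebraMap R K (modifiedCoordinates R K σ f j) = multiFactorial j * coeff j f.1 :=
  (f.2 j).choose_spec

theorem modifiedCoordinates_eq_zero_iff (f : modifiedSeries R K σ) (j : σ →₀ ℕ) :
    modifiedCoordinates R K σ f j = 0 ↔ coeff j f.1 = 0 := by
  have _ : CharZero K := charZero_of_injective_algebraMap (IsFractionRing.injective R K)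
  rw [← map_eq_zero_iff _ (IsFractionRing.injective R K), algebraMap_modifiedCoordinates,
    mul_eq_zero, or_iff_right (multiFactorial_ne_zero K j)]

theorem isCoordinates_modified : IsCoordinates (modifiedCoordinates R K σ) Finsupp.degree
    (modifiedFil R K σ) where
  finite := Finsupp.finite_of_degree_lt
  mem_iff _ f := forall₂_congr fun j _ => (modifiedCoordinates_eq_zero_iff f j).symm

variable {α β τ : Type*} [Fintype α] [Fintype β] [Fintype τ]

theorem isCoordinates_modified_sum (e : α ⊕ β ≃ τ) :
    IsCoordinates ((modifiedCoordinates R K τ).trans (LinearEquiv.funCongrLeft R R (sumExponents e)))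
      (fun p => p.1.degree + p.2.degree) (modifiedFil R K τ) where
  finite n := by
    refine ((Finsupp.finite_of_degree_lt (σ := τ) n).preimage
      (sumExponents e).injective.injOn).subset fun p hp => ?_
    change (sumExponents e p).degree < n
    rwa [degree_sumExponents]
  mem_iff n f := by
    rw [isCoordinates_modified.mem_iff, ← (sumExponents e).forall_congr_right]
    simp only [degree_sumExponents]
    rfl

/-- The factorial of an exponent in the joint variables is the product of the two factorials, so the
coordinates of f(X) g(Y) are the products of the coordinates. -/
theorem isCompletedTensor_modified (e : α ⊕ β ≃ τ) :
    IsCompletedTensor (modifiedFil R K α) (modifiedFil R K β) (modifiedFil R K τ)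
      ((LinearMap.mul R (modifiedSeries R K τ)).compl₁₂
        (modifiedSubst R K (fun i => X (e (Sum.inl i))) fun _ => constantCoeff_X _)
        (modifiedSubst R K (fun i => X (e (Sum.inr i))) fun _ => constantCoeff_X _)) := by
  refine isCoordinates_modified.isCompletedTensor isCoordinates_modified
    (isCoordinates_modified_sum e) fun f g p q => ?_
  apply IsFractionRing.injective R K
  change algebraMap R K (modifiedCoordinates R K τ _ (sumExponents e (p, q))) = _
  rw [map_mul, algebraMap_modifiedCoordinates, algebraMap_modifiedCoordinates,
    algebraMap_modifiedCoordinates, multiFactorial_sumExponents]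
  have := coeff_subst_X_mul_equiv e f.1 g.1 (p, q)
  simp only [LinearMap.compl₁₂_apply, LinearMap.mul_apply', modifiedSubst, LinearMap.coe_mk,
    AddHom.coe_mk, map_X, Subalgebra.coe_mul] at this ⊢
  rw [this]
  push_cast
  ring

end ModifiedCoordinates

/-! ### Substitution in modified power series -/

section ModifiedSubst

variable {R : Type*} (K : Type*) [CommRing R] [Field K] [Algebra R K]
  {σ τ υ : Type*} [Fintype σ] [Fintype τ] [Fintype υ]

omit [Fintype σ] [Fintype τ] in
theorem constantCoeff_map_eq_zero {a : σ → MvPowerSeries τ R} (ha : ∀ i, constantCoeff (a i) = 0)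
    (i : σ) : constantCoeff (map (algebraMap R K) (a i)) = 0 := by
  rw [constantCoeff_map, ha, map_zero]

/-- Reduces identities of substitution operators on modified series to identities of families over
`R`; the Hopf axioms for functions are deduced in this way from the laws of G. -/
theorem modifiedSubst_modifiedSubst {a : σ → MvPowerSeries τ R} {b : τ → MvPowerSeries υ R}
    {c : σ → MvPowerSeries υ R} (ha : ∀ i, constantCoeff (a i) = 0)
    (hb : ∀ i, constantCoeff (b i) = 0) (hc : ∀ i, constantCoeff (c i) = 0)
    (h : ∀ i, subst b (a i) = c i) (f : modifiedSeries R K σ) :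
    modifiedSubst R K b hb (modifiedSubst R K a ha f) = modifiedSubst R K c hc f :=
  Subtype.ext (subst_subst_congr (constantCoeff_map_eq_zero K ha) (constantCoeff_map_eq_zero K hb)
    (fun i => by rw [← h, map_subst (hasSubst_of_constantCoeff_zero hb)]) f.1)

theorem modifiedSubst_mul {a : σ → MvPowerSeries τ R} (ha : ∀ i, constantCoeff (a i) = 0)
    (f g : modifiedSeries R K σ) :
    modifiedSubst R K a ha (f * g) = modifiedSubst R K a ha f * modifiedSubst R K a ha g :=
  Subtype.ext (subst_mul (hasSubst_of_constantCoeff_zero (constantCoeff_map_eq_zero K ha)) _ _)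

theorem coe_algebraMap_modifiedSeries (r : R) :
    ((algebraMap R (modifiedSeries R K σ) r : modifiedSeries R K σ) : MvPowerSeries σ K) =
      C (algebraMap R K r) := by
  rw [Subalgebra.coe_algebraMap, MvPowerSeries.algebraMap_apply]

theorem modifiedSubst_algebraMap {a : σ → MvPowerSeries τ R} (ha : ∀ i, constantCoeff (a i) = 0)
    (r : R) : modifiedSubst R K a ha (algebraMap R _ r) = algebraMap R _ r :=
  Subtype.ext (by
    rw [coe_algebraMap_modifiedSeries]
    change subst _ (algebraMap R (modifiedSeries R K σ) r : MvPowerSeries σ K) = _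
    rw [coe_algebraMap_modifiedSeries, subst_C])

theorem modifiedSubst_one {a : σ → MvPowerSeries τ R} (ha : ∀ i, constantCoeff (a i) = 0) :
    modifiedSubst R K a ha 1 = 1 := by
  rw [← map_one (algebraMap R _), modifiedSubst_algebraMap, map_one]

theorem modifiedSubst_eq_self {a : σ → MvPowerSeries σ R} (ha : ∀ i, constantCoeff (a i) = 0)
    (h : ∀ i, a i = X i) (f : modifiedSeries R K σ) : modifiedSubst R K a ha f = f :=
  Subtype.ext (subst_eq_self (fun i => by rw [h, map_X]) f.1)

theorem modifiedSubst_mem {a : σ → MvPowerSeries τ R} (ha : ∀ i, constantCoeff (a i) = 0) {n : ℕ}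
    {f : modifiedSeries R K σ} (hf : f ∈ modifiedFil R K σ n) :
    modifiedSubst R K a ha f ∈ modifiedFil R K τ n :=
  natCast_le_order_iff.1 (le_order_subst_of_le (constantCoeff_map_eq_zero K ha)
    (natCast_le_order_iff.2 hf))

theorem isFilCont_modifiedSubst {a : σ → MvPowerSeries τ R} (ha : ∀ i, constantCoeff (a i) = 0) :
    IsFilCont (modifiedFil R K σ) (modifiedFil R K τ) (modifiedSubst R K a ha) :=
  fun n => ⟨n, fun _ => modifiedSubst_mem K ha⟩

theorem modifiedFil_mul_mem {n : ℕ} {f : modifiedSeries R K σ} (hf : f ∈ modifiedFil R K σ n)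
    (g : modifiedSeries R K σ) : f * g ∈ modifiedFil R K σ n :=
  natCast_le_order_iff.1 (le_order_mul_of_le (a := n) (b := 0) le_rfl
    (natCast_le_order_iff.2 hf) (by simp))

variable [IsDomain R] [IsFractionRing R K]

theorem modifiedEval_eq_iff (f : modifiedSeries R K σ) (r : R) :
    modifiedEval R K σ f = r ↔ constantCoeff f.1 = algebraMap R K r := by
  rw [← (IsFractionRing.injective R K).eq_iff, algebraMap_modifiedEval]

theorem modifiedSubst_zero {a : σ → MvPowerSeries τ R} (ha : ∀ i, constantCoeff (a i) = 0)
    (h : ∀ i, a i = 0) (f : modifiedSeries R K σ) :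
    modifiedSubst R K a ha f = algebraMap R _ (modifiedEval R K σ f) := by
  refine Subtype.ext ((subst_zero_family (fun i => by rw [h, map_zero]) f.1).trans ?_)
  rw [← algebraMap_modifiedEval (R := R), coe_algebraMap_modifiedSeries]

theorem modifiedEval_modifiedSubst {a : σ → MvPowerSeries τ R}
    (ha : ∀ i, constantCoeff (a i) = 0) (f : modifiedSeries R K σ) :
    modifiedEval R K τ (modifiedSubst R K a ha f) = modifiedEval R K σ f := by
  rw [modifiedEval_eq_iff, algebraMap_modifiedEval]
  exact constantCoeff_subst_of_zero (constantCoeff_map_eq_zero K ha) f.1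

theorem modifiedEval_mul (f g : modifiedSeries R K σ) :
    modifiedEval R K σ (f * g) = modifiedEval R K σ f * modifiedEval R K σ g := by
  rw [modifiedEval_eq_iff, map_mul, algebraMap_modifiedEval, algebraMap_modifiedEval]
  exact map_mul _ _ _

theorem modifiedEval_algebraMap (r : R) :
    modifiedEval R K σ (algebraMap R _ r) = r := by
  rw [modifiedEval_eq_iff, coe_algebraMap_modifiedSeries, constantCoeff_C]

end ModifiedSubst

/-! ### The complete Hopf algebra of modified functions -/

namespace FormalGroupLaw

variable {R : Type*} [CommRing R] {m : ℕ} {G : FormalGroupLaw R m}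

section

variable [IsDomain R] [CharZero R] {s : Fin m → MvPowerSeries (Fin m) R} (hs : G.IsInverse s)
include hs

/-- A right inverse of a right inverse is the element itself: evaluate the sum of X, s and s∘s with
both bracketings. -/
theorem IsInverse.subst_inverse (i : Fin m) : subst s (s i) = X i := by
  have h0 := hs.constantCoeff_eq_zero
  have hX : ∀ i : Fin m, constantCoeff (X i : MvPowerSeries (Fin m) R) = 0 :=
    fun i => constantCoeff_X i
  have hss : ∀ i, constantCoeff (subst s (s i)) = 0 := fun i => by
    rw [constantCoeff_subst_of_zero h0, h0]
  have h1 : G.add X s = 0 := funext hs.subst_eq_zero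
  have h2 : G.add s (fun i => subst s (s i)) = 0 := by
    funext j
    have h3 := congrArg (subst s) (congrFun h1 j)
    rw [G.subst_add_apply hX h0 h0] at h3
    refine Eq.trans ?_ (h3.trans (subst_zero_apply (hasSubst_of_constantCoeff_zero h0)))
    congr 1
    exact funext fun i => (subst_X (hasSubst_of_constantCoeff_zero h0) i).symm
  have key := G.add_assoc hX h0 hss
  rw [h1, h2, G.zero_add hss, G.add_zero hX] at key
  exact congrFun key i

theorem IsInverse.inverse_add (j : Fin m) : subst (Sum.elim s fun i => X i) (G.toSeries j) = 0 := by
  have h0 := hs.constantCoeff_eq_zero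
  have h3 := congrArg (subst s) (hs.subst_eq_zero j)
  rw [subst_zero_apply (hasSubst_of_constantCoeff_zero h0), subst_subst_congr
    (constantCoeff_elim (fun i => constantCoeff_X i) h0) h0 (c := Sum.elim s fun i => X i)] at h3
  · exact h3
  · rintro (i | i)
    · exact subst_X (hasSubst_of_constantCoeff_zero h0) i
    · exact hs.subst_inverse i

variable (K : Type*) [Field K] [Algebra R K] [IsFractionRing R K]

omit [CharZero R] in
/-- Functoriality of the tensor product of modified power series. -/
theorem modifiedSubst_elim_tmul {τ : Type*} [Fintype τ] {a b : Fin m → MvPowerSeries τ R}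
    (ha : ∀ i, constantCoeff (a i) = 0) (hb : ∀ i, constantCoeff (b i) = 0)
    (f g : modifiedSeries R K (Fin m)) :
    modifiedSubst R K (Sum.elim a b) (constantCoeff_elim ha hb)
      ((G.functionsHopf K hs).tmul f g) = modifiedSubst R K a ha f * modifiedSubst R K b hb g := by
  have hsab := hasSubst_of_constantCoeff_zero (constantCoeff_elim ha hb)
  change modifiedSubst R K _ _ (modifiedSubst R K _ _ f * modifiedSubst R K _ _ g) = _
  rw [modifiedSubst_mul K, modifiedSubst_modifiedSubst K (c := a) (hc := ha),
    modifiedSubst_modifiedSubst K (c := b) (hc := hb)]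
  all_goals exact fun i => subst_X hsab _

omit [CharZero R] in
theorem functionsHopf_mul_tmul (f g : modifiedSeries R K (Fin m)) :
    (G.functionsHopf K hs).mul ((G.functionsHopf K hs).tmul f g) = f * g := by
  refine (modifiedSubst_elim_tmul hs K (fun i => constantCoeff_X i) (fun i => constantCoeff_X i)
    f g).trans ?_
  rw [modifiedSubst_eq_self K _ fun _ => rfl, modifiedSubst_eq_self K _ fun _ => rfl]

omit [CharZero R] in
theorem functionsHopf_unit (r : R) : (G.functionsHopf K hs).unit r = algebraMap R _ r := rfl

/-- The continuous linear extensions required are substitutions: G applied to one pair of arguments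
for `coassoc`, one set of variables equal to 0 for the counit axioms, s in one set for the antipode
axioms. The axioms then express associativity, neutrality of 0 and the two inverse laws. -/
theorem isCompleteHopfAlgebra_functionsHopf : (G.functionsHopf K hs).IsCompleteHopfAlgebra where
  complete := isCoordinates_modified.isCompleteFiltration
  isTensor := isCompletedTensor_modified (Equiv.refl _)
  isTensorLeft := isCompletedTensor_modified (Equiv.refl _)
  isTensorRight := by
    have h := isCompletedTensor_modified (R := R) (K := K)
      (Equiv.sumAssoc (Fin m) (Fin m) (Fin m)).symm
    -- Splitting the three sets as X, (Y, Z) gives the family of variables used in `tmulRight`.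
    have e : (fun i : Fin m ⊕ Fin m => (X ((Equiv.sumAssoc (Fin m) (Fin m) (Fin m)).symm
        (Sum.inr i)) : MvPowerSeries ((Fin m ⊕ Fin m) ⊕ Fin m) R)) =
        Sum.elim (fun i => X (Sum.inl (Sum.inr i))) (fun i => X (Sum.inr i)) := by
      funext i
      rcases i with i | i <;> rfl
    simp only [e] at h
    exact h
  tmul_assoc x y z := by
    let x₁ := modifiedSubst R K (fun i => (X (Sum.inl (Sum.inl i)) :
      MvPowerSeries ((Fin m ⊕ Fin m) ⊕ Fin m) R)) (fun _ => constantCoeff_X _) x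
    let x₂ := modifiedSubst R K (fun i => (X (Sum.inl (Sum.inr i)) :
      MvPowerSeries ((Fin m ⊕ Fin m) ⊕ Fin m) R)) (fun _ => constantCoeff_X _) y
    let x₃ := modifiedSubst R K (fun i => (X (Sum.inr i) :
      MvPowerSeries ((Fin m ⊕ Fin m) ⊕ Fin m) R)) (fun _ => constantCoeff_X _) z
    refine Eq.trans (b := x₁ * x₂ * x₃) (congrArg (· * x₃) ?_)
      ((mul_assoc _ _ _).trans (congrArg (x₁ * ·) ?_))
    · change modifiedSubst R K _ _ (modifiedSubst R K _ _ x * modifiedSubst R K _ _ y) = _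
      rw [modifiedSubst_mul K, modifiedSubst_modifiedSubst K (hc := fun _ => constantCoeff_X _),
        modifiedSubst_modifiedSubst K (hc := fun _ => constantCoeff_X _)]
      all_goals exact fun i => subst_X (hasSubst_of_constantCoeff_zero fun _ => constantCoeff_X _) _
    · exact (modifiedSubst_elim_tmul hs K (fun _ => constantCoeff_X _) (fun _ => constantCoeff_X _)
        y z).symm
  mul_cont := isFilCont_modifiedSubst K
    (constantCoeff_elim (fun i => constantCoeff_X i) (fun i => constantCoeff_X i))
  comul_cont := isFilCont_modifiedSubst K G.constantCoeff_toSeries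
  counit_cont := ⟨1, fun f hf => (modifiedEval_eq_iff K f 0).2 (by
    rw [map_zero, ← coeff_zero_eq_constantCoeff_apply]
    exact hf 0 (by simp))⟩
  antipode_cont := isFilCont_modifiedSubst K hs.constantCoeff_eq_zero
  mul_assoc x y z := by
    simp only [functionsHopf_mul_tmul]
    exact mul_assoc _ _ _
  one_mul x := by
    rw [functionsHopf_mul_tmul, functionsHopf_unit, map_one, one_mul]
  mul_one x := by
    rw [functionsHopf_mul_tmul, functionsHopf_unit, map_one, mul_one]
  coassoc := by
    have h₁ : ∀ i, constantCoeff (subst (fun v => (X (Sum.inl v) :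
        MvPowerSeries ((Fin m ⊕ Fin m) ⊕ Fin m) R)) (G.toSeries i)) = 0 := fun i => by
      rw [constantCoeff_subst_of_zero fun _ => constantCoeff_X _, constantCoeff_toSeries]
    have h₂' : ∀ v : Fin m ⊕ Fin m, constantCoeff (Sum.elim (fun v => X (Sum.inl (Sum.inr v)))
        (fun v => X (Sum.inr v)) v : MvPowerSeries ((Fin m ⊕ Fin m) ⊕ Fin m) R) = 0 :=
      constantCoeff_elim (fun _ => constantCoeff_X _) (fun _ => constantCoeff_X _)
    have h₂ : ∀ i, constantCoeff (subst (Sum.elim (fun v => X (Sum.inl (Sum.inr v)))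
        (fun v => X (Sum.inr v)) : Fin m ⊕ Fin m → MvPowerSeries ((Fin m ⊕ Fin m) ⊕ Fin m) R)
        (G.toSeries i)) = 0 := fun i => by
      rw [constantCoeff_subst_of_zero h₂', constantCoeff_toSeries]
    refine ⟨modifiedSubst R K _ (constantCoeff_elim h₁ fun i => constantCoeff_X (Sum.inr i)),
      modifiedSubst R K _ (constantCoeff_elim (fun i => constantCoeff_X (Sum.inl (Sum.inl i))) h₂),
      isFilCont_modifiedSubst K _, isFilCont_modifiedSubst K _, fun x y => ?_, fun x y => ?_,
      fun x => ?_⟩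
    · refine (modifiedSubst_elim_tmul hs K h₁ (fun _ => constantCoeff_X _) x y).trans
        (congrArg (· * _) ?_)
      exact (modifiedSubst_modifiedSubst K G.constantCoeff_toSeries (fun _ => constantCoeff_X _) h₁
        (fun _ => rfl) x).symm
    · refine (modifiedSubst_elim_tmul hs K (fun _ => constantCoeff_X _) h₂ x y).trans
        (congrArg (_ * ·) ?_)
      exact (modifiedSubst_modifiedSubst K G.constantCoeff_toSeries h₂' h₂ (fun _ => rfl) y).symm
    · have h₃ := constantCoeff_elim h₁ fun i => constantCoeff_X (R := R) (Sum.inr i)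
      have h₄ : ∀ i, constantCoeff (subst (Sum.elim (fun i => subst (fun v => (X (Sum.inl v) :
          MvPowerSeries ((Fin m ⊕ Fin m) ⊕ Fin m) R)) (G.toSeries i)) fun i => X (Sum.inr i))
          (G.toSeries i)) = 0 := fun i => by
        rw [constantCoeff_subst_of_zero h₃, constantCoeff_toSeries]
      refine (modifiedSubst_modifiedSubst K G.constantCoeff_toSeries _ h₄ (fun _ => rfl) x).trans
        (modifiedSubst_modifiedSubst K G.constantCoeff_toSeries _ h₄ (fun i => ?_) x).symm
      exact (G.assoc i).symm
  counit_comul := by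
    refine ⟨modifiedSubst R K _ constantCoeff_atLeftZero, isFilCont_modifiedSubst K _,
      fun x y => ?_, fun x => ?_⟩
    · refine (modifiedSubst_elim_tmul hs K constantCoeff_zero_family (fun i => constantCoeff_X i)
        x y).trans ?_
      rw [modifiedSubst_zero K constantCoeff_zero_family fun _ => rfl,
        modifiedSubst_eq_self K _ fun _ => rfl,
        Algebra.smul_def]
      rfl
    · refine (modifiedSubst_modifiedSubst K G.constantCoeff_toSeries _ (fun i => constantCoeff_X i)
        (congrFun G.zero_add_X) x).trans (modifiedSubst_eq_self K _ (fun _ => rfl) x)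
  comul_counit := by
    refine ⟨modifiedSubst R K _ constantCoeff_atRightZero, isFilCont_modifiedSubst K _,
      fun x y => ?_, fun x => ?_⟩
    · refine (modifiedSubst_elim_tmul hs K (fun i => constantCoeff_X i) constantCoeff_zero_family
        x y).trans ?_
      rw [modifiedSubst_zero K constantCoeff_zero_family fun _ => rfl,
        modifiedSubst_eq_self K _ fun _ => rfl,
        Algebra.smul_def, mul_comm]
      rfl
    · refine (modifiedSubst_modifiedSubst K G.constantCoeff_toSeries _ (fun i => constantCoeff_X i)
        (congrFun G.add_zero_X) x).trans (modifiedSubst_eq_self K _ (fun _ => rfl) x)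
  counit_one := modifiedEval_algebraMap K 1
  counit_mul x y := by
    rw [functionsHopf_mul_tmul]
    exact modifiedEval_mul K x y
  comul_one := by
    rw [functionsHopf_unit, map_one]
    refine (modifiedSubst_one K G.constantCoeff_toSeries).trans (Eq.symm ?_)
    exact (congrArg₂ (· * ·) (modifiedSubst_one K fun i => constantCoeff_X (Sum.inl i))
      (modifiedSubst_one K fun i => constantCoeff_X (Sum.inr i))).trans (_root_.mul_one 1)
  comul_mul := by
    refine ⟨LinearMap.mul R _, fun n => ⟨n, fun a ha b => ⟨modifiedFil_mul_mem K ha b, ?_⟩⟩,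
      fun x y x' y' => ?_, fun x y => ?_⟩
    · rw [LinearMap.mul_apply', mul_comm]
      exact modifiedFil_mul_mem K ha b
    · simp only [functionsHopf_mul_tmul, LinearMap.mul_apply']
      change (modifiedSubst R K _ _ x * modifiedSubst R K _ _ y) *
        (modifiedSubst R K _ _ x' * modifiedSubst R K _ _ y') =
        modifiedSubst R K _ _ (x * x') * modifiedSubst R K _ _ (y * y')
      rw [modifiedSubst_mul K, modifiedSubst_mul K]
      exact mul_mul_mul_comm _ _ _ _
    · rw [functionsHopf_mul_tmul]
      exact modifiedSubst_mul K G.constantCoeff_toSeries x y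
  antipode_left := by
    have h₁ : ∀ i, constantCoeff (subst (fun v => (X (Sum.inl v) :
        MvPowerSeries (Fin m ⊕ Fin m) R)) (s i)) = 0 := fun i => by
      rw [constantCoeff_subst_of_zero fun _ => constantCoeff_X _, hs.constantCoeff_eq_zero]
    refine ⟨modifiedSubst R K _ (constantCoeff_elim h₁ fun i => constantCoeff_X (Sum.inr i)),
      isFilCont_modifiedSubst K _, fun x y => ?_, fun x => ?_⟩
    · refine (modifiedSubst_elim_tmul hs K h₁ (fun _ => constantCoeff_X _) x y).trans
        (congrArg (· * _) ?_)
      exact (modifiedSubst_modifiedSubst K hs.constantCoeff_eq_zero (fun _ => constantCoeff_X _) h₁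
        (fun _ => rfl) x).symm
    · have hδ : ∀ i, constantCoeff (Sum.elim (fun i => X i) (fun i => X i) i :
          MvPowerSeries (Fin m) R) = 0 :=
        constantCoeff_elim (fun i => constantCoeff_X i) (fun i => constantCoeff_X i)
      have hsδ := hasSubst_of_constantCoeff_zero hδ
      have h₂ : ∀ i, constantCoeff (Sum.elim s (fun i => X i) i : MvPowerSeries (Fin m) R) = 0 :=
        constantCoeff_elim hs.constantCoeff_eq_zero fun i => constantCoeff_X i
      refine (modifiedSubst_modifiedSubst K _ hδ h₂ ?_ _).trans ?_
      · rintro (i | i)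
        · refine (subst_subst_congr (fun _ => constantCoeff_X _) hδ
            (fun i => subst_X hsδ _) (s i)).trans
            (subst_eq_self (fun _ => rfl) (s i))
        · refine subst_X hsδ _
      · exact (modifiedSubst_modifiedSubst K G.constantCoeff_toSeries h₂ constantCoeff_zero_family
          hs.inverse_add x).trans (modifiedSubst_zero K constantCoeff_zero_family (fun _ => rfl) x)
  antipode_right := by
    have h₁ : ∀ i, constantCoeff (subst (fun v => (X (Sum.inr v) :
        MvPowerSeries (Fin m ⊕ Fin m) R)) (s i)) = 0 := fun i => by
      rw [constantCoeff_subst_of_zero fun _ => constantCoeff_X _, hs.constantCoeff_eq_zero]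
    refine ⟨modifiedSubst R K _ (constantCoeff_elim (fun i => constantCoeff_X (Sum.inl i)) h₁),
      isFilCont_modifiedSubst K _, fun x y => ?_, fun x => ?_⟩
    · refine (modifiedSubst_elim_tmul hs K (fun _ => constantCoeff_X _) h₁ x y).trans
        (congrArg (_ * ·) ?_)
      exact (modifiedSubst_modifiedSubst K hs.constantCoeff_eq_zero (fun _ => constantCoeff_X _) h₁
        (fun _ => rfl) y).symm
    · have hδ : ∀ i, constantCoeff (Sum.elim (fun i => X i) (fun i => X i) i :
          MvPowerSeries (Fin m) R) = 0 :=
        constantCoeff_elim (fun i => constantCoeff_X i) (fun i => constantCoeff_X i)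
      have hsδ := hasSubst_of_constantCoeff_zero hδ
      have h₂ : ∀ i, constantCoeff (Sum.elim (fun i => X i) s i : MvPowerSeries (Fin m) R) = 0 :=
        constantCoeff_elim (fun i => constantCoeff_X i) hs.constantCoeff_eq_zero
      refine (modifiedSubst_modifiedSubst K _ hδ h₂ ?_ _).trans ?_
      · rintro (i | i)
        · refine subst_X hsδ _
        · refine (subst_subst_congr (fun _ => constantCoeff_X _) hδ
            (fun i => subst_X hsδ _) (s i)).trans
            (subst_eq_self (fun _ => rfl) (s i))
      · exact (modifiedSubst_modifiedSubst K G.constantCoeff_toSeries h₂ constantCoeff_zero_family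
          hs.subst_eq_zero x).trans (modifiedSubst_zero K constantCoeff_zero_family (fun _ => rfl) x)

end

end FormalGroupLaw

/-! ### Vector fields on modified power series -/

section ModifiedField

variable {R : Type*} (K : Type*) [CommRing R] [Field K] [Algebra R K]
  {σ τ : Type*} [Fintype σ] [Fintype τ]

theorem map_mem_modifiedSeries (f : MvPowerSeries σ R) :
    map (algebraMap R K) f ∈ modifiedSeries R K σ := fun j => by
  rw [coeff_map]
  exact mul_mem (natCast_mem _ _) ⟨_, rfl⟩

variable {K} in
-- Differentiation shifts the coordinates j! b_j, so they stay in `R`.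
theorem pderiv_mem_modifiedSeries {f : MvPowerSeries σ K} (hf : f ∈ modifiedSeries R K σ) (i : σ) :
    pderiv K i f ∈ modifiedSeries R K σ := fun j => by
  have := hf (j + Finsupp.single i 1)
  rw [multiFactorial_add_single] at this
  rw [coeff_pderiv]
  convert! this using 1
  push_cast
  ring

/-- A vector field with coefficients in `R[[t]]`, acting on modified power series. -/
noncomputable def modifiedField (V : σ → MvPowerSeries σ R) :
    modifiedSeries R K σ →ₗ[R] modifiedSeries R K σ where
  toFun f := ⟨vectorField (fun i => map (algebraMap R K) (V i)) f.1, by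
    rw [vectorField_apply]
    exact sum_mem fun i _ => mul_mem (map_mem_modifiedSeries K _)
      (pderiv_mem_modifiedSeries f.2 i)⟩
  map_add' f g := Subtype.ext (map_add _ f.1 g.1)
  map_smul' r f := Subtype.ext ((vectorField _).map_smul_of_tower r f.1)

theorem modifiedField_coe (V : σ → MvPowerSeries σ R) (f : modifiedSeries R K σ) :
    (modifiedField K V f).1 = vectorField (fun i => map (algebraMap R K) (V i)) f.1 := rfl

theorem modifiedField_mul (V : σ → MvPowerSeries σ R) (f g : modifiedSeries R K σ) :
    modifiedField K V (f * g) = modifiedField K V f * g + f * modifiedField K V g :=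
  Subtype.ext (((vectorField _).leibniz f.1 g.1).trans (by
    rw [smul_eq_mul, smul_eq_mul, add_comm, mul_comm g.1]
    rfl))

theorem modifiedField_algebraMap (V : σ → MvPowerSeries σ R) (r : R) :
    modifiedField K V (algebraMap R _ r) = 0 := by
  refine Subtype.ext ?_
  rw [modifiedField_coe, coe_algebraMap_modifiedSeries]
  exact (vectorField _).map_algebraMap (algebraMap R K r)

theorem modifiedField_modifiedSubst {V : τ → MvPowerSeries τ R} {V' : σ → MvPowerSeries σ R}
    {a : σ → MvPowerSeries τ R} (ha : ∀ i, constantCoeff (a i) = 0)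
    (h : ∀ i, vectorField V (a i) = subst a (V' i)) (f : modifiedSeries R K σ) :
    modifiedField K V (modifiedSubst R K a ha f) = modifiedSubst R K a ha (modifiedField K V' f) :=
  Subtype.ext (vectorField_subst_of_related (constantCoeff_map_eq_zero K ha) (fun i => by
    rw [vectorField_map, h, map_subst (hasSubst_of_constantCoeff_zero ha)]) f.1)

/-- A commutation relation between vector fields over `R` holds on modified power series. -/
theorem modifiedField_comm {ι : Type*} [Fintype ι] {V W : σ → MvPowerSeries σ R} {c : ι → R}
    {Z : ι → σ → MvPowerSeries σ R}
    (h : ∀ f, vectorField V (vectorField W f) - vectorField W (vectorField V f) =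
      ∑ k, c k • vectorField (Z k) f) (f : modifiedSeries R K σ) :
    modifiedField K V (modifiedField K W f) - modifiedField K W (modifiedField K V f) =
      ∑ k, c k • modifiedField K (Z k) f := by
  refine Subtype.ext ?_
  rw [AddSubgroupClass.coe_sub, modifiedField_coe, modifiedField_coe, modifiedField_coe,
    modifiedField_coe, vectorField_comm, AddSubmonoidClass.coe_finsetSum]
  -- The hypothesis concerns series over `R`, while `f` has coefficients in `K`. The commutator is a
  -- vector field, so its coefficients suffice, and these are obtained from `h` at the variables.
  have h2 : ∀ i, vectorField (fun i => map (algebraMap R K) (V i)) (map (algebraMap R K) (W i)) -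
      vectorField (fun i => map (algebraMap R K) (W i)) (map (algebraMap R K) (V i)) =
      ∑ k, c k • map (algebraMap R K) (Z k i) := fun i => by
    rw [vectorField_map, vectorField_map, ← map_sub]
    have := h (X i)
    simp only [vectorField_X] at this
    rw [this, map_sum]
    refine Finset.sum_congr rfl fun k _ => ?_
    ext d
    rw [coeff_map]
    change algebraMap R K (c k * coeff d (Z k i)) = c k • coeff d (map (algebraMap R K) (Z k i))
    rw [map_mul, coeff_map, Algebra.smul_def]
  rw [vectorField_apply]
  simp only [h2, Finset.sum_mul]
  rw [Finset.sum_comm]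
  refine Finset.sum_congr rfl fun k _ => ?_
  change _ = c k • vectorField (fun i => map (algebraMap R K) (Z k i)) f.1
  rw [vectorField_apply, Finset.smul_sum]
  exact Finset.sum_congr rfl fun i _ => smul_mul_assoc _ _ _

end ModifiedField

/-! ### Induction in the enveloping algebra -/

section EnvelopingInduction

open UniversalEnvelopingAlgebra

attribute [local instance 100] LieRing.ofAssociativeRing

/-- The universal property lifts ι to a homomorphism into S; its composite with the inclusion is the
identity by uniqueness, so every element lies in S. -/
theorem UniversalEnvelopingAlgebra.subalgebra_eq_top {R L : Type*} [CommRing R] [LieRing L]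
    [LieAlgebra R L] {S : Subalgebra R (UniversalEnvelopingAlgebra R L)}
    (h : ∀ x, ι R x ∈ S) : S = ⊤ := by
  let g : L →ₗ⁅R⁆ S :=
    { toFun := fun x => ⟨ι R x, h x⟩
      map_add' := fun x y => Subtype.ext (map_add _ x y)
      map_smul' := fun r x => Subtype.ext (map_smul _ r x)
      map_lie' := fun {x y} => Subtype.ext (LieHom.map_lie (ι R) x y) }
  have hg : S.val.comp (lift R g) = AlgHom.id R _ := by
    apply hom_ext
    ext x
    change ((lift R g (ι R x) : S) : UniversalEnvelopingAlgebra R L) = ι R x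
    rw [lift_ι_apply]
    rfl
  rw [eq_top_iff]
  intro u _
  have := DFunLike.congr_fun hg u
  rw [AlgHom.id_apply] at this
  rw [← this]
  exact (lift R g u).2

variable {R : Type*} [CommRing R] {m : ℕ} {G : FormalGroupLaw R m}

theorem FormalGroupLaw.eq_sum_e (x : G.LieAlg) :
    x = ∑ j, (x : Fin m → R) j • G.e j := by
  exact pi_eq_sum_univ' (R := R) (x : Fin m → R)

theorem FormalGroupLaw.U_induction {C : G.U → Prop} (one : C 1) (add : ∀ u v, C u → C v → C (u + v))
    (smul : ∀ (r : R) u, C u → C (r • u)) (mul : ∀ j u, C u → C (ι R (G.e j) * u)) (u : G.U) :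
    C u := by
  have zero : C 0 := by simpa using smul 0 1 one
  let S : Submodule R G.U :=
    { carrier := {u | C u}
      add_mem' := fun {a b} ha hb => add a b ha hb
      zero_mem' := zero
      smul_mem' := smul }
  -- The stabiliser of `S` under left multiplication is a subalgebra. It contains the Lie algebra,
  -- hence everything, and is applied to `1 ∈ S`.
  let T : Subalgebra R G.U :=
    { carrier := {x | ∀ u ∈ S, x * u ∈ S}
      mul_mem' := fun {a b} ha hb u hu => by
        rw [mul_assoc]
        exact ha _ (hb u hu)
      add_mem' := fun {a b} ha hb u hu => by
        rw [add_mul]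
        exact S.add_mem (ha u hu) (hb u hu)
      algebraMap_mem' := fun r u hu => by
        rw [← Algebra.smul_def]
        exact S.smul_mem r hu }
  have hT : T = ⊤ := subalgebra_eq_top fun x u hu => by
    rw [FormalGroupLaw.eq_sum_e x, map_sum, Finset.sum_mul]
    refine S.sum_mem fun j _ => ?_
    rw [map_smul, smul_mul_assoc]
    exact S.smul_mem _ (mul j u hu)
  have : u ∈ T := hT ▸ Algebra.mem_top
  have := this 1 one
  rw [mul_one] at this
  exact this

end EnvelopingInduction

/-! ### Right actions of the enveloping algebra by vector fields -/

namespace FormalGroupLaw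

open UniversalEnvelopingAlgebra

attribute [local instance 100] LieRing.ofAssociativeRing

variable {R : Type*} [CommRing R] {m : ℕ} (G : FormalGroupLaw R m) (K : Type*) [Field K]
  [Algebra R K] {σ τ : Type*} [Fintype σ] [Fintype τ]

/-- Families of vector fields which satisfy the commutation relations of the opposite of the Lie
algebra of `G`. -/
def IsRightAction (V : Fin m → σ → MvPowerSeries σ R) : Prop :=
  ∀ l j f, vectorField (V l) (vectorField (V j) f) - vectorField (V j) (vectorField (V l) f) =
    ∑ k, (G.γ k j l - G.γ k l j) • vectorField (V k) f

variable {G}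
variable {V : Fin m → σ → MvPowerSeries σ R} (hV : G.IsRightAction V)

include hV in
theorem IsRightAction.sub_eq (x y : Fin m → R) (f : modifiedSeries R K σ) :
    (∑ j, y j • modifiedField K (V j) (∑ l, x l • modifiedField K (V l) f)) -
      ∑ l, x l • modifiedField K (V l) (∑ j, y j • modifiedField K (V j) f) =
    ∑ k, (∑ l, ∑ j, (G.γ k l j - G.γ k j l) * (x l * y j)) • modifiedField K (V k) f := by
  have h1 : ∀ j l, (y j * x l) • modifiedField K (V j) (modifiedField K (V l) f) -
      (x l * y j) • modifiedField K (V l) (modifiedField K (V j) f) =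
      ∑ k, ((G.γ k l j - G.γ k j l) * (x l * y j)) • modifiedField K (V k) f := by
    intro j l
    rw [mul_comm (y j), ← smul_sub, modifiedField_comm K (hV j l), Finset.smul_sum]
    exact Finset.sum_congr rfl fun k _ => by rw [smul_smul, mul_comm]
  simp only [map_sum, map_smul, Finset.smul_sum, smul_smul, Finset.sum_smul]
  rw [Finset.sum_comm, ← Finset.sum_sub_distrib]
  simp only [← Finset.sum_sub_distrib, h1]
  rw [Finset.sum_comm (γ := Fin m)]
  refine (Finset.sum_congr rfl fun l _ => Finset.sum_comm).trans ?_
  rw [Finset.sum_comm]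
  exact Finset.sum_congr rfl fun k _ => Finset.sum_comm

/-- The Lie algebra homomorphism given by a right action. -/
noncomputable def IsRightAction.lieHom :
    G.LieAlg →ₗ⁅R⁆ (Module.End R (modifiedSeries R K σ))ᵐᵒᵖ where
  toFun := fun x => MulOpposite.op (∑ j, (x : Fin m → R) j • modifiedField K (V j))
  map_add' := fun x y => by
    rw [← MulOpposite.op_add, ← Finset.sum_add_distrib]
    exact congrArg _ (Finset.sum_congr rfl fun j _ => add_smul _ _ _)
  map_smul' := fun r x => by
    rw [RingHom.id_apply, ← MulOpposite.op_smul, Finset.smul_sum]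
    exact congrArg _ (Finset.sum_congr rfl fun j _ => mul_smul _ _ _)
  map_lie' := fun {x y} => by
    rw [LieRing.of_associative_ring_bracket, ← MulOpposite.op_mul, ← MulOpposite.op_mul,
      ← MulOpposite.op_sub]
    refine congrArg _ (LinearMap.ext fun f => ?_)
    have h := hV.sub_eq K x y f
    simp only [LinearMap.sub_apply, Module.End.mul_apply, LinearMap.sum_apply,
      LinearMap.smul_apply]
    exact h.symm

/-- The right action of the universal enveloping algebra on modified power series. -/
noncomputable def IsRightAction.hom : G.U →ₐ[R] (Module.End R (modifiedSeries R K σ))ᵐᵒᵖ :=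
  UniversalEnvelopingAlgebra.lift R (hV.lieHom K)

/-- The operator by which `u` acts. -/
noncomputable def IsRightAction.act (u : G.U) : Module.End R (modifiedSeries R K σ) :=
  (hV.hom K u).unop

namespace IsRightAction

theorem act_one (f : modifiedSeries R K σ) : hV.act K 1 f = f := by
  rw [act, map_one]
  rfl

theorem act_mul (u v : G.U) (f : modifiedSeries R K σ) :
    hV.act K (u * v) f = hV.act K v (hV.act K u f) := by
  rw [act, map_mul]
  rfl

theorem act_add (u v : G.U) (f : modifiedSeries R K σ) :
    hV.act K (u + v) f = hV.act K u f + hV.act K v f := by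
  rw [act, map_add]
  rfl

theorem act_smul (r : R) (u : G.U) (f : modifiedSeries R K σ) :
    hV.act K (r • u) f = r • hV.act K u f := by
  rw [act, map_smul]
  rfl

theorem act_ι (x : G.LieAlg) (f : modifiedSeries R K σ) :
    hV.act K (ι R x) f = ∑ j, (x : Fin m → R) j • modifiedField K (V j) f := by
  rw [act, hom, lift_ι_apply]
  exact LinearMap.sum_apply Finset.univ (fun j => (x : Fin m → R) j • modifiedField K (V j)) f

theorem act_e (j : Fin m) (f : modifiedSeries R K σ) :
    hV.act K (ι R (G.e j)) f = modifiedField K (V j) f := by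
  rw [act_ι, Finset.sum_eq_single j]
  · change (Pi.single j 1 : Fin m → R) j • _ = _
    rw [Pi.single_eq_same, one_smul]
  · intro k _ hk
    change (Pi.single j 1 : Fin m → R) k • _ = _
    rw [Pi.single_eq_of_ne hk, zero_smul]
  · simp

variable {V' : Fin m → τ → MvPowerSeries τ R} (hV' : G.IsRightAction V')

/-- Equivariance need only be checked on the generators e_j; all later comparisons of actions are
reduced to vector fields by this. -/
theorem map_act {T : modifiedSeries R K σ →ₗ[R] modifiedSeries R K τ}
    (h : ∀ j f, T (modifiedField K (V j) f) = modifiedField K (V' j) (T f)) (u : G.U)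
    (f : modifiedSeries R K σ) : T (hV.act K u f) = hV'.act K u (T f) := by
  induction u using U_induction generalizing f with
  | one => rw [act_one, act_one]
  | add u v hu hv => rw [act_add, act_add, map_add, hu, hv]
  | smul r u hu => rw [act_smul, act_smul, map_smul, hu]
  | mul j u hu => rw [act_mul, act_mul, hu, act_e, act_e, h]

/-- Derivations kill constants, so a product of Lie algebra elements acts on constants through the
counit. -/
theorem act_algebraMap (u : G.U) (r : R) :
    hV.act K u (algebraMap R _ r) = algebraMap R _ (r * envelopingCounit R G.LieAlg u) := by
  induction u using U_induction generalizing r with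
  | one => rw [act_one, map_one, mul_one]
  | add u v hu hv => rw [act_add, hu, hv, map_add, mul_add, map_add]
  | smul s u hu =>
    rw [act_smul, hu, map_smul, smul_eq_mul, mul_left_comm, map_mul (algebraMap R _) s,
      Algebra.smul_def]
  | mul j u hu =>
    rw [act_mul, act_e, modifiedField_algebraMap, map_zero, map_mul (envelopingCounit R G.LieAlg),
      envelopingCounit, lift_ι_apply, LieHom.zero_apply, zero_mul, mul_zero, map_zero]

end IsRightAction

end FormalGroupLaw

/-! ### Slices of series in two sets of variables -/

section Slices

variable {K : Type*} [CommRing K] {σ τ : Type*} [Finite σ] [Finite τ]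

theorem coeff_subst_elim_zero_X (F : MvPowerSeries (σ ⊕ τ) K) (q : τ →₀ ℕ) :
    coeff q (subst (Sum.elim 0 X : σ ⊕ τ → MvPowerSeries τ K) F) =
      coeff (Finsupp.sumElim 0 q) F := by
  classical
  have := Fintype.ofFinite σ
  have := Fintype.ofFinite τ
  have hs : HasSubst (Sum.elim 0 X : σ ⊕ τ → MvPowerSeries τ K) :=
    hasSubst_of_constantCoeff_zero (by rintro (i | i) <;> simp)
  have hprod : ∀ p (q' : τ →₀ ℕ), ((Finsupp.sumElim p q').prod
      fun v e => (Sum.elim 0 X : σ ⊕ τ → MvPowerSeries τ K) v ^ e) =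
      (if p = 0 then 1 else 0) * monomial q' 1 := fun p q' => by
    rw [Finsupp.prod_fintype _ _ (fun _ => pow_zero _), Fintype.prod_sum_type]
    congr 1
    · split_ifs with h
      · rw [h]
        exact Finset.prod_eq_one fun i _ => pow_zero _
      · obtain ⟨i, hi⟩ := Finsupp.ne_iff.1 h
        exact Finset.prod_eq_zero (Finset.mem_univ i) (zero_pow hi)
    · rw [monomial_one_eq, Finsupp.prod_fintype _ _ (fun _ => pow_zero _)]
      rfl
  rw [coeff_subst hs, finsum_eq_single _ (Finsupp.sumElim 0 q), hprod, if_pos rfl, one_mul,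
    coeff_monomial_same, smul_eq_mul, mul_one]
  intro d hd
  obtain ⟨⟨p, q'⟩, rfl⟩ := Finsupp.sumFinsuppEquivProdFinsupp.symm.surjective d
  change coeff _ _ • coeff q ((Finsupp.sumElim p q').prod _) = 0
  rw [hprod]
  split_ifs with hp
  · rw [one_mul, coeff_monomial, if_neg, smul_zero]
    rintro rfl
    exact hd (by rw [hp]; rfl)
  · rw [zero_mul, map_zero, smul_zero]

/-- Links the slice along X_j, used to define the convolution, with the derivative at X = 0, used to
define the invariant fields. -/
theorem coeff_sumElim_single (F : MvPowerSeries (σ ⊕ τ) K) (j : σ) (q : τ →₀ ℕ) :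
    coeff (Finsupp.sumElim (Finsupp.single j 1) q) F =
      coeff q (subst (Sum.elim 0 X : σ ⊕ τ → MvPowerSeries τ K) (pderiv K (Sum.inl j) F)) := by
  rw [coeff_subst_elim_zero_X, coeff_pderiv]
  have h : Finsupp.sumElim (0 : σ →₀ ℕ) q + Finsupp.single (Sum.inl j) 1 =
      Finsupp.sumElim (Finsupp.single j 1) q := by
    classical
    ext (i | i) <;> simp [Finsupp.single_apply]
  rw [h]
  simp

end Slices

/-! ### Linear dependence of the operator on the vector field -/

section ModifiedFieldAlgebra

variable {R : Type*} (K : Type*) [CommRing R] [Field K] [Algebra R K] {σ : Type*} [Fintype σ]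

theorem modifiedField_add (V W : σ → MvPowerSeries σ R) (f : modifiedSeries R K σ) :
    modifiedField K (V + W) f = modifiedField K V f + modifiedField K W f :=
  Subtype.ext <| by
    change vectorField _ _ = vectorField _ _ + vectorField _ _
    simp only [vectorField_apply, Pi.add_apply, map_add, add_mul, Finset.sum_add_distrib]

theorem modifiedField_neg (V : σ → MvPowerSeries σ R) (f : modifiedSeries R K σ) :
    modifiedField K (-V) f = -modifiedField K V f :=
  Subtype.ext <| by
    change vectorField _ _ = -vectorField _ _
    simp only [vectorField_apply, Pi.neg_apply, map_neg, neg_mul, Finset.sum_neg_distrib]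

theorem modifiedField_zero (f : modifiedSeries R K σ) :
    modifiedField K (0 : σ → MvPowerSeries σ R) f = 0 :=
  Subtype.ext <| by
    change vectorField _ _ = 0
    simp only [vectorField_apply, Pi.zero_apply, map_zero, zero_mul, Finset.sum_const_zero]

theorem modifiedEval_modifiedField_congr [IsDomain R] [IsFractionRing R K]
    {V W : σ → MvPowerSeries σ R} (h : ∀ i, constantCoeff (V i) = constantCoeff (W i))
    (f : modifiedSeries R K σ) :
    modifiedEval R K σ (modifiedField K V f) = modifiedEval R K σ (modifiedField K W f) := by
  rw [modifiedEval_eq_iff, algebraMap_modifiedEval, modifiedField_coe, modifiedField_coe,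
    vectorField_apply, vectorField_apply, map_sum, map_sum]
  exact Finset.sum_congr rfl fun i _ => by
    rw [map_mul, map_mul, constantCoeff_map, constantCoeff_map, h]

end ModifiedFieldAlgebra

/-! ### The actions of U and U ⊗ U, and the Hopf structure -/

namespace FormalGroupLaw

open UniversalEnvelopingAlgebra

attribute [local instance 100] LieRing.ofAssociativeRing

section HopfStructure

variable {R : Type*} [CommRing R] {m : ℕ} (G : FormalGroupLaw R m)

theorem envelopingComul_e (j : Fin m) :
    envelopingComul R G.LieAlg (ι R (G.e j)) = ι R (G.e j) ⊗ₜ 1 + 1 ⊗ₜ ι R (G.e j) := by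
  rw [envelopingComul, lift_ι_apply]
  rfl

theorem envelopingAntipode_e_mul (j : Fin m) (u : G.U) :
    envelopingAntipode R G.LieAlg (ι R (G.e j) * u) =
      -(envelopingAntipode R G.LieAlg u * ι R (G.e j)) := by
  rw [envelopingAntipode, LinearMap.comp_apply, AlgHom.toLinearMap_apply, map_mul, lift_ι_apply,
    ← mul_neg]
  rfl

theorem envelopingAntipode_one : envelopingAntipode R G.LieAlg 1 = 1 := by
  rw [envelopingAntipode, LinearMap.comp_apply, AlgHom.toLinearMap_apply, map_one]
  rfl

end HopfStructure

variable {R : Type*} [CommRing R] [IsDomain R] [CharZero R] {m : ℕ} (G : FormalGroupLaw R m)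
  (K : Type*) [Field K] [Algebra R K]

theorem isRightAction_rightInv : G.IsRightAction G.rightInv := G.vectorField_rightInv_comm

theorem isRightAction_onLeft : G.IsRightAction fun j => onLeft (G.rightInv j) :=
  G.vectorField_onLeft_rightInv_comm

theorem isRightAction_onRight : G.IsRightAction fun j => onRight (G.rightInv j) :=
  G.vectorField_onRight_rightInv_comm

/-- The action of the enveloping algebra by right invariant vector fields. -/
noncomputable abbrev act (u : G.U) : Module.End R (modifiedSeries R K (Fin m)) :=
  G.isRightAction_rightInv.act K u

/-- The description of V_j as an infinitesimal translation, now for series over `K` while G and its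
fields remain defined over `R`. -/
theorem vectorField_rightInv_coe (j : Fin m) (f : MvPowerSeries (Fin m) K) :
    vectorField (fun i => map (algebraMap R K) (G.rightInv j i)) f =
      subst (Sum.elim 0 X : Fin m ⊕ Fin m → MvPowerSeries (Fin m) K)
        (pderiv K (Sum.inl j) (G.comulK K f)) := by
  have h0 : ∀ i, constantCoeff
      ((Sum.elim 0 X : Fin m ⊕ Fin m → MvPowerSeries (Fin m) K) i) = 0 := by
    rintro (i | i) <;> simp
  have h0' : ∀ i, constantCoeff
      ((Sum.elim 0 X : Fin m ⊕ Fin m → MvPowerSeries (Fin m) R) i) = 0 := by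
    rintro (i | i) <;> simp
  have hG := constantCoeff_map_eq_zero K G.constantCoeff_toSeries
  have hmap : ∀ F : MvPowerSeries (Fin m ⊕ Fin m) R,
      subst (Sum.elim 0 X : Fin m ⊕ Fin m → MvPowerSeries (Fin m) K) (map (algebraMap R K) F) =
        map (algebraMap R K)
          (subst (Sum.elim 0 X : Fin m ⊕ Fin m → MvPowerSeries (Fin m) R) F) := fun F => by
    rw [map_subst (hasSubst_of_constantCoeff_zero h0')]
    congr 1
    funext i
    rcases i with i | i <;> simp
  rw [vectorField_apply, comulK, coe_substAlgHom, pderiv_subst_eq_sum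
    (hasSubst_of_constantCoeff_zero hG), ← coe_substAlgHom (hasSubst_of_constantCoeff_zero h0),
    map_sum]
  refine Finset.sum_congr rfl fun i _ => ?_
  rw [map_mul, coe_substAlgHom, mul_comm]
  congr 1
  · refine (subst_subst_eq_self hG h0 (fun i => ?_) _).symm
    rw [hmap]
    have := G.subst_atLeftZero_toSeries (X i)
    rw [subst_X (hasSubst_of_constantCoeff_zero G.constantCoeff_toSeries)] at this
    rw [this, map_X]
  · rw [rightInv, ← hmap]
    congr 1
    ext d
    simp only [coeff_pderiv, coeff_map, map_mul, map_add, map_natCast, map_one]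

/-- A tangent vector reads only the part of f(G(X, Y)) linear in X, and that part consists of the
V_j f. No continuity of `ψ` is needed. -/
theorem conv_tangent (L : G.LieAlg) (ψ : MvPowerSeries (Fin m) K →ₗ[K] K)
    (f : modifiedSeries R K (Fin m)) :
    G.conv K (G.tangent K L) ψ f.1 = ψ (G.act K (ι R L) f).1 := by
  have h1 : ∀ j, slice K (Finsupp.single j 1) (G.comulK K f.1) =
      (modifiedField K (G.rightInv j) f).1 :=
    fun j => by
      rw [modifiedField_coe, vectorField_rightInv_coe]
      ext q
      exact coeff_sumElim_single _ _ _
  rw [act, IsRightAction.act_ι, AddSubmonoidClass.coe_finsetSum, map_sum, conv, tangent]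
  simp only [LinearMap.comp_apply, LinearMap.sum_apply, LinearMap.smul_apply]
  refine Finset.sum_congr rfl fun j _ => ?_
  change _ • coeff 0 (pderiv K j (applyRight K ψ (G.comulK K f.1))) =
    ψ ((L : Fin m → R) j • (modifiedField K (G.rightInv j) f).1)
  rw [coeff_pderiv, ← h1, ← algebraMap_smul K ((L : Fin m → R) j) (slice K _ _), map_smul,
    _root_.zero_add, Finsupp.zero_apply, Nat.cast_zero, _root_.zero_add, mul_one]
  rfl

theorem wordFunctional_eq (w : List G.LieAlg) (f : modifiedSeries R K (Fin m)) :
    G.wordFunctional K w f.1 = constantCoeff (G.act K (w.map (ι R)).prod f).1 := by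
  induction w generalizing f with
  | nil =>
    rw [List.map_nil, List.prod_nil, act, IsRightAction.act_one]
    rfl
  | cons L w ih =>
    rw [wordFunctional, conv_tangent, ih, List.map_cons, List.prod_cons, act, IsRightAction.act_mul]

/-! ### Two sets of variables -/

theorem act_onLeft_onRight_comm (u v : G.U) (F : modifiedSeries R K (Fin m ⊕ Fin m)) :
    G.isRightAction_onLeft.act K u (G.isRightAction_onRight.act K v F) =
      G.isRightAction_onRight.act K v (G.isRightAction_onLeft.act K u F) := by
  have h : ∀ (v' w : Fin m → MvPowerSeries (Fin m) R) (F : modifiedSeries R K (Fin m ⊕ Fin m)),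
      modifiedField K (onLeft v') (modifiedField K (onRight w) F) =
        modifiedField K (onRight w) (modifiedField K (onLeft v') F) := fun v' w F => by
    -- A vanishing commutator is the case of an empty family on the right-hand side.
    have := modifiedField_comm K (ι := Empty) (V := onLeft v') (W := onRight w) (c := Empty.elim)
      (Z := Empty.elim) (fun f => by
        rw [vectorField_onLeft_onRight_comm, sub_self, Finset.univ_eq_empty, Finset.sum_empty]) F
    rwa [Finset.univ_eq_empty, Finset.sum_empty, sub_eq_zero] at this
  refine (IsRightAction.map_act K G.isRightAction_onRight G.isRightAction_onRight
    (T := G.isRightAction_onLeft.act K u) (fun j f => ?_) v F)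
  exact (IsRightAction.map_act K G.isRightAction_onLeft G.isRightAction_onLeft
    (T := modifiedField K (onRight (G.rightInv j))) (fun i f => (h _ _ f).symm) u f).symm

/-- The right action of `U ⊗ U` on modified power series in two sets of variables. -/
noncomputable def hom₂ :
    G.U ⊗[R] G.U →ₐ[R] (Module.End R (modifiedSeries R K (Fin m ⊕ Fin m)))ᵐᵒᵖ :=
  Algebra.TensorProduct.lift (G.isRightAction_onLeft.hom K) (G.isRightAction_onRight.hom K)
    fun u v => MulOpposite.unop_injective
      (LinearMap.ext fun F => (G.act_onLeft_onRight_comm K u v F).symm)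

/-- The operator by which an element of `U ⊗ U` acts. -/
noncomputable def act₂ (z : G.U ⊗[R] G.U) : Module.End R (modifiedSeries R K (Fin m ⊕ Fin m)) :=
  (G.hom₂ K z).unop

theorem act₂_tmul (u v : G.U) (F : modifiedSeries R K (Fin m ⊕ Fin m)) :
    G.act₂ K (u ⊗ₜ v) F =
      G.isRightAction_onRight.act K v (G.isRightAction_onLeft.act K u F) := by
  have h : G.hom₂ K (u ⊗ₜ v) = G.isRightAction_onLeft.hom K u * G.isRightAction_onRight.hom K v :=
    Algebra.TensorProduct.lift_tmul _ _ _ u v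
  rw [act₂, h]
  rfl

theorem act₂_mul (z z' : G.U ⊗[R] G.U) (F : modifiedSeries R K (Fin m ⊕ Fin m)) :
    G.act₂ K (z * z') F = G.act₂ K z' (G.act₂ K z F) := by
  rw [act₂, map_mul]
  rfl

theorem act₂_add (z z' : G.U ⊗[R] G.U) (F : modifiedSeries R K (Fin m ⊕ Fin m)) :
    G.act₂ K (z + z') F = G.act₂ K z F + G.act₂ K z' F := by
  rw [act₂, map_add]
  rfl

theorem act₂_smul (r : R) (z : G.U ⊗[R] G.U) (F : modifiedSeries R K (Fin m ⊕ Fin m)) :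
    G.act₂ K (r • z) F = r • G.act₂ K z F := by
  rw [act₂, map_smul]
  rfl

theorem act₂_one (F : modifiedSeries R K (Fin m ⊕ Fin m)) : G.act₂ K 1 F = F := by
  rw [act₂, map_one]
  rfl

variable {K}

variable (K) in
-- The Leibniz rule: on F(X, X) the field V_j acts as V_j in X plus V_j in Y, which is the coproduct
-- of e_j. Multiplicativity of the coproduct extends this to all of U.
theorem act_modifiedSubst_diag
    (hd : ∀ i, constantCoeff ((Sum.elim (fun i => X i) (fun i => X i) :
      Fin m ⊕ Fin m → MvPowerSeries (Fin m) R) i) = 0)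
    (u : G.U) (F : modifiedSeries R K (Fin m ⊕ Fin m)) :
    G.act K u (modifiedSubst R K _ hd F) =
      modifiedSubst R K _ hd (G.act₂ K (envelopingComul R G.LieAlg u) F) := by
  have hs := hasSubst_of_constantCoeff_zero hd
  have hX : ∀ f : MvPowerSeries (Fin m) R, subst (fun i => X i) f = f := fun f =>
    congrFun subst_self f
  induction u using U_induction generalizing F with
  | one => rw [act, IsRightAction.act_one, map_one, act₂_one]
  | add u v hu hv =>
    rw [act] at hu hv ⊢
    rw [IsRightAction.act_add, hu, hv, map_add, act₂_add, map_add]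
  | smul r u hu =>
    rw [act] at hu ⊢
    rw [IsRightAction.act_smul, hu, map_smul (envelopingComul R G.LieAlg), act₂_smul, map_smul]
  | mul j u hu =>
    rw [act] at hu ⊢
    rw [IsRightAction.act_mul, map_mul, act₂_mul, envelopingComul_e, act₂_add, act₂_tmul, act₂_tmul,
      IsRightAction.act_one, IsRightAction.act_one, IsRightAction.act_e, IsRightAction.act_e,
      IsRightAction.act_e, ← modifiedField_add, ← hu]
    congr 1
    refine modifiedField_modifiedSubst K hd ?_ F
    rintro (i | i)
    · rw [Pi.add_apply, ← coe_substAlgHom hs, map_add, coe_substAlgHom]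
      change vectorField _ (X i) = subst _ (subst _ _) + subst _ 0
      rw [subst_subst_eq_self (constantCoeff_X_inl) hd (fun i => by rw [subst_X hs]; rfl),
        ← coe_substAlgHom hs, map_zero, _root_.add_zero, vectorField_X]
    · rw [Pi.add_apply, ← coe_substAlgHom hs, map_add, coe_substAlgHom]
      change vectorField _ (X i) = subst _ 0 + subst _ (subst _ _)
      rw [subst_subst_eq_self (constantCoeff_X_inr) hd (fun i => by rw [subst_X hs]; rfl),
        ← coe_substAlgHom hs, map_zero, _root_.zero_add, vectorField_X]

variable (K) in
theorem act_onLeft_modifiedSubst_toSeries (u : G.U) (f : modifiedSeries R K (Fin m)) :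
    G.isRightAction_onLeft.act K u (modifiedSubst R K G.toSeries G.constantCoeff_toSeries f) =
      modifiedSubst R K G.toSeries G.constantCoeff_toSeries (G.act K u f) :=
  (IsRightAction.map_act K _ _ (fun j f => (modifiedField_modifiedSubst K _
    (fun i => G.vectorField_rightInv_toSeries j i) f).symm) u f).symm

variable (K) in
-- Fields in Y commute with the restriction to X = 0.
theorem modifiedEval_act_onRight [IsFractionRing R K] (u : G.U)
    (F : modifiedSeries R K (Fin m ⊕ Fin m))
    (h0 : ∀ i, constantCoeff ((Sum.elim 0 X : Fin m ⊕ Fin m → MvPowerSeries (Fin m) R) i) = 0) :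
    modifiedEval R K _ (G.isRightAction_onRight.act K u F) =
      modifiedEval R K _ (G.act K u (modifiedSubst R K _ h0 F)) := by
  have hs := hasSubst_of_constantCoeff_zero h0
  rw [← modifiedEval_modifiedSubst K h0, act]
  congr 1
  refine IsRightAction.map_act K _ _ (fun j f => (modifiedField_modifiedSubst K _ ?_ f).symm) u F
  rintro (i | i)
  · change vectorField _ 0 = subst _ 0
    rw [← coe_substAlgHom hs, map_zero, map_zero]
  · change vectorField _ (X i) = subst _ (subst _ _)
    rw [subst_subst_eq_self (constantCoeff_X_inr) h0 (fun i => by rw [subst_X hs]; rfl),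
      vectorField_X]

variable (K) in
/-- Functions on the product evaluated at `u ⊗ v`. -/
theorem modifiedEval_act₂_modifiedSubst_toSeries [IsFractionRing R K] (u v : G.U)
    (f : modifiedSeries R K (Fin m)) :
    modifiedEval R K _ (G.act₂ K (u ⊗ₜ v)
      (modifiedSubst R K G.toSeries G.constantCoeff_toSeries f)) =
      modifiedEval R K _ (G.act K (u * v) f) := by
  have h0 : ∀ i, constantCoeff
      ((Sum.elim 0 X : Fin m ⊕ Fin m → MvPowerSeries (Fin m) R) i) = 0 := by
    rintro (i | i) <;> simp
  -- Right invariance lets u pass through G; then X = 0 turns G(X, Y) into Y, where v acts. In a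
  -- right action u followed by v is u * v.
  rw [act₂_tmul, act_onLeft_modifiedSubst_toSeries, modifiedEval_act_onRight G K v _ h0, act, act,
    IsRightAction.act_mul]
  congr 2
  rw [modifiedSubst_modifiedSubst K (c := (fun i => X i : Fin m → MvPowerSeries (Fin m) R)) _ h0
    (fun i => constantCoeff_X i)]
  · exact modifiedSubst_eq_self K (fun i => constantCoeff_X i) (fun _ => rfl) _
  · intro i
    have := G.subst_atLeftZero_toSeries (X i)
    rwa [subst_X (hasSubst_of_constantCoeff_zero G.constantCoeff_toSeries)] at this

variable (K) in
-- Fields in X kill g(Y) and fields in Y kill f(X), so u and v act on separate factors.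
theorem modifiedEval_act₂_tmul [IsFractionRing R K] {s : Fin m → MvPowerSeries (Fin m) R}
    (hs : G.IsInverse s) (u v : G.U) (f g : modifiedSeries R K (Fin m)) :
    modifiedEval R K _ (G.act₂ K (u ⊗ₜ v) ((G.functionsHopf K hs).tmul f g)) =
      modifiedEval R K _ (G.act K u f) * modifiedEval R K _ (G.act K v g) := by
  have hl : HasSubst (fun i => (X (Sum.inl i) : MvPowerSeries (Fin m ⊕ Fin m) R)) :=
    hasSubst_of_constantCoeff_zero constantCoeff_X_inl
  have hr : HasSubst (fun i => (X (Sum.inr i) : MvPowerSeries (Fin m ⊕ Fin m) R)) :=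
    hasSubst_of_constantCoeff_zero constantCoeff_X_inr
  let l := modifiedSubst R K (fun i => (X (Sum.inl i) : MvPowerSeries (Fin m ⊕ Fin m) R))
    constantCoeff_X_inl
  let r := modifiedSubst R K (fun i => (X (Sum.inr i) : MvPowerSeries (Fin m ⊕ Fin m) R))
    constantCoeff_X_inr
  have hll : ∀ (w : Fin m → MvPowerSeries (Fin m) R) h,
      modifiedField K (onLeft w) (l h) = l (modifiedField K w h) := fun w h =>
    modifiedField_modifiedSubst K constantCoeff_X_inl (fun i => vectorField_X _ _) h
  have hrr : ∀ (w : Fin m → MvPowerSeries (Fin m) R) h,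
      modifiedField K (onRight w) (r h) = r (modifiedField K w h) := fun w h =>
    modifiedField_modifiedSubst K constantCoeff_X_inr (fun i => vectorField_X _ _) h
  have hlr : ∀ (w : Fin m → MvPowerSeries (Fin m) R) h,
      modifiedField K (onLeft w) (r h) = 0 := fun w h => by
    refine (modifiedField_modifiedSubst K (V' := 0) _ (fun i => ?_) h).trans ?_
    · rw [vectorField_X, Pi.zero_apply, ← coe_substAlgHom hr, map_zero]
      rfl
    · rw [modifiedField_zero, map_zero]
  have hrl : ∀ (w : Fin m → MvPowerSeries (Fin m) R) h,
      modifiedField K (onRight w) (l h) = 0 := fun w h => by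
    refine (modifiedField_modifiedSubst K (V' := 0) _ (fun i => ?_) h).trans ?_
    · rw [vectorField_X, Pi.zero_apply, ← coe_substAlgHom hl, map_zero]
      rfl
    · rw [modifiedField_zero, map_zero]
  have h1 : ∀ h, G.isRightAction_onLeft.act K u (l h * r g) = l (G.act K u h) * r g := fun h =>
    (IsRightAction.map_act K G.isRightAction_rightInv G.isRightAction_onLeft
      (T := (LinearMap.mulRight R (r g)) ∘ₗ l) (fun j f => by
        simp only [LinearMap.comp_apply, LinearMap.mulRight_apply]
        rw [modifiedField_mul, hlr, hll, mul_zero, _root_.add_zero]) u h).symm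
  have h2 : ∀ h, G.isRightAction_onRight.act K v (l h * r g) = l h * r (G.act K v g) := fun h =>
    (IsRightAction.map_act K G.isRightAction_rightInv G.isRightAction_onRight
      (T := (LinearMap.mulLeft R (l h)) ∘ₗ r) (fun j f => by
        simp only [LinearMap.comp_apply, LinearMap.mulLeft_apply]
        rw [modifiedField_mul, hrl, hrr, zero_mul, _root_.zero_add]) v g).symm
  change modifiedEval R K _ (G.act₂ K (u ⊗ₜ v) (l f * r g)) = _
  rw [act₂_tmul, h1, h2, modifiedEval_mul, modifiedEval_modifiedSubst, modifiedEval_modifiedSubst]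

variable (K) in
-- Induction on left multiplication by e_j: V_j passes through s as minus the left invariant field,
-- which commutes with the action and so can be moved outside. At the origin it equals V_j, now
-- acting last; this is right multiplication by -e_j, as for the antipode.
theorem modifiedEval_act_modifiedSubst_inverse [IsFractionRing R K]
    {s : Fin m → MvPowerSeries (Fin m) R} (hs : G.IsInverse s) (u : G.U)
    (f : modifiedSeries R K (Fin m)) :
    modifiedEval R K _ (G.act K u (modifiedSubst R K s hs.constantCoeff_eq_zero f)) =
      modifiedEval R K _ (G.act K (envelopingAntipode R G.LieAlg u) f) := by
  induction u using U_induction generalizing f with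
  | one =>
    rw [envelopingAntipode_one, act, IsRightAction.act_one, IsRightAction.act_one,
      modifiedEval_modifiedSubst]
  | add u v hu hv =>
    rw [act] at hu hv
    rw [map_add, act, act, IsRightAction.act_add, IsRightAction.act_add, map_add, map_add, hu, hv]
  | smul r u hu =>
    rw [act] at hu
    rw [map_smul, act, act, IsRightAction.act_smul, IsRightAction.act_smul, map_smul, map_smul, hu]
  | mul j u hu =>
    have hss := hasSubst_of_constantCoeff_zero hs.constantCoeff_eq_zero
    have h1 : modifiedField K (G.rightInv j) (modifiedSubst R K s hs.constantCoeff_eq_zero f) =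
        modifiedSubst R K s hs.constantCoeff_eq_zero (modifiedField K (-G.leftInv j) f) :=
      modifiedField_modifiedSubst K _ (fun i => by
        rw [Pi.neg_apply, ← coe_substAlgHom hss, map_neg, coe_substAlgHom]
        exact congrFun (G.vectorField_rightInv_inverse hs j) i) f
    have h2 : ∀ v, G.act K v (modifiedField K (G.leftInv j) f) =
        modifiedField K (G.leftInv j) (G.act K v f) := fun v =>
      (IsRightAction.map_act K _ _ (T := modifiedField K (G.leftInv j)) (fun i f => by
        have := modifiedField_comm K (ι := Empty) (V := G.leftInv j) (W := G.rightInv i)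
          (c := Empty.elim) (Z := Empty.elim) (fun f => by
            rw [vectorField_leftInv_rightInv_comm, sub_self, Finset.univ_eq_empty,
              Finset.sum_empty]) f
        rwa [Finset.univ_eq_empty, Finset.sum_empty, sub_eq_zero] at this) v f).symm
    rw [envelopingAntipode_e_mul, act, IsRightAction.act_mul, IsRightAction.act_e, h1]
    rw [act] at hu
    rw [hu, modifiedField_neg, map_neg, map_neg, h2, ← neg_one_smul R (_ * _), act, act,
      IsRightAction.act_smul, neg_one_smul, map_neg, IsRightAction.act_mul, IsRightAction.act_e]
    congr 1
    exact modifiedEval_modifiedField_congr K (fun i => by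
      rw [constantCoeff_leftInv, constantCoeff_rightInv]) _

end FormalGroupLaw

/-! ### Ordered monomials, the pairings and their triangularity -/

namespace FormalGroupLaw

open UniversalEnvelopingAlgebra

attribute [local instance 100] LieRing.ofAssociativeRing

section Words

variable {R : Type*} [CommRing R] {m : ℕ} (G : FormalGroupLaw R m)

/-- The product of the basis vectors named by a word. -/
noncomputable def wordProd (w : List (Fin m)) : G.U := (w.map fun k => ι R (G.e k)).prod

theorem wordProd_nil : G.wordProd [] = 1 := rfl

theorem wordProd_cons (k : Fin m) (w : List (Fin m)) :
    G.wordProd (k :: w) = ι R (G.e k) * G.wordProd w := List.prod_cons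

theorem wordProd_append (v w : List (Fin m)) :
    G.wordProd (v ++ w) = G.wordProd v * G.wordProd w := by
  rw [wordProd, List.map_append, List.prod_append]
  rfl

/-- The nondecreasing word with a given exponent. -/
def sortedWord (j : Fin m →₀ ℕ) : List (Fin m) :=
  (List.ofFn fun i => List.replicate (j i) i).flatten

theorem wordExponent_sortedWord (j : Fin m →₀ ℕ) : wordExponent (sortedWord j) = j := by
  rw [wordExponent, sortedWord, List.map_flatten, List.sum_flatten, List.map_ofFn, List.map_ofFn,
    List.sum_ofFn]
  simp only [Function.comp_apply, List.map_replicate, List.sum_replicate, Finsupp.smul_single,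
    smul_eq_mul, mul_one]
  exact Finsupp.univ_sum_single j

theorem wordProd_sortedWord (j : Fin m →₀ ℕ) :
    G.wordProd (sortedWord j) = G.orderedMonomial j := by
  rw [wordProd, sortedWord, List.map_flatten, List.prod_flatten, List.map_ofFn, List.map_ofFn,
    orderedMonomial]
  congr 2
  funext i
  simp only [Function.comp_apply, List.map_replicate, List.prod_replicate]

theorem length_sortedWord (j : Fin m →₀ ℕ) : (sortedWord j).length = j.degree := by
  rw [← degree_wordExponent, wordExponent_sortedWord]

theorem wordExponent_apply (w : List (Fin m)) (k : Fin m) : wordExponent w k = w.count k := by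
  induction w with
  | nil => rfl
  | cons a w ih =>
    rw [wordExponent, List.map_cons, List.sum_cons, Finsupp.add_apply, ← wordExponent, ih,
      List.count_cons, Finsupp.single_apply, add_comm]
    simp

theorem perm_sortedWord (w : List (Fin m)) : w.Perm (sortedWord (wordExponent w)) := by
  rw [List.perm_iff_count]
  intro k
  rw [← wordExponent_apply, ← wordExponent_apply, wordExponent_sortedWord]

theorem mul_wordProd_mem_span (k : Fin m) {n : ℕ} {u : G.U}
    (hu : u ∈ Submodule.span R (G.wordProd '' {w | w.length < n})) :
    ι R (G.e k) * u ∈ Submodule.span R (G.wordProd '' {w | w.length < n + 1}) := by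
  have : Submodule.span R (G.wordProd '' {w | w.length < n}) ≤
      (Submodule.span R (G.wordProd '' {w | w.length < n + 1})).comap
        (LinearMap.mulLeft R (ι R (G.e k))) := by
    rw [Submodule.span_le]
    rintro _ ⟨w, hw, rfl⟩
    exact Submodule.subset_span ⟨k :: w, Nat.succ_lt_succ hw, G.wordProd_cons k w⟩
  exact this hu

/-- Permuting a word changes the product by products of shorter words. -/
theorem wordProd_sub_mem_span_of_perm {v w : List (Fin m)} (h : v.Perm w) :
    G.wordProd v - G.wordProd w ∈
      Submodule.span R (G.wordProd '' {u | u.length < v.length}) := by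
  induction h with
  | nil => rw [sub_self]; exact zero_mem _
  | cons k h ih =>
    rw [wordProd_cons, wordProd_cons, ← mul_sub]
    exact G.mul_wordProd_mem_span k ih
  | swap a b l =>
    -- A transposition costs a bracket, which is a combination of the e_k, hence words with one
    -- letter less.
    have h1 : G.wordProd (b :: a :: l) - G.wordProd (a :: b :: l) =
        ι R ⁅G.e b, G.e a⁆ * G.wordProd l := by
      rw [LieHom.map_lie, LieRing.of_associative_ring_bracket, wordProd_cons, wordProd_cons,
        wordProd_cons, wordProd_cons, sub_mul, mul_assoc, mul_assoc]
    rw [h1, eq_sum_e ⁅G.e b, G.e a⁆, map_sum, Finset.sum_mul]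
    refine Submodule.sum_mem _ fun k _ => ?_
    rw [map_smul, smul_mul_assoc, ← wordProd_cons]
    exact Submodule.smul_mem _ _ (Submodule.subset_span ⟨k :: l, by simp, rfl⟩)
  | trans h₁ h₂ ih₁ ih₂ =>
    rw [← h₁.length_eq] at ih₂
    rw [← sub_add_sub_cancel]
    exact add_mem ih₁ ih₂

/-- Sorting a word changes its product only by shorter words, to which strong induction on the
length applies. -/
theorem wordProd_mem_span_orderedMonomial (w : List (Fin m)) :
    G.wordProd w ∈ Submodule.span R (G.orderedMonomial '' {j | j.degree ≤ w.length}) := by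
  induction hn : w.length using Nat.strong_induction_on generalizing w with
  | _ n ih =>
    subst hn
    have h1 : G.wordProd (sortedWord (wordExponent w)) ∈
        Submodule.span R (G.orderedMonomial '' {j | j.degree ≤ w.length}) := by
      rw [wordProd_sortedWord]
      exact Submodule.subset_span (Set.mem_image_of_mem _ (degree_wordExponent w).le)
    have h2 : Submodule.span R (G.wordProd '' {u | u.length < w.length}) ≤
        Submodule.span R (G.orderedMonomial '' {j | j.degree ≤ w.length}) := by
      rw [Submodule.span_le]
      rintro _ ⟨v, hv, rfl⟩
      have h4 : {j : Fin m →₀ ℕ | j.degree ≤ v.length} ⊆ {j | j.degree ≤ w.length} :=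
        Set.ofPred_subset_ofPred.2 fun j hj => hj.trans (le_of_lt hv)
      exact Submodule.span_mono (Set.image_mono h4) (ih v.length hv v rfl)
    have h3 := add_mem (h2 (G.wordProd_sub_mem_span_of_perm (perm_sortedWord w))) h1
    rwa [sub_add_cancel] at h3

/-- The degree bound gives the continuity of the maps in the coassociativity axiom of the dual. -/
theorem orderedMonomial_mul_mem_span (p q : Fin m →₀ ℕ) :
    G.orderedMonomial p * G.orderedMonomial q ∈
      Submodule.span R (G.orderedMonomial '' {j | j.degree ≤ p.degree + q.degree}) := by
  have := G.wordProd_mem_span_orderedMonomial (sortedWord p ++ sortedWord q)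
  rwa [wordProd_append, wordProd_sortedWord, wordProd_sortedWord, List.length_append,
    length_sortedWord, length_sortedWord] at this

theorem span_orderedMonomial : Submodule.span R (Set.range G.orderedMonomial) = ⊤ := by
  rw [eq_top_iff]
  have h1 : Submodule.span R (Set.range G.wordProd) ≤
      Submodule.span R (Set.range G.orderedMonomial) := by
    rw [Submodule.span_le]
    rintro _ ⟨w, rfl⟩
    exact Submodule.span_mono (Set.image_subset_range _ _) (G.wordProd_mem_span_orderedMonomial w)
  refine le_trans ?_ h1
  intro u _
  induction u using U_induction with
  | one => exact Submodule.subset_span ⟨[], rfl⟩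
  | add u v hu hv => exact add_mem (hu trivial) (hv trivial)
  | smul r u hu => exact Submodule.smul_mem _ r (hu trivial)
  | mul k u hu =>
    have : Submodule.span R (Set.range G.wordProd) ≤
        (Submodule.span R (Set.range G.wordProd)).comap (LinearMap.mulLeft R (ι R (G.e k))) := by
      rw [Submodule.span_le]
      rintro _ ⟨w, rfl⟩
      exact Submodule.subset_span ⟨k :: w, G.wordProd_cons k w⟩
    exact this (hu trivial)

theorem IsRightAction.act_wordProd {G : FormalGroupLaw R m} (K : Type*) [Field K] [Algebra R K]
    {σ : Type*} [Fintype σ] {V : Fin m → σ → MvPowerSeries σ R} (hV : G.IsRightAction V)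
    (w : List (Fin m)) (f : modifiedSeries R K σ) :
    (hV.act K (G.wordProd w) f).1 =
      w.foldl (fun f k => vectorField (fun i => map (algebraMap R K) (V k i)) f) f.1 := by
  induction w generalizing f with
  | nil => rw [wordProd_nil, act_one]; rfl
  | cons k w ih => rw [wordProd_cons, act_mul, ih, act_e]; rfl

end Words

theorem natCast_le_order_of_mem {R : Type*} (K : Type*) [CommRing R] [Field K] [Algebra R K]
    {σ : Type*} [Fintype σ] {n : ℕ} {f : modifiedSeries R K σ} (hf : f ∈ modifiedFil R K σ n) :
    (n : ℕ∞) ≤ f.1.order :=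
  natCast_le_order_iff.2 hf

variable {R : Type*} [CommRing R] [IsDomain R] [CharZero R] {m : ℕ} (G : FormalGroupLaw R m)
  (K : Type*) [Field K] [Algebra R K] [IsFractionRing R K]

/-- The pairing of functions with the universal enveloping algebra. -/
noncomputable def pairing : modifiedSeries R K (Fin m) →ₗ[R] Module.Dual R G.U :=
  LinearMap.mk₂ R (fun f u => modifiedEval R K _ (G.act K u f))
    (fun f g u => by rw [map_add, map_add])
    (fun r f u => by rw [map_smul, map_smul])
    (fun f u v => by rw [act, act, act, IsRightAction.act_add, map_add])
    (fun r f u => by rw [act, act, IsRightAction.act_smul, map_smul])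

theorem pairing_apply (f : modifiedSeries R K (Fin m)) (u : G.U) :
    G.pairing K f u = modifiedEval R K _ (G.act K u f) := rfl

/-- The pairing of functions of two sets of variables with `U ⊗ U`. -/
noncomputable def pairing₂ :
    modifiedSeries R K (Fin m ⊕ Fin m) →ₗ[R] Module.Dual R (G.U ⊗[R] G.U) :=
  LinearMap.mk₂ R (fun F z => modifiedEval R K _ (G.act₂ K z F))
    (fun f g u => by rw [map_add, map_add])
    (fun r f u => by rw [map_smul, map_smul])
    (fun f u v => by rw [act₂_add, map_add])
    (fun r f u => by rw [act₂_smul, map_smul])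

theorem pairing₂_apply (F : modifiedSeries R K (Fin m ⊕ Fin m)) (z : G.U ⊗[R] G.U) :
    G.pairing₂ K F z = modifiedEval R K _ (G.act₂ K z F) := rfl

/-- e^j acts as the product of |j| invariant fields, so on series of order at least |j| the leading
term computation gives j! b_j. -/
theorem pairing_orderedMonomial {n : ℕ} {f : modifiedSeries R K (Fin m)}
    (hf : f ∈ modifiedFil R K (Fin m) n) {j : Fin m →₀ ℕ} (hj : j.degree ≤ n) :
    G.pairing K f (G.orderedMonomial j) = modifiedCoordinates R K (Fin m) f j := by
  apply IsFractionRing.injective R K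
  rw [pairing_apply, algebraMap_modifiedEval, ← wordProd_sortedWord, act,
    IsRightAction.act_wordProd, algebraMap_modifiedCoordinates,
    constantCoeff_foldl_vectorField (fun k i => ?_), wordExponent_sortedWord]
  · rw [length_sortedWord]
    exact (Nat.cast_le.2 hj).trans (natCast_le_order_of_mem K hf)
  · rw [constantCoeff_map, constantCoeff_rightInv, apply_ite (algebraMap R K), map_one, map_zero]

omit [IsDomain R] [CharZero R] [IsFractionRing R K] in
theorem modifiedMonomial_mem (j : Fin m →₀ ℕ) :
    modifiedMonomial R K j ∈ modifiedFil R K (Fin m) j.degree := fun i hi => by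
  classical
  change coeff i (monomial j 1) = 0
  rw [coeff_monomial, if_neg]
  rintro rfl
  exact lt_irrefl _ hi

theorem modifiedCoordinates_modifiedMonomial (i j : Fin m →₀ ℕ) :
    modifiedCoordinates R K (Fin m) (modifiedMonomial R K i) j =
      if j = i then (multiFactorial i : R) else 0 := by
  classical
  apply IsFractionRing.injective R K
  rw [algebraMap_modifiedCoordinates]
  change _ * coeff j (monomial i 1) = _
  rw [coeff_monomial]
  split_ifs with h
  · rw [h, mul_one, map_natCast]
  · rw [mul_zero, map_zero]

/-- In a relation take i of maximal degree in the support and pair with t^i: the terms j ≠ i vanish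
and i! times the coefficient of e^i remains. -/
theorem linearIndependent_orderedMonomial : LinearIndependent R G.orderedMonomial := by
  classical
  let K := FractionRing R
  rw [linearIndependent_iff]
  intro l hl
  by_contra hne
  obtain ⟨i, hi, hmax⟩ := Finset.exists_max_image l.support Finsupp.degree
    (Finsupp.support_nonempty_iff.2 hne)
  have h := congrArg (G.pairing K (modifiedMonomial R K i)) hl
  rw [map_zero, Finsupp.linearCombination_apply, Finsupp.sum, map_sum, Finset.sum_eq_single i,
    map_smul, G.pairing_orderedMonomial K (modifiedMonomial_mem K i) le_rfl,
    modifiedCoordinates_modifiedMonomial, if_pos rfl, smul_eq_mul] at h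
  · rcases mul_eq_zero.1 h with h | h
    · exact Finsupp.mem_support_iff.1 hi h
    · exact Finset.prod_ne_zero_iff.2 (fun i _ => Nat.factorial_ne_zero _) (Nat.cast_eq_zero.1 h)
  · intro j hj hji
    rw [map_smul, G.pairing_orderedMonomial K (modifiedMonomial_mem K i) (hmax j hj),
      modifiedCoordinates_modifiedMonomial, if_neg hji, smul_zero]
  · exact fun h => absurd hi h

/-- The ordered monomials form a basis of the universal enveloping algebra. -/
noncomputable def monomialBasis : Module.Basis (Fin m →₀ ℕ) R G.U :=
  Module.Basis.mk G.linearIndependent_orderedMonomial G.span_orderedMonomial.ge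

theorem monomialBasis_apply (j : Fin m →₀ ℕ) : G.monomialBasis j = G.orderedMonomial j :=
  Module.Basis.mk_apply _ _ j

theorem foldl_vectorField_eq {V : Fin m ⊕ Fin m → Fin m ⊕ Fin m → MvPowerSeries (Fin m ⊕ Fin m) K}
    (p q : List (Fin m)) (F : MvPowerSeries (Fin m ⊕ Fin m) K) :
    q.foldl (fun f k => vectorField (V (Sum.inr k)) f)
        (p.foldl (fun f k => vectorField (V (Sum.inl k)) f) F) =
      (p.map Sum.inl ++ q.map Sum.inr).foldl (fun f k => vectorField (V k) f) F := by
  rw [List.foldl_append, List.foldl_map, List.foldl_map]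

theorem wordExponent_append {σ : Type*} (v w : List σ) :
    wordExponent (v ++ w) = wordExponent v + wordExponent w := by
  rw [wordExponent, List.map_append, List.sum_append]
  rfl

theorem wordExponent_map {σ τ : Type*} (g : σ → τ) (w : List σ) :
    wordExponent (w.map g) = (wordExponent w).mapDomain g := by
  rw [wordExponent, wordExponent, ← Finsupp.mapDomain.addMonoidHom_apply, map_list_sum, List.map_map,
    List.map_map]
  congr 2
  funext i
  exact Finsupp.mapDomain_single.symm

theorem wordExponent_map_append (p q : Fin m →₀ ℕ) :
    wordExponent ((sortedWord p).map Sum.inl ++ (sortedWord q).map Sum.inr) =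
      sumExponents (Equiv.refl _) (p, q) := by
  rw [wordExponent_append, wordExponent_map, wordExponent_map, wordExponent_sortedWord,
    wordExponent_sortedWord]
  ext (i | i)
  · rw [Finsupp.add_apply, Finsupp.mapDomain_apply Sum.inl_injective,
      Finsupp.mapDomain_of_notMem_range _ _ (by simp)]
    rfl
  · rw [Finsupp.add_apply, Finsupp.mapDomain_apply Sum.inr_injective,
      Finsupp.mapDomain_of_notMem_range _ _ (by simp), _root_.zero_add]
    rfl

/-- The fields V_j in X and in Y together form a frame with value the coordinate frame at the
origin, so the leading term computation applies to the concatenated word. -/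
theorem pairing₂_orderedMonomial {n : ℕ} {F : modifiedSeries R K (Fin m ⊕ Fin m)}
    (hF : F ∈ modifiedFil R K (Fin m ⊕ Fin m) n) {p q : Fin m →₀ ℕ}
    (hpq : p.degree + q.degree ≤ n) :
    G.pairing₂ K F (G.orderedMonomial p ⊗ₜ G.orderedMonomial q) =
      modifiedCoordinates R K (Fin m ⊕ Fin m) F (sumExponents (Equiv.refl _) (p, q)) := by
  classical
  apply IsFractionRing.injective R K
  have hl : ∀ w : Fin m → MvPowerSeries (Fin m) R, ∀ i, constantCoeff (onLeft w i) =
      Sum.elim (fun i => constantCoeff (w i)) 0 i := fun w i => by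
    rcases i with i | i
    · exact constantCoeff_subst_of_zero constantCoeff_X_inl _
    · exact map_zero _
  have hr : ∀ w : Fin m → MvPowerSeries (Fin m) R, ∀ i, constantCoeff (onRight w i) =
      Sum.elim (fun _ => 0) (fun i => constantCoeff (w i)) i := fun w i => by
    rcases i with i | i
    · exact map_zero _
    · exact constantCoeff_subst_of_zero constantCoeff_X_inr _
  let V : Fin m ⊕ Fin m → Fin m ⊕ Fin m → MvPowerSeries (Fin m ⊕ Fin m) K := fun k i =>
    map (algebraMap R K) (Sum.elim (fun j => onLeft (G.rightInv j))
      (fun j => onRight (G.rightInv j)) k i)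
  have hV : ∀ k i, constantCoeff (V k i) = if k = i then 1 else 0 := by
    rintro (k | k) (i | i) <;>
    simp [V, hl, hr, constantCoeff_rightInv, apply_ite (algebraMap R K)]
  rw [pairing₂_apply, algebraMap_modifiedEval, act₂_tmul, ← wordProd_sortedWord,
    ← wordProd_sortedWord, IsRightAction.act_wordProd, IsRightAction.act_wordProd,
    algebraMap_modifiedCoordinates, ← wordExponent_map_append,
    ← constantCoeff_foldl_vectorField hV, ← foldl_vectorField_eq]
  · rfl
  · rw [List.length_append, List.length_map, List.length_map, length_sortedWord, length_sortedWord]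
    exact (Nat.cast_le.2 hpq).trans (natCast_le_order_of_mem K hF)

end FormalGroupLaw

/-! ### Coordinates on dual modules -/

section DualCoordinates

variable {R : Type*} [CommRing R]

theorem IsCoordinates.reindex {M ι κ : Type*} [AddCommGroup M] [Module R M] {c : M ≃ₗ[R] (ι → R)}
    {w : ι → ℕ} {F : ℕ → Submodule R M} (h : IsCoordinates c w F) (e : κ ≃ ι) {w' : κ → ℕ}
    (hw : ∀ k, w' k = w (e k)) :
    IsCoordinates (c ≪≫ₗ LinearEquiv.funCongrLeft R R e) w' F where
  finite n := by
    simp only [hw]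
    exact (h.finite n).preimage e.injective.injOn
  mem_iff n x := by
    rw [h.mem_iff, e.forall_congr_left]
    simp only [hw]
    refine forall_congr' fun i => ?_
    rw [LinearEquiv.trans_apply, LinearEquiv.funCongrLeft_apply, LinearMap.funLeft_apply,
      e.apply_symm_apply]

theorem isCoordinates_dualFil {M ι : Type*} [AddCommGroup M] [Module R M]
    (b : Module.Basis ι R M) {v : ι → M} (hb : ∀ i, b i = v i) {w : ι → ℕ}
    (hw : ∀ n, {i | w i < n}.Finite) :
    IsCoordinates (b.constr R).symm w (dualFil v w) where
  finite := hw
  mem_iff n x := forall_congr' fun i => by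
    rw [← hb]
    rfl

theorem finite_setOf_add_lt {ι κ : Type*} {w : ι → ℕ} {w' : κ → ℕ}
    (hw : ∀ n, {i | w i < n}.Finite) (hw' : ∀ n, {i | w' i < n}.Finite) (n : ℕ) :
    {p : ι × κ | w p.1 + w' p.2 < n}.Finite :=
  ((hw n).prod (hw' n)).subset fun p hp => by
    have hp' : w p.1 + w' p.2 < n := hp
    exact ⟨lt_of_le_of_lt (Nat.le_add_right _ _) hp', lt_of_le_of_lt (Nat.le_add_left _ _) hp'⟩

end DualCoordinates

/-! ### Transport of the Hopf axioms -/

section Transport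

variable {R H H₂ H₃ H' H₂' H₃' : Type*} [CommRing R]
    [AddCommGroup H] [Module R H] [AddCommGroup H₂] [Module R H₂] [AddCommGroup H₃] [Module R H₃]
    [AddCommGroup H'] [Module R H'] [AddCommGroup H₂'] [Module R H₂']
    [AddCommGroup H₃'] [Module R H₃']
    {A : CompleteHopfData R H H₂ H₃} {B : CompleteHopfData R H' H₂' H₃'}

/-- The axioms of a complete Hopf algebra which only involve two tensor factors are transported by
compatible isomorphisms. -/
theorem CompleteHopfData.IsCompleteHopfAlgebra.transport (hA : A.IsCompleteHopfAlgebra)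
    (Φ : H ≃ₗ[R] H') (Φ₂ : H₂ ≃ₗ[R] H₂')
    (hf : ∀ n x, x ∈ A.fil n ↔ Φ x ∈ B.fil n) (hf₂ : ∀ n x, x ∈ A.fil₂ n ↔ Φ₂ x ∈ B.fil₂ n)
    (ht : ∀ x y, Φ₂ (A.tmul x y) = B.tmul (Φ x) (Φ y))
    (hmul : ∀ z, Φ (A.mul z) = B.mul (Φ₂ z)) (hcomul : ∀ x, Φ₂ (A.comul x) = B.comul (Φ x))
    (hunit : ∀ r, Φ (A.unit r) = B.unit r) (hcounit : ∀ x, B.counit (Φ x) = A.counit x)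
    (hantipode : ∀ x, Φ (A.antipode x) = B.antipode (Φ x))
    (complete : IsCompleteFiltration B.fil)
    (isTensor : IsCompletedTensor B.fil B.fil B.fil₂ B.tmul)
    (isTensorLeft : IsCompletedTensor B.fil₂ B.fil B.fil₃ B.tmulLeft)
    (isTensorRight : IsCompletedTensor B.fil B.fil₂ B.fil₃ B.tmulRight)
    (tmul_assoc : ∀ x y z, B.tmulLeft (B.tmul x y) z = B.tmulRight x (B.tmul y z))
    (coassoc : ∃ cl cr : H₂' →ₗ[R] H₃', IsFilCont B.fil₂ B.fil₃ cl ∧ IsFilCont B.fil₂ B.fil₃ cr ∧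
      (∀ x y, cl (B.tmul x y) = B.tmulLeft (B.comul x) y) ∧
      (∀ x y, cr (B.tmul x y) = B.tmulRight x (B.comul y)) ∧
      ∀ x, cl (B.comul x) = cr (B.comul x)) :
    B.IsCompleteHopfAlgebra where
  complete := complete
  isTensor := isTensor
  isTensorLeft := isTensorLeft
  isTensorRight := isTensorRight
  tmul_assoc := tmul_assoc
  coassoc := coassoc
  mul_cont n := by
    obtain ⟨k, hk⟩ := hA.mul_cont n
    refine ⟨k, fun z hz => ?_⟩
    obtain ⟨z, rfl⟩ := Φ₂.surjective z
    rw [← hmul, ← hf]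
    exact hk z ((hf₂ k z).2 hz)
  comul_cont n := by
    obtain ⟨k, hk⟩ := hA.comul_cont n
    refine ⟨k, fun z hz => ?_⟩
    obtain ⟨z, rfl⟩ := Φ.surjective z
    rw [← hcomul, ← hf₂]
    exact hk z ((hf k z).2 hz)
  counit_cont := by
    obtain ⟨k, hk⟩ := hA.counit_cont
    refine ⟨k, fun z hz => ?_⟩
    obtain ⟨z, rfl⟩ := Φ.surjective z
    rw [hcounit]
    exact hk z ((hf k z).2 hz)
  antipode_cont n := by
    obtain ⟨k, hk⟩ := hA.antipode_cont n
    refine ⟨k, fun z hz => ?_⟩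
    obtain ⟨z, rfl⟩ := Φ.surjective z
    rw [← hantipode, ← hf]
    exact hk z ((hf k z).2 hz)
  mul_assoc x y z := by
    obtain ⟨x, rfl⟩ := Φ.surjective x
    obtain ⟨y, rfl⟩ := Φ.surjective y
    obtain ⟨z, rfl⟩ := Φ.surjective z
    simp only [← ht, ← hmul, hA.mul_assoc]
  one_mul x := by
    obtain ⟨x, rfl⟩ := Φ.surjective x
    simp only [← hunit, ← ht, ← hmul, hA.one_mul]
  mul_one x := by
    obtain ⟨x, rfl⟩ := Φ.surjective x
    simp only [← hunit, ← ht, ← hmul, hA.mul_one]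
  counit_comul := by
    obtain ⟨c, hc, h1, h2⟩ := hA.counit_comul
    refine ⟨Φ.toLinearMap ∘ₗ c ∘ₗ Φ₂.symm.toLinearMap, fun n => ?_, fun x y => ?_, fun x => ?_⟩
    · obtain ⟨k, hk⟩ := hc n
      refine ⟨k, fun z hz => ?_⟩
      obtain ⟨z, rfl⟩ := Φ₂.surjective z
      simpa [← hf] using hk z ((hf₂ k z).2 hz)
    · obtain ⟨x, rfl⟩ := Φ.surjective x
      obtain ⟨y, rfl⟩ := Φ.surjective y
      simp [← ht, h1, hcounit]
    · obtain ⟨x, rfl⟩ := Φ.surjective x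
      simp [← hcomul, h2]
  comul_counit := by
    obtain ⟨c, hc, h1, h2⟩ := hA.comul_counit
    refine ⟨Φ.toLinearMap ∘ₗ c ∘ₗ Φ₂.symm.toLinearMap, fun n => ?_, fun x y => ?_, fun x => ?_⟩
    · obtain ⟨k, hk⟩ := hc n
      refine ⟨k, fun z hz => ?_⟩
      obtain ⟨z, rfl⟩ := Φ₂.surjective z
      simpa [← hf] using hk z ((hf₂ k z).2 hz)
    · obtain ⟨x, rfl⟩ := Φ.surjective x
      obtain ⟨y, rfl⟩ := Φ.surjective y
      simp [← ht, h1, hcounit]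
    · obtain ⟨x, rfl⟩ := Φ.surjective x
      simp [← hcomul, h2]
  counit_one := by rw [← hunit, hcounit, hA.counit_one]
  counit_mul x y := by
    obtain ⟨x, rfl⟩ := Φ.surjective x
    obtain ⟨y, rfl⟩ := Φ.surjective y
    rw [← ht, ← hmul, hcounit, hcounit, hcounit, hA.counit_mul]
  comul_one := by rw [← hunit, ← hcomul, ← ht, hA.comul_one]
  comul_mul := by
    obtain ⟨m₂, hm, h1, h2⟩ := hA.comul_mul
    refine ⟨(m₂.compl₁₂ Φ₂.symm.toLinearMap Φ₂.symm.toLinearMap).compr₂ Φ₂.toLinearMap, fun n => ?_,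
      fun x y x' y' => ?_, fun x y => ?_⟩
    · obtain ⟨k, hk⟩ := hm n
      refine ⟨k, fun a ha b => ?_⟩
      obtain ⟨a, rfl⟩ := Φ₂.surjective a
      obtain ⟨b, rfl⟩ := Φ₂.surjective b
      simpa [← hf₂] using hk a ((hf₂ k a).2 ha) b
    · obtain ⟨x, rfl⟩ := Φ.surjective x
      obtain ⟨y, rfl⟩ := Φ.surjective y
      obtain ⟨x', rfl⟩ := Φ.surjective x'
      obtain ⟨y', rfl⟩ := Φ.surjective y'
      simp [← ht, ← hmul, h1]
    · obtain ⟨x, rfl⟩ := Φ.surjective x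
      obtain ⟨y, rfl⟩ := Φ.surjective y
      simp [← ht, ← hmul, ← hcomul, h2]
  antipode_left := by
    obtain ⟨c, hc, h1, h2⟩ := hA.antipode_left
    refine ⟨Φ₂.toLinearMap ∘ₗ c ∘ₗ Φ₂.symm.toLinearMap, fun n => ?_, fun x y => ?_, fun x => ?_⟩
    · obtain ⟨k, hk⟩ := hc n
      refine ⟨k, fun z hz => ?_⟩
      obtain ⟨z, rfl⟩ := Φ₂.surjective z
      simpa [← hf₂] using hk z ((hf₂ k z).2 hz)
    · obtain ⟨x, rfl⟩ := Φ.surjective x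
      obtain ⟨y, rfl⟩ := Φ.surjective y
      simp [← ht, h1, ← hantipode]
    · obtain ⟨x, rfl⟩ := Φ.surjective x
      simp only [LinearMap.comp_apply, LinearEquiv.coe_coe, ← hcomul, LinearEquiv.symm_apply_apply,
        ← hmul, h2, hcounit, hunit]
  antipode_right := by
    obtain ⟨c, hc, h1, h2⟩ := hA.antipode_right
    refine ⟨Φ₂.toLinearMap ∘ₗ c ∘ₗ Φ₂.symm.toLinearMap, fun n => ?_, fun x y => ?_, fun x => ?_⟩
    · obtain ⟨k, hk⟩ := hc n
      refine ⟨k, fun z hz => ?_⟩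
      obtain ⟨z, rfl⟩ := Φ₂.surjective z
      simpa [← hf₂] using hk z ((hf₂ k z).2 hz)
    · obtain ⟨x, rfl⟩ := Φ.surjective x
      obtain ⟨y, rfl⟩ := Φ.surjective y
      simp [← ht, h1, ← hantipode]
    · obtain ⟨x, rfl⟩ := Φ.surjective x
      simp only [LinearMap.comp_apply, LinearEquiv.coe_coe, ← hcomul, LinearEquiv.symm_apply_apply,
        ← hmul, h2, hcounit, hunit]

end Transport

/-! ### The duality between functions and the enveloping algebra -/

namespace FormalGroupLaw

attribute [local instance 100] LieRing.ofAssociativeRing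

variable {R : Type*} [CommRing R] [IsDomain R] [CharZero R] {m : ℕ} (G : FormalGroupLaw R m)
  (K : Type*) [Field K] [Algebra R K] [IsFractionRing R K]

theorem finite_setOf_degree_lt (n : ℕ) : {j : Fin m →₀ ℕ | j.degree < n}.Finite :=
  -- The finiteness does not involve the ring; ℤ and ℚ are arbitrary choices.
  (isCoordinates_modified (R := ℤ) (K := ℚ) (σ := Fin m)).finite n

/-! ### Compatibility of the pairings with the structure maps -/

section Compatibility

variable {s : Fin m → MvPowerSeries (Fin m) R} (hs : G.IsInverse s)

theorem pairing_mul (F : modifiedSeries R K (Fin m ⊕ Fin m)) :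
    G.pairing K ((G.functionsHopf K hs).mul F) = G.dualHopf.mul (G.pairing₂ K F) := by
  have hd : ∀ i, constantCoeff ((Sum.elim (fun i => X i) (fun i => X i) :
      Fin m ⊕ Fin m → MvPowerSeries (Fin m) R) i) = 0 := by
    rintro (i | i) <;> exact constantCoeff_X _
  refine LinearMap.ext fun u => ?_
  change modifiedEval R K _ (G.act K u (modifiedSubst R K _ hd F)) =
    modifiedEval R K _ (G.act₂ K (envelopingComul R G.LieAlg u) F)
  rw [act_modifiedSubst_diag, modifiedEval_modifiedSubst]

theorem pairing₂_comul (f : modifiedSeries R K (Fin m)) :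
    G.pairing₂ K ((G.functionsHopf K hs).comul f) = G.dualHopf.comul (G.pairing K f) :=
  TensorProduct.ext' fun u v => G.modifiedEval_act₂_modifiedSubst_toSeries K u v f

theorem pairing₂_tmul (f g : modifiedSeries R K (Fin m)) :
    G.pairing₂ K ((G.functionsHopf K hs).tmul f g) =
      G.dualHopf.tmul (G.pairing K f) (G.pairing K g) :=
  TensorProduct.ext' fun u v => G.modifiedEval_act₂_tmul K hs u v f g

theorem pairing_unit (r : R) :
    G.pairing K ((G.functionsHopf K hs).unit r) = G.dualHopf.unit r := by
  refine LinearMap.ext fun u => ?_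
  change modifiedEval R K _ (G.act K u (algebraMap R _ r)) = r • envelopingCounit R G.LieAlg u
  rw [act, IsRightAction.act_algebraMap, modifiedEval_algebraMap, smul_eq_mul]

theorem counit_pairing (f : modifiedSeries R K (Fin m)) :
    G.dualHopf.counit (G.pairing K f) = (G.functionsHopf K hs).counit f := by
  change modifiedEval R K _ (G.act K 1 f) = modifiedEval R K _ f
  rw [act, IsRightAction.act_one]

theorem pairing_antipode (f : modifiedSeries R K (Fin m)) :
    G.pairing K ((G.functionsHopf K hs).antipode f) = G.dualHopf.antipode (G.pairing K f) :=
  LinearMap.ext fun u => G.modifiedEval_act_modifiedSubst_inverse K hs u f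

end Compatibility

/-! ### The dual of the enveloping algebra -/

theorem isCoordinates_dual :
    IsCoordinates (G.monomialBasis.constr R).symm Finsupp.degree G.dualHopf.fil :=
  isCoordinates_dualFil G.monomialBasis G.monomialBasis_apply finite_setOf_degree_lt

theorem isCoordinates_dual₂ :
    IsCoordinates ((G.monomialBasis.tensorProduct G.monomialBasis).constr R).symm
      (fun p => p.1.degree + p.2.degree) G.dualHopf.fil₂ :=
  isCoordinates_dualFil _
    (fun p => by
      rw [Module.Basis.tensorProduct_apply', monomialBasis_apply, monomialBasis_apply])
    (finite_setOf_add_lt finite_setOf_degree_lt finite_setOf_degree_lt)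

theorem isCoordinates_dual₃ :
    IsCoordinates (((G.monomialBasis.tensorProduct G.monomialBasis).tensorProduct
      G.monomialBasis).constr R).symm
      (fun p => p.1.1.degree + p.1.2.degree + p.2.degree) G.dualHopf.fil₃ :=
  isCoordinates_dualFil _
    (fun p => by
      rw [Module.Basis.tensorProduct_apply', Module.Basis.tensorProduct_apply', monomialBasis_apply,
        monomialBasis_apply, monomialBasis_apply])
    (finite_setOf_add_lt (finite_setOf_add_lt finite_setOf_degree_lt finite_setOf_degree_lt)
      finite_setOf_degree_lt)

theorem isCompletedTensor_dual :
    IsCompletedTensor G.dualHopf.fil G.dualHopf.fil G.dualHopf.fil₂ G.dualHopf.tmul :=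
  G.isCoordinates_dual.isCompletedTensor G.isCoordinates_dual G.isCoordinates_dual₂
    fun φ ψ p q => by
      change G.dualHopf.tmul φ ψ (G.monomialBasis.tensorProduct G.monomialBasis (p, q)) = _
      rw [Module.Basis.tensorProduct_apply]
      rfl

theorem isCompletedTensorLeft_dual :
    IsCompletedTensor G.dualHopf.fil₂ G.dualHopf.fil G.dualHopf.fil₃ G.dualHopf.tmulLeft :=
  G.isCoordinates_dual₂.isCompletedTensor G.isCoordinates_dual G.isCoordinates_dual₃
    fun φ ψ p q => by
      change G.dualHopf.tmulLeft φ ψ ((G.monomialBasis.tensorProduct G.monomialBasis).tensorProduct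
        G.monomialBasis (p, q)) = _
      rw [Module.Basis.tensorProduct_apply]
      rfl

/-- The triple basis is indexed by ((p, q), r), so its coordinates are first reindexed by (p, (q,
r)). -/
theorem isCompletedTensorRight_dual :
    IsCompletedTensor G.dualHopf.fil G.dualHopf.fil₂ G.dualHopf.fil₃ G.dualHopf.tmulRight :=
  G.isCoordinates_dual.isCompletedTensor G.isCoordinates_dual₂
    (G.isCoordinates_dual₃.reindex (Equiv.prodAssoc _ _ _).symm
      fun p => (_root_.add_assoc _ _ _).symm)
    fun φ ψ p q => by
      change G.dualHopf.tmulRight φ ψ ((G.monomialBasis.tensorProduct G.monomialBasis).tensorProduct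
        G.monomialBasis ((p, q.1), q.2)) =
        φ (G.monomialBasis p) * ψ (G.monomialBasis.tensorProduct G.monomialBasis (q.1, q.2))
      rw [Module.Basis.tensorProduct_apply, Module.Basis.tensorProduct_apply,
        Module.Basis.tensorProduct_apply]
      rfl

omit [IsDomain R] [CharZero R] in
-- The two maps are the transposes of multiplying the first two or the last two factors. They
-- preserve the filtration because a product of ordered monomials involves only monomials of at most
-- the total degree.
theorem coassoc_dual : ∃ cl cr : Module.Dual R (G.U ⊗[R] G.U) →ₗ[R]
      Module.Dual R ((G.U ⊗[R] G.U) ⊗[R] G.U),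
    IsFilCont G.dualHopf.fil₂ G.dualHopf.fil₃ cl ∧ IsFilCont G.dualHopf.fil₂ G.dualHopf.fil₃ cr ∧
      (∀ x y, cl (G.dualHopf.tmul x y) = G.dualHopf.tmulLeft (G.dualHopf.comul x) y) ∧
      (∀ x y, cr (G.dualHopf.tmul x y) = G.dualHopf.tmulRight x (G.dualHopf.comul y)) ∧
      ∀ x, cl (G.dualHopf.comul x) = cr (G.dualHopf.comul x) := by
  refine ⟨(TensorProduct.map (LinearMap.mul' R G.U) LinearMap.id).dualMap,
    (TensorProduct.map LinearMap.id (LinearMap.mul' R G.U) ∘ₗ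
      (TensorProduct.assoc R G.U G.U G.U).toLinearMap).dualMap, fun n => ⟨n, fun χ hχ => ?_⟩,
    fun n => ⟨n, fun χ hχ => ?_⟩, fun φ ψ => ?_, fun φ ψ => ?_, fun φ => ?_⟩
  · rintro ⟨⟨p, q⟩, r⟩ hp
    change χ ((G.orderedMonomial p * G.orderedMonomial q) ⊗ₜ G.orderedMonomial r) = 0
    have : Submodule.span R (G.orderedMonomial '' {j | j.degree ≤ p.degree + q.degree}) ≤
        LinearMap.ker (χ ∘ₗ (TensorProduct.mk R G.U G.U).flip (G.orderedMonomial r)) := by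
      rw [Submodule.span_le]
      rintro _ ⟨j, hj, rfl⟩
      exact hχ (j, r) (lt_of_le_of_lt (Nat.add_le_add_right hj _) hp)
    exact this (G.orderedMonomial_mul_mem_span p q)
  · rintro ⟨⟨p, q⟩, r⟩ hp
    change χ (G.orderedMonomial p ⊗ₜ (G.orderedMonomial q * G.orderedMonomial r)) = 0
    have : Submodule.span R (G.orderedMonomial '' {j | j.degree ≤ q.degree + r.degree}) ≤
        LinearMap.ker (χ ∘ₗ TensorProduct.mk R G.U G.U (G.orderedMonomial p)) := by
      rw [Submodule.span_le]
      rintro _ ⟨j, hj, rfl⟩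
      refine hχ (p, j) (lt_of_le_of_lt (Nat.add_le_add_left hj _) ?_)
      rw [← Nat.add_assoc]
      exact hp
    exact this (G.orderedMonomial_mul_mem_span q r)
  · exact TensorProduct.ext_threefold fun u v w => rfl
  · exact TensorProduct.ext_threefold fun u v w => rfl
  · exact TensorProduct.ext_threefold fun u v w => congrArg φ (mul_assoc u v w)

theorem pairing_triangular (n : ℕ) (f) (hf : f ∈ modifiedFil R K (Fin m) n) (j : Fin m →₀ ℕ)
    (hj : j.degree ≤ n) :
    (G.monomialBasis.constr R).symm (G.pairing K f) j = modifiedCoordinates R K (Fin m) f j := by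
  rw [← G.pairing_orderedMonomial K hf hj, ← monomialBasis_apply]
  rfl

theorem pairing₂_triangular (n : ℕ) (F) (hF : F ∈ modifiedFil R K (Fin m ⊕ Fin m) n)
    (p : (Fin m →₀ ℕ) × (Fin m →₀ ℕ)) (hp : p.1.degree + p.2.degree ≤ n) :
    ((G.monomialBasis.tensorProduct G.monomialBasis).constr R).symm (G.pairing₂ K F) p =
      ((modifiedCoordinates R K (Fin m ⊕ Fin m)).trans
        (LinearEquiv.funCongrLeft R R (sumExponents (Equiv.refl _)))) F p := by
  change G.pairing₂ K F (G.monomialBasis.tensorProduct G.monomialBasis p) = _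
  rw [Module.Basis.tensorProduct_apply', monomialBasis_apply, monomialBasis_apply]
  exact G.pairing₂_orderedMonomial K hF hp

/-- The duality between functions and the universal enveloping algebra. -/
noncomputable def pairingEquiv : modifiedSeries R K (Fin m) ≃ₗ[R] Module.Dual R G.U :=
  LinearEquiv.ofBijective (G.pairing K)
    (isCoordinates_modified.bijective_of_triangular G.isCoordinates_dual (G.pairing_triangular K))

/-- The duality between functions of two sets of variables and `U ⊗ U`. -/
noncomputable def pairingEquiv₂ :
    modifiedSeries R K (Fin m ⊕ Fin m) ≃ₗ[R] Module.Dual R (G.U ⊗[R] G.U) :=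
  LinearEquiv.ofBijective (G.pairing₂ K)
    ((isCoordinates_modified_sum (Equiv.refl _)).bijective_of_triangular G.isCoordinates_dual₂
      (G.pairing₂_triangular K))

theorem mem_fil_iff (n : ℕ) (f : modifiedSeries R K (Fin m)) :
    f ∈ modifiedFil R K (Fin m) n ↔ G.pairing K f ∈ G.dualHopf.fil n :=
  ⟨isCoordinates_modified.map_mem G.isCoordinates_dual (G.pairing_triangular K),
    isCoordinates_modified.mem_of_map_mem G.isCoordinates_dual (G.pairing_triangular K)⟩

theorem mem_fil₂_iff (n : ℕ) (F : modifiedSeries R K (Fin m ⊕ Fin m)) :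
    F ∈ modifiedFil R K (Fin m ⊕ Fin m) n ↔ G.pairing₂ K F ∈ G.dualHopf.fil₂ n :=
  ⟨(isCoordinates_modified_sum (Equiv.refl _)).map_mem G.isCoordinates_dual₂
      (G.pairing₂_triangular K),
    (isCoordinates_modified_sum (Equiv.refl _)).mem_of_map_mem G.isCoordinates_dual₂
      (G.pairing₂_triangular K)⟩

include K in
-- Axioms with at most two tensor factors are inherited from functions through the pairings. No
-- pairing in three sets of variables is used: completeness, the tensor products and coassociativity
-- come from the basis and the associativity of U.
theorem isCompleteHopfAlgebra_dualHopf {s : Fin m → MvPowerSeries (Fin m) R} (hs : G.IsInverse s) :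
    G.dualHopf.IsCompleteHopfAlgebra :=
  (isCompleteHopfAlgebra_functionsHopf hs K).transport (G.pairingEquiv K) (G.pairingEquiv₂ K)
    (G.mem_fil_iff K) (G.mem_fil₂_iff K) (G.pairing₂_tmul K hs) (G.pairing_mul K hs)
    (G.pairing₂_comul K hs) (G.pairing_unit K hs) (G.counit_pairing K hs) (G.pairing_antipode K hs)
    G.isCoordinates_dual.isCompleteFiltration G.isCompletedTensor_dual G.isCompletedTensorLeft_dual
    G.isCompletedTensorRight_dual
    (fun _ _ _ => TensorProduct.ext_threefold fun _ _ _ => mul_assoc _ _ _) G.coassoc_dual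

theorem isIso_pairingEquiv {s : Fin m → MvPowerSeries (Fin m) R} (hs : G.IsInverse s) :
    (G.functionsHopf K hs).IsIso G.dualHopf (G.pairingEquiv K) where
  cont n := ⟨n, fun f hf => (G.mem_fil_iff K n f).1 hf⟩
  cont_symm n := ⟨n, fun φ hφ => by
    refine (G.mem_fil_iff K n _).2 ?_
    rwa [← (G.pairingEquiv K).apply_symm_apply φ] at hφ⟩
  map_mul_comul := ⟨G.pairing₂ K, fun n => ⟨n, fun F hF => (G.mem_fil₂_iff K n F).1 hF⟩,
    G.pairing₂_tmul K hs, G.pairing_mul K hs, G.pairing₂_comul K hs⟩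
  map_unit := G.pairing_unit K hs
  map_counit := G.counit_pairing K hs
  map_antipode := G.pairing_antipode K hs

/-- t^j has order |j|, so its pairing with every e^i, |i| ≤ |j|, is given exactly by the coordinates
of t^j, which are j! at i = j and 0 elsewhere. -/
theorem pairing_modifiedMonomial_sub_mem (j : Fin m →₀ ℕ) :
    G.pairing K (modifiedMonomial R K j) - multiFactorial j • G.monomialBasis.coord j ∈
      G.dualHopf.fil (j.degree + 1) := by
  classical
  intro i hi
  rw [LinearMap.sub_apply, G.pairing_orderedMonomial K (modifiedMonomial_mem K j)
    (Nat.lt_succ_iff.1 hi), modifiedCoordinates_modifiedMonomial, LinearMap.smul_apply,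
    ← monomialBasis_apply, Module.Basis.coord_apply, Module.Basis.repr_self, Finsupp.single_apply]
  split_ifs <;> simp

end FormalGroupLaw

/-! ### The main theorem -/

theorem mainTheorem5 {R : Type*} [CommRing R] [IsDomain R] [CharZero R]
    {K : Type*} [Field K] [Algebra R K] [IsFractionRing R K]
    {m : ℕ} (G : FormalGroupLaw R m) :
    ∃ (s : Fin m → MvPowerSeries (Fin m) R) (hs : G.IsInverse s)
      (b : Module.Basis (Fin m →₀ ℕ) R G.U)
      (Φ : modifiedSeries R K (Fin m) ≃ₗ[R] Module.Dual R G.U),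
      (∀ j, b j = G.orderedMonomial j) ∧
      (G.functionsHopf K hs).IsCompleteHopfAlgebra ∧
      G.dualHopf.IsCompleteHopfAlgebra ∧
      (∀ (f : modifiedSeries R K (Fin m)) (w : List G.LieAlg),
        algebraMap R K (Φ f (w.map (UniversalEnvelopingAlgebra.ι R)).prod) =
          G.wordFunctional K w f.1) ∧
      (G.functionsHopf K hs).IsIso G.dualHopf Φ ∧
      (∀ n f, f ∈ (G.functionsHopf K hs).fil n ↔ Φ f ∈ G.dualHopf.fil n) ∧
      (∀ j, Φ (modifiedMonomial R K j) - multiFactorial j • b.coord j ∈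
        G.dualHopf.fil (j.degree + 1)) := by
  obtain ⟨s, hs⟩ := G.exists_isInverse
  exact ⟨s, hs, G.monomialBasis, G.pairingEquiv K, G.monomialBasis_apply,
    FormalGroupLaw.isCompleteHopfAlgebra_functionsHopf hs K,
    G.isCompleteHopfAlgebra_dualHopf K hs,
    fun f w => (algebraMap_modifiedEval R K _).trans (G.wordFunctional_eq K w f).symm,
    G.isIso_pairingEquiv K hs, G.mem_fil_iff K, G.pairing_modifiedMonomial_sub_mem K⟩
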